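/- For $a\in\mathbb{C}$ let $f_a(z)=z^3+az^2+z$, let $J_a$ be its Julia set, let $\mathcal{C}_1=\{a\in\mathbb{C}: J_a \text{ is connected}\}$ and $\mathcal{H}_\infty=\mathbb{C}\setminus\mathcal{C}_1$. For $a\in\mathbb{C}\setminus[-\sqrt3,\sqrt3]$ let $c_-(a)$ be the critical point of $f_a$ that depends continuously on $a$ and equals $\frac{-a-\sqrt{a^2-3}}{3}$ for $\operatorname{Re}a>0$ and $\frac{-a+\sqrt{a^2-3}}{3}$ for $\operatorname{Re}a<0$ (principal square root), and let $v_-(a)=f_a(c_-(a))$. Let $G_a(z)=\lim_{n}3^{-n}\log^+|f_a^n(z)|$ be the Green function of $f_a$, and let $\phi_a^\infty$ be the Böttcher coordinate of $f_a$ at $\infty$, i.e. the holomorphic function on $U_a=\{z: G_a(z)>G_a(c)\text{ for every critical point }c\text{ of }f_a\}$ with $\phi_a^\infty\circ f_a=(\phi_a^\infty)^3$ and $\phi_a^\infty(z)/z\to1$ as $z\to\infty$. Then $\mathcal{H}_\infty$ is connected. For every $a\in\mathcal{H}_\infty$ one has $a\notin[-\sqrt3,\sqrt3]$, the Böttcher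 coordinate $\phi_a^\infty$ exists on $U_a$, and $v_-(a)\in U_a$. The map $\Phi_\infty(a)=\phi_a^\infty(v_-(a))$ is holomorphic on $\mathcal{H}_\infty$, and, extended by $\Phi_\infty(\infty)=\infty$, it is a branched covering of degree $3$ from $\mathcal{H}_\infty\cup\{\infty\}$ onto $(\mathbb{C}\setminus\overline{\mathbb{D}})\cup\{\infty\}$ whose only ramification point is $\infty$; in particular it restricts to an unramified covering $\mathcal{H}_\infty\to\mathbb{C}\setminus\overline{\mathbb{D}}$ of degree $3$. -/

import Mathlib

open Filter Topology
open scoped OnePoint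

noncomputable section

namespace PerOne

/-- The cubic polynomial `f_a(z) = z³ + a z² + z`, with a parabolic fixed point at `0`. -/
def f (a z : ℂ) : ℂ := z ^ 3 + a * z ^ 2 + z

/-- The filled Julia set of `f_a`: the points with bounded orbit. -/
def filledJulia (a : ℂ) : Set ℂ :=
  {z | Bornology.IsBounded (Set.range fun n : ℕ => (f a)^[n] z)}

/-- The Julia set of the polynomial `f_a`, as the boundary of the filled Julia set. -/
def julia (a : ℂ) : Set ℂ := frontier (filledJulia a)

/-- The connectedness locus `𝒞₁`. -/
def connectedLocus : Set ℂ := {a | IsConnected (julia a)}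

/-- The escape locus `ℋ_∞ = ℂ ∖ 𝒞₁`. -/
def escapeLocus : Set ℂ := connectedLocusᶜ

/-- The real segment `[-√3, √3]`. -/
def slit : Set ℂ := {a | a.im = 0 ∧ |a.re| ≤ √3}

/-- The principal square root. -/
def csqrt (z : ℂ) : ℂ := z ^ (1 / 2 : ℂ)

/-- The critical point `c_-(a)`: the branch, holomorphic on `ℂ ∖ [-√3, √3]`, which equals
`(-a - √(a² - 3)) / 3` for `Re a > 0` and `(-a + √(a² - 3)) / 3` for `Re a < 0`
(see `cMinus_of_re_pos`, `cMinus_of_re_neg`, `continuousOn_cMinus`). -/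
def cMinus (a : ℂ) : ℂ := (-a - a * csqrt (1 - 3 / a ^ 2)) / 3

/-- The critical value `v_-(a) = f_a(c_-(a))`. -/
def vMinus (a : ℂ) : ℂ := f a (cMinus a)

/-- The Green function `G_a(z) = lim 3⁻ⁿ log⁺ |f_aⁿ(z)|` (the limit exists for all `a`, `z`). -/
def green (a z : ℂ) : ℝ :=
  limUnder atTop fun n : ℕ => Real.posLog ‖(f a)^[n] z‖ / 3 ^ n

/-- The natural domain of the Böttcher coordinate at `∞`: the points at which the Green function
is larger than at every critical point of `f_a`. -/
def bottcherDomain (a : ℂ) : Set ℂ := {z | ∀ c, deriv (f a) c = 0 → green a c < green a z}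

/-- `φ` is the Böttcher coordinate of `f_a` at `∞`, on its natural domain, normalized to be tangent
to the identity at `∞`. These conditions determine `φ` on `bottcherDomain a`. -/
structure IsBottcher (a : ℂ) (φ : ℂ → ℂ) : Prop where
  holomorphic : DifferentiableOn ℂ φ (bottcherDomain a)
  conj : ∀ z ∈ bottcherDomain a, φ (f a z) = φ z ^ 3
  tangent : Tendsto (fun z => φ z / z) (Bornology.cobounded ℂ) (𝓝 1)

/-- The normalized Böttcher coordinate `φ_a^∞`, meaningful on `bottcherDomain a`. -/
def bottcher (a : ℂ) : ℂ → ℂ := Classical.epsilon (IsBottcher a)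

/-- The parameter map `Φ_∞(a) = φ_a^∞(v_-(a))`. -/
def Phi (a : ℂ) : ℂ := bottcher a (vMinus a)

/-- `f` restricts to a branched covering `U → V` of degree `d` between open subsets of surfaces,
with local degree `e x` at `x ∈ U`: each `y ∈ V` has an open neighbourhood, with a coordinate onto
the unit disc centred at `y`, whose preimage in `U` is the disjoint union of open sets, one around
each `x` in the finite fibre over `y`, with coordinates onto the unit disc centred at `x` in which
`f` is `w ↦ w ^ e x`; the local degrees over `y` add up to `d`. -/
structure IsBranchedCoveringOn {X Y : Type*} [TopologicalSpace X] [TopologicalSpace Y]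
    (f : X → Y) (U : Set X) (V : Set Y) (d : ℕ) (e : X → ℕ) : Prop where
  mapsTo : Set.MapsTo f U V
  model : ∀ y ∈ V, ∃ (F : Finset X) (ψ : OpenPartialHomeomorph Y ℂ)
      (χ : X → OpenPartialHomeomorph X ℂ),
    (F : Set X) = U ∩ f ⁻¹' {y} ∧ ∑ x ∈ F, e x = d ∧
    y ∈ ψ.source ∧ ψ.source ⊆ V ∧ ψ y = 0 ∧ ψ.target = Metric.ball 0 1 ∧
    U ∩ f ⁻¹' ψ.source = ⋃ x ∈ F, (χ x).source ∧
    (F : Set X).PairwiseDisjoint (fun x => (χ x).source) ∧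
    ∀ x ∈ F, x ∈ (χ x).source ∧ χ x x = 0 ∧ (χ x).target = Metric.ball 0 1 ∧ 0 < e x ∧
      ∀ u ∈ (χ x).source, ψ (f u) = χ x u ^ e x

/-- The subset `S ∪ {∞}` of the Riemann sphere. -/
def withInfty (S : Set ℂ) : Set (OnePoint ℂ) := insert ∞ ((↑) '' S)

theorem csqrt_sq (z : ℂ) : csqrt z ^ 2 = z := by
  simp only [csqrt, one_div]
  exact Complex.cpow_nat_inv_pow z two_ne_zero

theorem csqrt_re_nonneg (z : ℂ) : 0 ≤ (csqrt z).re := by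
  by_cases hz : z = 0
  · simp [csqrt, hz]
  · have h2 : Complex.log z * (1 / 2) = ((Complex.log z) / 2) := by ring
    rw [csqrt, Complex.cpow_def_of_ne_zero hz, Complex.exp_re]
    refine mul_nonneg (Real.exp_pos _).le (Real.cos_nonneg_of_mem_Icc ?_)
    have h : (Complex.log z * (1 / 2)).im = z.arg / 2 := by
      rw [h2]; simp [Complex.log_im]
    rw [h]
    constructor <;> linarith [Complex.neg_pi_lt_arg z, Complex.arg_le_pi z]

theorem ne_zero_of_not_mem_slit {a : ℂ} (ha : a ∉ slit) : a ≠ 0 := by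
  rintro rfl
  exact ha ⟨rfl, by simp⟩

theorem slit_aux {a : ℂ} (ha : a ∉ slit) : 1 - 3 / a ^ 2 ∈ Complex.slitPlane := by
  have h0 := ne_zero_of_not_mem_slit ha
  by_contra h
  rw [Complex.mem_slitPlane_iff, not_or, not_lt, not_not] at h
  obtain ⟨hr, hi⟩ := h
  set w : ℂ := 1 - 3 / a ^ 2 with hw
  have e : a ^ 2 * (1 - w) = 3 := by rw [hw]; field_simp; ring
  have e1 := congrArg Complex.re e
  have e2 := congrArg Complex.im e
  simp [pow_two, hi] at e1 e2
  have hpos : 0 < 1 - w.re := by linarith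
  have e3 : a.re * a.im = 0 := by
    rcases e2 with h | h
    · nlinarith
    · linarith
  have hre : a.im = 0 := by
    rcases mul_eq_zero.1 e3 with h | h
    · rw [h] at e1; nlinarith [mul_nonneg (mul_self_nonneg a.im) hpos.le]
    · exact h
  refine ha ⟨hre, Real.abs_le_sqrt ?_⟩
  rw [hre] at e1
  nlinarith [mul_nonneg (mul_self_nonneg a.re) (neg_nonneg.2 hr)]

theorem csqrt_re_pos {z : ℂ} (hz : z ∈ Complex.slitPlane) : 0 < (csqrt z).re := by
  refine lt_of_le_of_ne (csqrt_re_nonneg z) fun h => ?_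
  have e := csqrt_sq z
  have e1 := congrArg Complex.re e
  have e2 := congrArg Complex.im e
  simp [pow_two, ← h] at e1 e2
  rcases Complex.mem_slitPlane_iff.1 hz with h1 | h1
  · nlinarith [mul_self_nonneg (csqrt z).im]
  · exact h1 e2.symm

theorem cMinus_of_re_pos {a : ℂ} (ha : a ∉ slit) (hre : 0 < a.re) :
    cMinus a = (-a - csqrt (a ^ 2 - 3)) / 3 := by
  have h0 := ne_zero_of_not_mem_slit ha
  have hw := csqrt_re_pos (slit_aux ha)
  have hw2 := csqrt_sq (1 - 3 / a ^ 2)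
  have hq := csqrt_re_nonneg (a ^ 2 - 3)
  have hq2 := csqrt_sq (a ^ 2 - 3)
  unfold cMinus
  set w := csqrt (1 - 3 / a ^ 2)
  set q := csqrt (a ^ 2 - 3)
  have hs : q ^ 2 = (a * w) ^ 2 := by rw [mul_pow, hw2, hq2]; field_simp
  rcases sq_eq_sq_iff_eq_or_eq_neg.1 hs with h | h
  · rw [h]
  · exfalso
    set s := a * w with hsdef
    have hs1 : s.re ≤ 0 := by rw [h] at hq; simpa using hq
    have e := congrArg Complex.im (hs.symm.trans hq2)
    simp [pow_two] at e
    have hre1 : s.re = a.re * w.re - a.im * w.im := by rw [hsdef, Complex.mul_re]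
    have him1 : s.im = a.re * w.im + a.im * w.re := by rw [hsdef, Complex.mul_im]
    have h3 : s.re * a.re + s.im * a.im = w.re * (a.re ^ 2 + a.im ^ 2) := by
      rw [hre1, him1]; ring
    have h4 : 0 < w.re * (a.re ^ 2 + a.im ^ 2) := by positivity
    have h5 : 0 < s.im * a.im := by nlinarith
    have h6 : a.im ≠ 0 := by rintro h; simp [h] at h5
    have h7 : 0 < a.re * a.im ^ 2 := by positivity
    have h8 : s.re * (s.im * a.im) = a.re * a.im ^ 2 := by
      have : s.re * s.im = a.re * a.im := by linarith
      rw [← mul_assoc, this]; ring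
    nlinarith [mul_nonneg (neg_nonneg.2 hs1) h5.le]

theorem cMinus_of_re_neg {a : ℂ} (ha : a ∉ slit) (hre : a.re < 0) :
    cMinus a = (-a + csqrt (a ^ 2 - 3)) / 3 := by
  have hn : -a ∉ slit := by simpa [slit] using ha
  have h := cMinus_of_re_pos hn (by simpa using hre)
  have h2 : cMinus (-a) = -cMinus a := by
    unfold cMinus; rw [neg_sq]; ring
  rw [h2, neg_sq] at h
  linear_combination -h

theorem continuousOn_cMinus : ContinuousOn cMinus slitᶜ := by
  intro a ha
  have h0 := ne_zero_of_not_mem_slit ha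
  have h1 : ContinuousAt (fun a : ℂ => 1 - 3 / a ^ 2) a := by
    fun_prop (disch := simpa using h0)
  have h2 : ContinuousAt (fun a : ℂ => csqrt (1 - 3 / a ^ 2)) a :=
    ContinuousAt.comp (g := csqrt) (continuousAt_cpow_const (slit_aux ha)) h1
  apply ContinuousAt.continuousWithinAt
  unfold cMinus
  fun_prop

end PerOne

end

noncomputable section

namespace PerOne

/-! ### Escape estimates and the Green function -/

/-! Let `G_a` be the Green function and `critGreen a` its largest value at a critical point. The
Julia set is connected exactly when `critGreen a = 0` (`escapeLocus_eq`). On the remaining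
parameters everything reduces to a cube root of `Phi`. Besides the double preimage `c_-`, the value
`v_-` has one simple preimage, the cocritical point `coCrit a`; it lies at level `critGreen a`, on
the boundary of the Böttcher domain, and the Böttcher coordinate extends to it along a ray. The
resulting function `coPhi` satisfies `coPhi ^ 3 = Phi` and is a homeomorphism of the escape locus
onto `{1 < |w|}`, proper at `∞`. In the coordinates `1 / coPhi` and `1 / w` the extended `Phi` is `u
↦ u ^ 3` on the unit disc, which yields the degree and the only ramification point; connectedness of
the escape locus also follows from the homeomorphism.

The Böttcher coordinate is handled through its inverse `psi a ζ`, with `ζ = log φ` and `critGreen a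
< Re ζ`. Near infinity this inverts a small perturbation of the identity. It is continued to the
left by lifting `ζ ↦ psi a (3ζ)` through `f a`, for all `a` at once: `(a, z) ↦ (a, f a z)` is a
covering off the critical values (`isCoveringMapOn_family`), and the domain of pairs `(a, ζ)` is
contractible. The map `psi a` is injective modulo `2πi` (`psi_eq_iff`) and onto (`exists_psi_eq`),
and preimages depend holomorphically on parameters (`exists_analytic_psi_preimage`).

The parabolic point `0` forces a critical point into the filled Julia set
(`exists_crit_green_eq_zero`), so at most one escapes. The critical points have product `1/3`, and a
maximum principle in the plane of the critical point shows that the escaping one satisfies `3|c|² >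
1` (`one_lt_of_green_pos`); hence it is `c_-`, and `a` is off the slit. Of the three rays over
`v_-`, two land at `c_-` and one at `coCrit a` (`lands_trichotomy`). The two rays meeting at `c_-`
disconnect the Julia set (`not_isPreconnected_julia`).

Finally `coPhi` is open and proper, hence onto. It is injective near infinity because `Phi a ~
(4/27) a³`, and globally because a collision of largest modulus could be pushed further out
(`injOn_coPhi`). -/

/-- An escape radius for `f a`. -/
def escR (a : ℂ) : ℝ := 4 * (1 + ‖a‖)

/-- The relative deviation of `f a z` from `z ^ 3`. -/
def dev (a z : ℂ) : ℂ := a / z + 1 / z ^ 2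

theorem four_le_escR (a : ℂ) : 4 ≤ escR a := by
  unfold escR; linarith [norm_nonneg a]

theorem escR_pos (a : ℂ) : 0 < escR a := by linarith [four_le_escR a]

theorem continuous_escR : Continuous escR := by unfold escR; fun_prop

theorem continuous_f : Continuous fun p : ℂ × ℂ => f p.1 p.2 := by unfold f; fun_prop

theorem continuous_f_iterate (n : ℕ) : Continuous fun p : ℂ × ℂ => (f p.1)^[n] p.2 := by
  induction n with
  | zero => simpa using continuous_snd
  | succ n ih =>
    simp only [Function.iterate_succ_apply', f]
    fun_prop

theorem ne_zero_of_escR_le {a z : ℂ} (hz : escR a ≤ ‖z‖) : z ≠ 0 := by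
  rw [← norm_pos_iff]; linarith [escR_pos a]

theorem f_eq_mul {a z : ℂ} (hz : z ≠ 0) : f a z = z ^ 3 * (1 + dev a z) := by
  unfold f dev; field_simp; ring

theorem norm_dev_le {a z : ℂ} (hz : escR a ≤ ‖z‖) : ‖dev a z‖ ≤ (1 + ‖a‖) / ‖z‖ := by
  have h4 := four_le_escR a
  have h1 : 1 ≤ ‖z‖ := by linarith
  unfold dev
  calc ‖a / z + 1 / z ^ 2‖ ≤ ‖a‖ / ‖z‖ + 1 / ‖z‖ ^ 2 := by
        refine (norm_add_le _ _).trans (le_of_eq ?_)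
        simp
    _ ≤ ‖a‖ / ‖z‖ + 1 / ‖z‖ := by
        gcongr
        nlinarith
    _ = _ := by ring

theorem norm_dev_le_half {a z : ℂ} (hz : escR a ≤ ‖z‖) : ‖dev a z‖ ≤ 1 / 2 := by
  have h4 := four_le_escR a
  refine (norm_dev_le hz).trans ?_
  rw [div_le_iff₀ (by linarith)]
  unfold escR at hz
  linarith [norm_nonneg a]

theorem norm_f_lower {a z : ℂ} (hz : escR a ≤ ‖z‖) : ‖z‖ ^ 3 / 2 ≤ ‖f a z‖ := by
  rw [f_eq_mul (ne_zero_of_escR_le hz), norm_mul, norm_pow]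
  have h := norm_dev_le_half hz
  have h2 : 1 - ‖dev a z‖ ≤ ‖1 + dev a z‖ := by
    have := norm_sub_norm_le (1 : ℂ) (-dev a z)
    simpa using this
  have : 0 ≤ ‖z‖ ^ 3 := by positivity
  nlinarith

theorem norm_f_upper {a z : ℂ} (hz : escR a ≤ ‖z‖) : ‖f a z‖ ≤ 2 * ‖z‖ ^ 3 := by
  rw [f_eq_mul (ne_zero_of_escR_le hz), norm_mul, norm_pow]
  have h := norm_dev_le_half hz
  have h2 : ‖1 + dev a z‖ ≤ 1 + ‖dev a z‖ := by
    simpa using norm_add_le (1 : ℂ) (dev a z)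
  have : 0 ≤ ‖z‖ ^ 3 := by positivity
  nlinarith

theorem two_mul_norm_le {a z : ℂ} (hz : escR a ≤ ‖z‖) : 2 * ‖z‖ ≤ ‖f a z‖ := by
  have h := norm_f_lower hz
  have h4 := four_le_escR a
  have : 4 ≤ ‖z‖ := by linarith
  nlinarith [mul_nonneg (norm_nonneg z) (by nlinarith : (0 : ℝ) ≤ ‖z‖ ^ 2 - 4)]

theorem pow_mul_norm_le {a z : ℂ} (hz : escR a ≤ ‖z‖) (n : ℕ) :
    2 ^ n * ‖z‖ ≤ ‖(f a)^[n] z‖ := by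
  induction n with
  | zero => simp
  | succ n ih =>
    have h1 : escR a ≤ ‖(f a)^[n] z‖ := by
      refine hz.trans (le_trans ?_ ih)
      exact le_mul_of_one_le_left (norm_nonneg _) (one_le_pow₀ (by norm_num))
    rw [Function.iterate_succ_apply']
    have := two_mul_norm_le h1
    rw [pow_succ]; linarith

theorem norm_le_norm_iterate {a z : ℂ} (hz : escR a ≤ ‖z‖) (n : ℕ) :
    ‖z‖ ≤ ‖(f a)^[n] z‖ :=
  (le_mul_of_one_le_left (norm_nonneg _) (one_le_pow₀ (by norm_num))).trans (pow_mul_norm_le hz n)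

theorem escR_le_norm_iterate {a z : ℂ} (hz : escR a ≤ ‖z‖) (n : ℕ) :
    escR a ≤ ‖(f a)^[n] z‖ := hz.trans (norm_le_norm_iterate hz n)

/-- The constant in the comparison of `log⁺ |f a z|` and `3 log⁺ |z|`. -/
def greenBound (a : ℂ) : ℝ := Real.log 2 + 3 * Real.log (escR a)

theorem greenBound_nonneg (a : ℂ) : 0 ≤ greenBound a := by
  have := Real.log_nonneg (by linarith [four_le_escR a] : 1 ≤ escR a)
  have := Real.log_nonneg (by norm_num : (1 : ℝ) ≤ 2)
  unfold greenBound; linarith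

theorem continuous_greenBound : Continuous greenBound := by
  unfold greenBound
  exact continuous_const.add (continuous_const.mul
    (continuous_escR.log fun a => (escR_pos a).ne'))

/-- Beyond the escape radius `f a z / z ^ 3` lies between `1/2` and `2` in modulus; inside it both
terms are bounded outright. The bound is uniform in `z` and continuous in `a`, so the Green function
is a locally uniform limit in both variables. -/
theorem abs_posLog_f_sub_le (a z : ℂ) :
    |Real.posLog ‖f a z‖ - 3 * Real.posLog ‖z‖| ≤ greenBound a := by
  have h4 := four_le_escR a
  have hR := Real.log_nonneg (by linarith : 1 ≤ escR a)
  have h2 := Real.log_nonneg (by norm_num : (1 : ℝ) ≤ 2)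
  rcases le_or_gt (escR a) ‖z‖ with hz | hz
  · have hz1 : 1 ≤ ‖z‖ := by linarith
    have hf1 : 1 ≤ ‖f a z‖ := by linarith [two_mul_norm_le hz]
    rw [Real.posLog_eq_log (by rwa [abs_norm]), Real.posLog_eq_log (by rwa [abs_norm])]
    have hz0 : 0 < ‖z‖ := by linarith
    have hu := Real.log_le_log (by linarith) (norm_f_upper hz)
    have hl := Real.log_le_log (by positivity) (norm_f_lower hz)
    rw [Real.log_mul (by norm_num) (by positivity), Real.log_pow] at hu
    rw [Real.log_div (by positivity) (by norm_num), Real.log_pow] at hl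
    push_cast at hu hl
    unfold greenBound
    rw [abs_le]; constructor <;> linarith
  · have hf : ‖f a z‖ ≤ 2 * escR a ^ 3 := by
      have e : ‖f a z‖ ≤ ‖z‖ ^ 3 + ‖a‖ * ‖z‖ ^ 2 + ‖z‖ := by
        unfold f
        refine (norm_add₃_le).trans (le_of_eq ?_)
        simp
      have e1 : ‖a‖ ≤ escR a / 4 := by unfold escR; linarith
      calc ‖f a z‖ ≤ ‖z‖ ^ 3 + ‖a‖ * ‖z‖ ^ 2 + ‖z‖ := e
        _ ≤ escR a ^ 3 + escR a / 4 * escR a ^ 2 + escR a := by gcongr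
        _ ≤ 2 * escR a ^ 3 := by nlinarith [mul_nonneg (escR_pos a).le (by nlinarith : (0:ℝ) ≤ escR a ^ 2 - 4)]
    have b1 : Real.posLog ‖f a z‖ ≤ greenBound a := by
      refine (Real.posLog_le_posLog (norm_nonneg _) hf).trans (le_of_eq ?_)
      rw [Real.posLog_eq_log, Real.log_mul (by norm_num) (by positivity [escR_pos a]), Real.log_pow]
      · unfold greenBound; push_cast; ring
      · rw [abs_of_pos (by have := escR_pos a; positivity)]
        nlinarith [one_le_pow₀ (by linarith : 1 ≤ escR a) (n := 3)]
    have b2 : Real.posLog ‖z‖ ≤ Real.log (escR a) := by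
      refine (Real.posLog_le_posLog (norm_nonneg _) hz.le).trans (le_of_eq ?_)
      rw [Real.posLog_eq_log]
      rw [abs_of_pos (escR_pos a)]; linarith
    have p1 : 0 ≤ Real.posLog ‖f a z‖ := Real.posLog_nonneg
    have p2 : 0 ≤ Real.posLog ‖z‖ := Real.posLog_nonneg
    have : 3 * Real.log (escR a) ≤ greenBound a := by unfold greenBound; linarith
    rw [abs_le]; constructor <;> linarith

theorem dist_greenSeq_le (a z : ℂ) (n : ℕ) :
    dist (Real.posLog ‖(f a)^[n] z‖ / 3 ^ n) (Real.posLog ‖(f a)^[n + 1] z‖ / 3 ^ (n + 1))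
      ≤ greenBound a / 3 * (1 / 3) ^ n := by
  rw [dist_comm, Real.dist_eq, Function.iterate_succ_apply']
  have h := abs_posLog_f_sub_le a ((f a)^[n] z)
  have e : Real.posLog ‖f a ((f a)^[n] z)‖ / 3 ^ (n + 1) - Real.posLog ‖(f a)^[n] z‖ / 3 ^ n =
      (Real.posLog ‖f a ((f a)^[n] z)‖ - 3 * Real.posLog ‖(f a)^[n] z‖) / 3 ^ (n + 1) := by
    rw [pow_succ]; field_simp
  rw [e, abs_div, abs_of_pos (by positivity : (0 : ℝ) < 3 ^ (n + 1)), one_div, inv_pow, pow_succ]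
  rw [div_le_iff₀ (by positivity)]
  refine h.trans (le_of_eq ?_)
  field_simp

theorem tendsto_green (a z : ℂ) :
    Tendsto (fun n : ℕ => Real.posLog ‖(f a)^[n] z‖ / 3 ^ n) atTop (𝓝 (green a z)) :=
  (cauchySeq_of_le_geometric (1 / 3) _ (by norm_num) (dist_greenSeq_le a z)).tendsto_limUnder

theorem dist_greenSeq_green_le (a z : ℂ) (n : ℕ) :
    dist (Real.posLog ‖(f a)^[n] z‖ / 3 ^ n) (green a z) ≤ greenBound a * (1 / 3) ^ n := by
  have h := dist_le_of_le_geometric_of_tendsto (1 / 3) _ (by norm_num) (dist_greenSeq_le a z)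
    (tendsto_green a z) n
  refine h.trans ?_
  have := greenBound_nonneg a
  have : (0 : ℝ) ≤ (1 / 3) ^ n := by positivity
  rw [div_le_iff₀ (by norm_num)]
  nlinarith [mul_nonneg (greenBound_nonneg a) this]

theorem green_nonneg (a z : ℂ) : 0 ≤ green a z :=
  ge_of_tendsto' (tendsto_green a z) fun n => div_nonneg Real.posLog_nonneg (by positivity)

theorem green_f (a z : ℂ) : green a (f a z) = 3 * green a z := by
  refine tendsto_nhds_unique (tendsto_green a (f a z)) ?_
  have h := ((tendsto_add_atTop_iff_nat 1).2 (tendsto_green a z)).const_mul 3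
  refine h.congr fun n => ?_
  rw [← Function.iterate_succ_apply, pow_succ]
  field_simp

theorem green_f_iterate (a z : ℂ) (n : ℕ) : green a ((f a)^[n] z) = 3 ^ n * green a z := by
  induction n with
  | zero => simp
  | succ n ih => rw [Function.iterate_succ_apply', green_f, ih, pow_succ]; ring

theorem continuous_green : Continuous fun p : ℂ × ℂ => green p.1 p.2 := by
  have key : TendstoLocallyUniformly
      (fun (n : ℕ) (p : ℂ × ℂ) => Real.posLog ‖(f p.1)^[n] p.2‖ / 3 ^ n)
      (fun p => green p.1 p.2) atTop := by
    rw [Metric.tendstoLocallyUniformly_iff]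
    intro ε hε p
    have hc : Continuous fun q : ℂ × ℂ => greenBound q.1 := continuous_greenBound.comp continuous_fst
    refine ⟨{q | greenBound q.1 < greenBound p.1 + 1},
      hc.continuousAt.eventually_lt continuousAt_const (by simp), ?_⟩
    have ht : Tendsto (fun n : ℕ => (greenBound p.1 + 1) * (1 / 3 : ℝ) ^ n) atTop (𝓝 0) := by
      simpa using (tendsto_pow_atTop_nhds_zero_of_lt_one (by norm_num) (by norm_num :
        (1 / 3 : ℝ) < 1)).const_mul (greenBound p.1 + 1)
    filter_upwards [ht.eventually_lt_const hε] with n hn q hq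
    rw [dist_comm]
    refine (dist_greenSeq_green_le q.1 q.2 n).trans_lt (lt_of_le_of_lt ?_ hn)
    gcongr
  refine key.continuous (Frequently.of_forall fun n => ?_)
  exact (Real.continuous_posLog.comp (continuous_f_iterate n).norm).div_const _

theorem green_eq_zero_of_bounded {a z : ℂ} {C : ℝ} (h : ∀ n, ‖(f a)^[n] z‖ ≤ C) :
    green a z = 0 := by
  refine le_antisymm ?_ (green_nonneg a z)
  have ht : Tendsto (fun n : ℕ => Real.posLog C * (1 / 3 : ℝ) ^ n) atTop (𝓝 0) := by
    simpa using (tendsto_pow_atTop_nhds_zero_of_lt_one (by norm_num) (by norm_num :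
      (1 / 3 : ℝ) < 1)).const_mul (Real.posLog C)
  refine le_of_tendsto_of_tendsto' (tendsto_green a z) ht fun n => ?_
  rw [one_div, inv_pow, ← div_eq_mul_inv]
  gcongr
  exact h n

/-- By `|f z| ≥ |z|³ / 2`, the quantity `log |z| - log 2` at least triples under `f a`: the two
terms `log 2` lost are fewer than the three allowed. -/
theorem log_norm_sub_le_green {a z : ℂ} (hz : escR a ≤ ‖z‖) :
    Real.log ‖z‖ - Real.log 2 ≤ green a z := by
  have key : ∀ n : ℕ, (Real.log ‖z‖ - Real.log 2) * 3 ^ n ≤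
      Real.log ‖(f a)^[n] z‖ - Real.log 2 := by
    intro n
    induction n with
    | zero => simp
    | succ n ih =>
      have h1 := escR_le_norm_iterate hz n
      have h0 : 0 < ‖(f a)^[n] z‖ := (escR_pos a).trans_le h1
      have hl := Real.log_le_log (by positivity) (norm_f_lower h1)
      rw [Real.log_div (by positivity) (by norm_num), Real.log_pow] at hl
      push_cast at hl
      rw [Function.iterate_succ_apply', pow_succ]
      have := Real.log_nonneg (by norm_num : (1 : ℝ) ≤ 2)
      nlinarith
  refine ge_of_tendsto' (tendsto_green a z) fun n => ?_
  rw [le_div_iff₀ (by positivity)]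
  refine (key n).trans ?_
  have := Real.log_nonneg (by norm_num : (1 : ℝ) ≤ 2)
  have h := le_max_right 0 (Real.log ‖(f a)^[n] z‖)
  rw [Real.posLog]; linarith

theorem green_pos_of_escR_le {a z : ℂ} (hz : escR a ≤ ‖z‖) : 0 < green a z := by
  refine lt_of_lt_of_le ?_ (log_norm_sub_le_green hz)
  have := Real.log_lt_log (by norm_num) (by linarith [four_le_escR a] : (2 : ℝ) < ‖z‖)
  linarith

theorem norm_iterate_lt_of_green_eq_zero {a z : ℂ} (h : green a z = 0) (n : ℕ) :
    ‖(f a)^[n] z‖ < escR a := by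
  by_contra! hn
  have := green_pos_of_escR_le hn
  rw [green_f_iterate, h] at this
  simp at this

theorem mem_filledJulia_iff {a z : ℂ} : z ∈ filledJulia a ↔ green a z = 0 := by
  constructor
  · intro h
    obtain ⟨C, hC⟩ := isBounded_iff_forall_norm_le.1 
      (show Bornology.IsBounded (Set.range fun n : ℕ => (f a)^[n] z) from h)
    exact green_eq_zero_of_bounded fun n => hC _ ⟨n, rfl⟩
  · intro h
    refine (isBounded_iff_forall_norm_le.2 ⟨escR a, ?_⟩ : Bornology.IsBounded (Set.range fun n : ℕ => (f a)^[n] z))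
    rintro _ ⟨n, rfl⟩
    exact (norm_iterate_lt_of_green_eq_zero h n).le

theorem tendsto_norm_iterate {a z : ℂ} (h : 0 < green a z) :
    Tendsto (fun n => ‖(f a)^[n] z‖) atTop atTop := by
  obtain ⟨N, hN⟩ : ∃ N, escR a ≤ ‖(f a)^[N] z‖ := by
    by_contra! hn
    exact h.ne' (green_eq_zero_of_bounded fun n => (hn n).le)
  rw [← tendsto_add_atTop_iff_nat N]
  have h1 : Tendsto (fun n : ℕ => (2 : ℝ) ^ n * ‖(f a)^[N] z‖) atTop atTop :=
    (tendsto_pow_atTop_atTop_of_one_lt (by norm_num)).atTop_mul_const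
      ((escR_pos a).trans_le hN)
  refine tendsto_atTop_mono (fun n => ?_) h1
  rw [Function.iterate_add_apply]
  exact pow_mul_norm_le hN n

theorem green_le_posLog_add (a z : ℂ) : green a z ≤ Real.posLog ‖z‖ + greenBound a := by
  have := dist_greenSeq_green_le a z 0
  simp only [Function.iterate_zero, id, pow_zero, div_one, mul_one, Real.dist_eq] at this
  have := (abs_le.1 this).1
  linarith

theorem abs_green_sub_log_le {a z : ℂ} (hz : escR a ≤ ‖z‖) :
    |green a z - Real.log ‖z‖| ≤ greenBound a := by
  have := dist_greenSeq_green_le a z 0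
  simp only [Function.iterate_zero, id, pow_zero, div_one, mul_one] at this
  rwa [Real.posLog_eq_log (by rw [abs_norm]; linarith [four_le_escR a]), dist_comm,
    Real.dist_eq] at this

/-! ### The logarithmic Böttcher coordinate near infinity -/

/-- `log (φ_a(z) / z)` for `z` near infinity. -/
def hinf (a z : ℂ) : ℂ := ∑' n : ℕ, Complex.log (1 + dev a ((f a)^[n] z)) / 3 ^ (n + 1)

theorem norm_hinf_term_le {a z : ℂ} {δ : ℝ} (hz : escR a ≤ ‖z‖)
    (hδ : ∀ n, ‖dev a ((f a)^[n] z)‖ ≤ δ) (n : ℕ) :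
    ‖Complex.log (1 + dev a ((f a)^[n] z)) / 3 ^ (n + 1)‖ ≤ δ / 2 * (1 / 3) ^ n := by
  have h1 := Complex.norm_log_one_add_half_le_self
    (norm_dev_le_half (escR_le_norm_iterate hz n))
  have h2 := hδ n
  rw [norm_div, norm_pow, Complex.norm_ofNat, div_le_iff₀ (by positivity)]
  calc _ ≤ 3 / 2 * δ := by linarith
    _ = _ := by rw [one_div, inv_pow, pow_succ]; field_simp

theorem norm_hinf_term_le' {a z : ℂ} (hz : escR a ≤ ‖z‖) (n : ℕ) :
    ‖Complex.log (1 + dev a ((f a)^[n] z)) / 3 ^ (n + 1)‖ ≤ 1 / 4 * (1 / 3) ^ n := by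
  refine (norm_hinf_term_le hz (δ := 1 / 2)
    (fun n => norm_dev_le_half (escR_le_norm_iterate hz n)) n).trans (le_of_eq (by ring))

theorem summable_geom_third (C : ℝ) : Summable fun n : ℕ => C * (1 / 3 : ℝ) ^ n :=
  (summable_geometric_of_lt_one (by norm_num) (by norm_num)).mul_left C

theorem summable_hinf {a z : ℂ} (hz : escR a ≤ ‖z‖) :
    Summable fun n : ℕ => Complex.log (1 + dev a ((f a)^[n] z)) / 3 ^ (n + 1) :=
  Summable.of_norm_bounded (summable_geom_third _) (norm_hinf_term_le' hz)

theorem norm_hinf_le_of_dev {a z : ℂ} {δ : ℝ} (hz : escR a ≤ ‖z‖)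
    (hδ : ∀ n, ‖dev a ((f a)^[n] z)‖ ≤ δ) : ‖hinf a z‖ ≤ 3 / 4 * δ := by
  refine (tsum_of_norm_bounded (((hasSum_geometric_of_lt_one (by norm_num)
    (by norm_num : (1 / 3 : ℝ) < 1)).mul_left (δ / 2))) (norm_hinf_term_le hz hδ)).trans
    (le_of_eq (by ring))

theorem norm_hinf_le {a z : ℂ} (hz : escR a ≤ ‖z‖) : ‖hinf a z‖ ≤ 3 / 8 :=
  (norm_hinf_le_of_dev hz fun n => norm_dev_le_half (escR_le_norm_iterate hz n)).trans
    (le_of_eq (by norm_num))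

theorem norm_hinf_le_div {a z : ℂ} (hz : escR a ≤ ‖z‖) :
    ‖hinf a z‖ ≤ 3 / 4 * ((1 + ‖a‖) / ‖z‖) := by
  refine norm_hinf_le_of_dev hz fun n => ?_
  refine (norm_dev_le (escR_le_norm_iterate hz n)).trans ?_
  have := (escR_pos a).trans_le hz
  gcongr
  exact norm_le_norm_iterate hz n

/-- Removing the first term of the series shifts the orbit by one step. This is the logarithmic form
of `φ ∘ f = φ ^ 3`. -/
theorem hinf_f {a z : ℂ} (hz : escR a ≤ ‖z‖) :
    hinf a (f a z) = 3 * hinf a z - Complex.log (1 + dev a z) := by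
  have h := (summable_hinf hz).tsum_eq_zero_add
  rw [← hinf] at h
  rw [h, hinf]
  simp only [Function.iterate_zero, id, zero_add, pow_one]
  rw [mul_add, mul_div_cancel₀ _ (by norm_num : (3 : ℂ) ≠ 0), add_sub_cancel_left, ← tsum_mul_left]
  refine tsum_congr fun n => ?_
  rw [← Function.iterate_succ_apply, pow_succ _ (n + 1)]
  field_simp

theorem one_add_dev_mem_slitPlane {a z : ℂ} (hz : escR a ≤ ‖z‖) :
    1 + dev a z ∈ Complex.slitPlane :=
  Complex.mem_slitPlane_of_norm_lt_one ((norm_dev_le_half hz).trans_lt (by norm_num))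

theorem continuousOn_hinf :
    ContinuousOn (fun p : ℂ × ℂ => hinf p.1 p.2) {p | escR p.1 ≤ ‖p.2‖} := by
  refine continuousOn_tsum (u := fun n : ℕ => 1 / 4 * (1 / 3 : ℝ) ^ n) (fun n => ?_)
    (summable_geom_third _) fun n p hp => norm_hinf_term_le' hp n
  refine ContinuousOn.div_const ?_ _
  refine ContinuousOn.clog ?_ fun p hp => one_add_dev_mem_slitPlane (escR_le_norm_iterate hp n)
  have hc := (continuous_f_iterate n).continuousOn (s := {p : ℂ × ℂ | escR p.1 ≤ ‖p.2‖})
  have h0 : ∀ p ∈ {p : ℂ × ℂ | escR p.1 ≤ ‖p.2‖}, (f p.1)^[n] p.2 ≠ 0 := fun p hp =>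
    ne_zero_of_escR_le (escR_le_norm_iterate hp n)
  unfold dev
  refine continuousOn_const.add ((continuousOn_fst.div hc h0).add
    (continuousOn_const.div (hc.pow 2) fun p hp => pow_ne_zero 2 (h0 p hp)))

theorem differentiableOn_f_iterate {U : Set ℂ} {α g : ℂ → ℂ} (hα : DifferentiableOn ℂ α U)
    (hg : DifferentiableOn ℂ g U) (n : ℕ) :
    DifferentiableOn ℂ (fun t => (f (α t))^[n] (g t)) U := by
  induction n with
  | zero => simpa using hg
  | succ n ih =>
    simp only [Function.iterate_succ_apply', f]
    fun_prop

/-- Stated along a holomorphic curve `(α t, g t)`, so that holomorphy in the point and in the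
parameter are both instances of one statement in one variable. -/
theorem differentiableOn_hinf {U : Set ℂ} (hU : IsOpen U) {α g : ℂ → ℂ}
    (hα : DifferentiableOn ℂ α U) (hg : DifferentiableOn ℂ g U)
    (h : ∀ t ∈ U, escR (α t) ≤ ‖g t‖) : DifferentiableOn ℂ (fun t => hinf (α t) (g t)) U := by
  refine Complex.differentiableOn_tsum_of_summable_norm (summable_geom_third (1 / 4))
    (fun n => ?_) hU fun n t ht => norm_hinf_term_le' (h t ht) n
  refine DifferentiableOn.div_const ?_ _
  refine DifferentiableOn.clog ?_ fun t ht =>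
    one_add_dev_mem_slitPlane (escR_le_norm_iterate (h t ht) n)
  have hc := differentiableOn_f_iterate hα hg n
  have h0 : ∀ t ∈ U, (f (α t))^[n] (g t) ≠ 0 := fun t ht =>
    ne_zero_of_escR_le (escR_le_norm_iterate (h t ht) n)
  unfold dev
  exact (differentiableOn_const _).add ((hα.div hc h0).add
    ((differentiableOn_const _).div (hc.pow 2) fun t ht => pow_ne_zero 2 (h0 t ht)))

/-- The difference of the two sides is multiplied by `3` under `f a`, yet stays bounded along the
orbit; it therefore vanishes. -/
theorem green_eq_log_add {a z : ℂ} (hz : escR a ≤ ‖z‖) :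
    green a z = Real.log ‖z‖ + (hinf a z).re := by
  have step : ∀ z, escR a ≤ ‖z‖ → green a (f a z) - Real.log ‖f a z‖ - (hinf a (f a z)).re =
      3 * (green a z - Real.log ‖z‖ - (hinf a z).re) := by
    intro z hz
    have h0 := ne_zero_of_escR_le hz
    have h1 := Complex.slitPlane_ne_zero (one_add_dev_mem_slitPlane hz)
    rw [green_f, hinf_f hz, f_eq_mul h0, norm_mul, Real.log_mul (by simpa using h0) (by simpa using h1),
      norm_pow, Real.log_pow, Complex.sub_re, Complex.log_re]
    simp
    ring
  have iter : ∀ n : ℕ, green a ((f a)^[n] z) - Real.log ‖(f a)^[n] z‖ - (hinf a ((f a)^[n] z)).re =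
      3 ^ n * (green a z - Real.log ‖z‖ - (hinf a z).re) := by
    intro n
    induction n with
    | zero => simp
    | succ n ih =>
      rw [Function.iterate_succ_apply', step _ (escR_le_norm_iterate hz n), ih, pow_succ]; ring
  set D := green a z - Real.log ‖z‖ - (hinf a z).re with hD
  have bound : ∀ n : ℕ, |D| ≤ (greenBound a + 1) * (1 / 3 : ℝ) ^ n := by
    intro n
    have h1 := abs_green_sub_log_le (escR_le_norm_iterate hz n)
    have h2 := (Complex.abs_re_le_norm _).trans (norm_hinf_le (escR_le_norm_iterate hz n))
    have h3 : |3 ^ n * D| ≤ greenBound a + 1 := by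
      rw [← iter n]
      refine (abs_sub _ _).trans ?_
      linarith
    rw [abs_mul, abs_of_pos (by positivity : (0 : ℝ) < 3 ^ n)] at h3
    rw [one_div, inv_pow, ← div_eq_mul_inv, le_div_iff₀ (by positivity)]
    linarith
  have ht : Tendsto (fun n : ℕ => (greenBound a + 1) * (1 / 3 : ℝ) ^ n) atTop (𝓝 0) := by
    simpa using (tendsto_pow_atTop_nhds_zero_of_lt_one (by norm_num) (by norm_num :
      (1 / 3 : ℝ) < 1)).const_mul (greenBound a + 1)
  have : |D| ≤ 0 := ge_of_tendsto' ht bound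
  have := abs_eq_zero.1 (le_antisymm this (abs_nonneg _))
  linarith

/-- The logarithm of the escape radius. -/
def logR (a : ℂ) : ℝ := Real.log (escR a)

theorem continuous_logR : Continuous logR :=
  continuous_escR.log fun a => (escR_pos a).ne'

theorem logR_pos (a : ℂ) : 0 < logR a := Real.log_pos (by linarith [four_le_escR a])

theorem escR_le_norm_exp {a ξ : ℂ} : escR a ≤ ‖Complex.exp ξ‖ ↔ logR a ≤ ξ.re := by
  rw [Complex.norm_exp, logR, Real.log_le_iff_le_exp (escR_pos a)]

/-- The logarithmic Böttcher coordinate, in the variable `ξ = log z`. -/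
def logB (a ξ : ℂ) : ℂ := ξ + hinf a (Complex.exp ξ)

theorem logB_re {a ξ : ℂ} (h : logR a ≤ ξ.re) : (logB a ξ).re = green a (Complex.exp ξ) := by
  rw [green_eq_log_add (escR_le_norm_exp.2 h), logB, Complex.norm_exp, Real.log_exp,
    Complex.add_re]

theorem logB_add_int_mul (a ξ : ℂ) (k : ℤ) :
    logB a (ξ + k * (2 * Real.pi * Complex.I)) = logB a ξ + k * (2 * Real.pi * Complex.I) := by
  have : Complex.exp (ξ + k * (2 * Real.pi * Complex.I)) = Complex.exp ξ :=
    (Complex.exp_eq_exp_iff_exists_int.2 ⟨k, rfl⟩)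
  rw [logB, logB, this]; ring

theorem differentiableOn_hinf_exp (a : ℂ) :
    DifferentiableOn ℂ (fun ξ => hinf a (Complex.exp ξ)) {ξ | logR a < ξ.re} :=
  differentiableOn_hinf (isOpen_lt continuous_const Complex.continuous_re)
    (differentiableOn_const a) Complex.differentiable_exp.differentiableOn
    fun _ ht => escR_le_norm_exp.2 (le_of_lt ht)

/-- Cauchy's estimate on a disc of radius `3/4`, where the function is at most `3/8`. Consequently
`logB a` is the identity plus a contraction of ratio `1/2`, which makes it injective and solvable.
-/
theorem norm_deriv_hinf_exp_le {a ξ : ℂ} (h : logR a + 1 ≤ ξ.re) :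
    ‖deriv (fun ξ => hinf a (Complex.exp ξ)) ξ‖ ≤ 1 / 2 := by
  have hsub : Metric.closedBall ξ (3 / 4) ⊆ {ξ | logR a < ξ.re} := by
    intro x hx
    have h1 := (Complex.abs_re_le_norm (x - ξ)).trans (mem_closedBall_iff_norm.1 hx)
    rw [Complex.sub_re] at h1
    have := (abs_le.1 h1).1
    simp only [Set.mem_ofPred_eq]; linarith
  have := Complex.norm_deriv_le_of_forall_mem_sphere_norm_le (by norm_num : (0 : ℝ) < 3 / 4)
    (((differentiableOn_hinf_exp a).mono hsub).diffContOnCl_ball subset_rfl)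
    (C := 3 / 8) fun x hx =>
      norm_hinf_le (escR_le_norm_exp.2 (hsub (Metric.sphere_subset_closedBall hx)).le)
  exact this.trans (by norm_num)

theorem norm_hinf_exp_sub_le {a ξ ξ' : ℂ} (h : logR a + 1 ≤ ξ.re) (h' : logR a + 1 ≤ ξ'.re) :
    ‖hinf a (Complex.exp ξ) - hinf a (Complex.exp ξ')‖ ≤ 1 / 2 * ‖ξ - ξ'‖ := by
  refine (convex_halfSpace_re_ge (logR a + 1)).norm_image_sub_le_of_norm_deriv_le
    (f := fun ξ => hinf a (Complex.exp ξ)) (fun x hx => ?_)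
    (fun x hx => norm_deriv_hinf_exp_le hx) h' h
  refine (differentiableOn_hinf_exp a).differentiableAt
    ((isOpen_lt continuous_const Complex.continuous_re).mem_nhds ?_)
  have : logR a + 1 ≤ x.re := hx
  simp only [Set.mem_ofPred_eq]; linarith

theorem norm_sub_le_logB {a ξ ξ' : ℂ} (h : logR a + 1 ≤ ξ.re) (h' : logR a + 1 ≤ ξ'.re) :
    ‖ξ - ξ'‖ ≤ 2 * ‖logB a ξ - logB a ξ'‖ := by
  have h1 := norm_hinf_exp_sub_le h h'
  have e : ξ - ξ' = (logB a ξ - logB a ξ') -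
      (hinf a (Complex.exp ξ) - hinf a (Complex.exp ξ')) := by unfold logB; ring
  have h2 : ‖ξ - ξ'‖ ≤ ‖logB a ξ - logB a ξ'‖ +
      ‖hinf a (Complex.exp ξ) - hinf a (Complex.exp ξ')‖ := by
    conv_lhs => rw [e]
    exact norm_sub_le _ _
  linarith

/-- The equation reads `ξ = ζ - hinf a (exp ξ)` and is solved by Banach's fixed point theorem; the
correction has norm at most `3/8`, so the real part drops by less than `1/2`. -/
theorem exists_logB_eq {a ζ : ℂ} (h : logR a + 2 ≤ ζ.re) :
    ∃ ξ : ℂ, logR a + 3 / 2 ≤ ξ.re ∧ logB a ξ = ζ := by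
  set s : Set ℂ := {ξ | logR a + 1 ≤ ξ.re}
  set T : ℂ → ℂ := fun ξ => ζ - hinf a (Complex.exp ξ) with hT
  have hre : ∀ ξ ∈ s, logR a + 3 / 2 ≤ (T ξ).re := by
    intro ξ hξ
    have hξ' : logR a + 1 ≤ ξ.re := hξ
    have h1 := (Complex.abs_re_le_norm _).trans
      (norm_hinf_le (escR_le_norm_exp.2 (by linarith : logR a ≤ ξ.re)))
    have := (abs_le.1 h1).2
    simp only [hT, Complex.sub_re]; linarith
  have hmaps : Set.MapsTo T s s := fun ξ hξ => by
    have := hre ξ hξ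
    simp only [s, Set.mem_ofPred_eq]; linarith
  have hs : IsComplete s :=
    (isClosed_le continuous_const Complex.continuous_re).isComplete
  have hc : ContractingWith (1 / 2) (hmaps.restrict T s s) := by
    refine ⟨by norm_num, LipschitzWith.of_dist_le_mul fun x y => ?_⟩
    have := norm_hinf_exp_sub_le x.2 y.2
    rw [Subtype.dist_eq, Subtype.dist_eq, dist_eq_norm, dist_eq_norm]
    simp only [Set.MapsTo.val_restrict_apply, hT, sub_sub_sub_cancel_left]
    rw [norm_sub_rev]
    simpa using this
  obtain ⟨ξ, hξ, hfix, -⟩ := hc.exists_fixedPoint' hs hmaps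
    (x := ζ) (by simp only [s, Set.mem_ofPred_eq]; linarith) (edist_ne_top _ _)
  refine ⟨ξ, ?_, ?_⟩
  · have := hre ξ hξ
    rwa [hfix] at this
  · have : ζ - hinf a (Complex.exp ξ) = ξ := hfix
    rw [logB]; linear_combination -this

open Classical in
/-- The inverse of the logarithmic Böttcher coordinate. -/
def logBInv (a ζ : ℂ) : ℂ :=
  if h : logR a + 2 ≤ ζ.re then (exists_logB_eq h).choose else 0

theorem logBInv_re {a ζ : ℂ} (h : logR a + 2 ≤ ζ.re) : logR a + 3 / 2 ≤ (logBInv a ζ).re := by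
  rw [logBInv, dif_pos h]; exact (exists_logB_eq h).choose_spec.1

theorem logB_logBInv {a ζ : ℂ} (h : logR a + 2 ≤ ζ.re) : logB a (logBInv a ζ) = ζ := by
  rw [logBInv, dif_pos h]; exact (exists_logB_eq h).choose_spec.2

theorem logBInv_eq {a ζ ξ : ℂ} (h : logR a + 2 ≤ ζ.re) (hξ : logR a + 1 ≤ ξ.re)
    (e : logB a ξ = ζ) : logBInv a ζ = ξ := by
  have := norm_sub_le_logB (by linarith [logBInv_re h] : logR a + 1 ≤ (logBInv a ζ).re) hξ
  rw [logB_logBInv h, e, sub_self, norm_zero, mul_zero] at this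
  exact sub_eq_zero.1 (norm_le_zero_iff.1 this)

/-- The expansion estimate `norm_sub_le_logB` has the same constant for every parameter. Compared
with the fixed point `ξ₀`, it bounds `‖logBInv a ζ - ξ₀‖` by `2‖ζ - logB a ξ₀‖`, which tends to `0`.
-/
theorem continuousOn_logBInv :
    ContinuousOn (fun p : ℂ × ℂ => logBInv p.1 p.2) {p | logR p.1 + 2 < p.2.re} := by
  rintro ⟨a₀, ζ₀⟩ hp
  apply ContinuousAt.continuousWithinAt
  have hp' : logR a₀ + 2 < ζ₀.re := hp
  set ξ₀ := logBInv a₀ ζ₀ with hξ₀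
  have h0 := logBInv_re hp'.le
  have hcR : Continuous fun p : ℂ × ℂ => logR p.1 := continuous_logR.comp continuous_fst
  have ev1 : ∀ᶠ p : ℂ × ℂ in 𝓝 (a₀, ζ₀), logR p.1 + 2 < p.2.re :=
    (isOpen_lt (hcR.add continuous_const) (Complex.continuous_re.comp continuous_snd)).mem_nhds hp
  have ev2 : ∀ᶠ p : ℂ × ℂ in 𝓝 (a₀, ζ₀), logR p.1 + 1 < ξ₀.re :=
    (isOpen_lt (hcR.add continuous_const) continuous_const).mem_nhds
      (show logR a₀ + 1 < ξ₀.re by linarith)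
  have hcont : ContinuousAt (fun p : ℂ × ℂ => logB p.1 ξ₀) (a₀, ζ₀) := by
    unfold logB
    refine continuousAt_const.add ?_
    have hmem : {p : ℂ × ℂ | escR p.1 ≤ ‖p.2‖} ∈ 𝓝 (a₀, Complex.exp ξ₀) := by
      have : IsOpen {p : ℂ × ℂ | escR p.1 < ‖p.2‖} :=
        isOpen_lt (continuous_escR.comp continuous_fst) continuous_snd.norm
      refine mem_of_superset (this.mem_nhds ?_) fun p hp =>
        (le_of_lt hp : escR p.1 ≤ ‖p.2‖)
      have : Real.log (escR a₀) < ξ₀.re := by rw [← logR]; linarith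
      simpa [Complex.norm_exp] using (Real.log_lt_iff_lt_exp (escR_pos a₀)).1 this
    exact ContinuousAt.comp (f := fun p : ℂ × ℂ => (p.1, Complex.exp ξ₀))
      (continuousOn_hinf.continuousAt hmem) (by fun_prop)
  have hlim : Tendsto (fun p : ℂ × ℂ => 2 * ‖p.2 - logB p.1 ξ₀‖) (𝓝 (a₀, ζ₀)) (𝓝 0) := by
    have := ((continuousAt_snd.sub hcont).norm.const_mul 2).tendsto
    simpa [hξ₀, logB_logBInv hp'.le] using this
  rw [ContinuousAt, tendsto_iff_norm_sub_tendsto_zero]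
  refine squeeze_zero' (Eventually.of_forall fun _ => norm_nonneg _) ?_ hlim
  filter_upwards [ev1, ev2] with p h1 h2
  have := norm_sub_le_logB (by linarith [logBInv_re h1.le] : logR p.1 + 1 ≤ (logBInv p.1 p.2).re)
    h2.le
  rwa [logB_logBInv h1.le] at this

theorem differentiableOn_logBInv (a : ℂ) :
    DifferentiableOn ℂ (logBInv a) {ζ | logR a + 2 < ζ.re} := by
  have hopen : IsOpen {ζ : ℂ | logR a + 2 < ζ.re} :=
    isOpen_lt continuous_const Complex.continuous_re
  intro ζ hζ
  have hζ' : logR a + 2 < ζ.re := hζ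
  have h0 := logBInv_re hζ'.le
  set h : ℂ → ℂ := fun ξ => hinf a (Complex.exp ξ) with hh
  have hd : DifferentiableAt ℂ h (logBInv a ζ) := (differentiableOn_hinf_exp a).differentiableAt
    ((isOpen_lt continuous_const Complex.continuous_re).mem_nhds
      (by simp only [Set.mem_ofPred_eq]; linarith))
  have hB : HasDerivAt (logB a) (1 + deriv h (logBInv a ζ)) (logBInv a ζ) :=
    (hasDerivAt_id _).add hd.hasDerivAt
  have hne : 1 + deriv h (logBInv a ζ) ≠ 0 := by
    intro e
    have := norm_deriv_hinf_exp_le (by linarith : logR a + 1 ≤ (logBInv a ζ).re)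
    rw [← hh, eq_neg_of_add_eq_zero_right e] at this
    norm_num at this
  have hc : ContinuousAt (logBInv a) ζ :=
    ContinuousAt.comp (f := fun ζ : ℂ => (a, ζ)) (g := fun p : ℂ × ℂ => logBInv p.1 p.2)
      (continuousOn_logBInv.continuousAt ((isOpen_lt
        ((continuous_logR.comp continuous_fst).add continuous_const)
        (Complex.continuous_re.comp continuous_snd)).mem_nhds hζ')) (by fun_prop)
  refine (HasDerivAt.of_local_left_inverse hc hB hne ?_).differentiableAt.differentiableWithinAt
  filter_upwards [hopen.mem_nhds hζ] with y hy
  exact logB_logBInv (le_of_lt hy)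

/-- The inverse Böttcher coordinate near infinity, in logarithmic coordinates. -/
def psiInf (a ζ : ℂ) : ℂ := Complex.exp (logBInv a ζ)

theorem continuousOn_psiInf :
    ContinuousOn (fun p : ℂ × ℂ => psiInf p.1 p.2) {p | logR p.1 + 2 < p.2.re} :=
  Complex.continuous_exp.comp_continuousOn continuousOn_logBInv

theorem differentiableOn_psiInf (a : ℂ) :
    DifferentiableOn ℂ (psiInf a) {ζ | logR a + 2 < ζ.re} :=
  (differentiableOn_logBInv a).cexp

theorem psiInf_logB {a ξ : ℂ} (hξ : logR a + 1 ≤ ξ.re) (h : logR a + 2 ≤ (logB a ξ).re) :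
    psiInf a (logB a ξ) = Complex.exp ξ := by
  rw [psiInf, logBInv_eq h hξ rfl]

theorem f_psiInf {a ζ : ℂ} (h : logR a + 2 ≤ ζ.re) : f a (psiInf a ζ) = psiInf a (3 * ζ) := by
  have h0 := logBInv_re h
  have hR := logR_pos a
  set ξ := logBInv a ζ with hξ
  have hz : escR a ≤ ‖Complex.exp ξ‖ := escR_le_norm_exp.2 (by linarith)
  -- This is the logarithm of `f a (exp ξ)` close to `3 * ξ`; on this branch the functional equation
  -- of `hinf` gives `logB a ξ' = 3 * ζ` exactly.
  set ξ' := 3 * ξ + Complex.log (1 + dev a (Complex.exp ξ)) with hξ'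
  have e1 : Complex.exp ξ' = f a (Complex.exp ξ) := by
    rw [hξ', Complex.exp_add, Complex.exp_log
      (Complex.slitPlane_ne_zero (one_add_dev_mem_slitPlane hz)), f_eq_mul (Complex.exp_ne_zero _),
      ← Complex.exp_nat_mul]
    norm_num
  have e2 : logB a ξ' = 3 * ζ := by
    rw [← logB_logBInv h, ← hξ, logB, logB, e1, hinf_f hz, hξ']; ring
  have e3 : logR a + 1 ≤ ξ'.re := by
    have h1 := (Complex.abs_re_le_norm _).trans
      (Complex.norm_log_one_add_half_le_self (norm_dev_le_half hz))
    have h2 := (abs_le.1 h1).1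
    have h3 := norm_dev_le_half hz
    have : ξ'.re = 3 * ξ.re + (Complex.log (1 + dev a (Complex.exp ξ))).re := by
      rw [hξ', Complex.add_re]; simp
    linarith
  have e4 : logR a + 2 ≤ (3 * ζ).re := by simp; linarith
  rw [← e2, psiInf_logB e3 (by rw [e2]; exact e4), e1, psiInf]

theorem green_psiInf {a ζ : ℂ} (h : logR a + 2 ≤ ζ.re) : green a (psiInf a ζ) = ζ.re := by
  rw [psiInf, ← logB_re (by linarith [logBInv_re h]), logB_logBInv h]

theorem psiInf_eq_iff {a ζ ζ' : ℂ} (h : logR a + 2 ≤ ζ.re) (h' : logR a + 2 ≤ ζ'.re) :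
    psiInf a ζ = psiInf a ζ' ↔ ∃ k : ℤ, ζ = ζ' + k * (2 * Real.pi * Complex.I) := by
  constructor
  · intro e
    obtain ⟨k, hk⟩ := Complex.exp_eq_exp_iff_exists_int.1 e
    refine ⟨k, ?_⟩
    rw [← logB_logBInv h, hk, logB_add_int_mul, logB_logBInv h']
  · rintro ⟨k, rfl⟩
    have : logBInv a (ζ' + k * (2 * Real.pi * Complex.I)) =
        logBInv a ζ' + k * (2 * Real.pi * Complex.I) := by
      refine logBInv_eq h ?_ ?_
      · simp; linarith [logBInv_re h']
      · rw [logB_add_int_mul, logB_logBInv h']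
    rw [psiInf, this, psiInf]
    exact Complex.exp_eq_exp_iff_exists_int.2 ⟨k, rfl⟩

/-! ### Critical points -/

theorem hasDerivAt_f (a z : ℂ) : HasDerivAt (f a) (3 * z ^ 2 + 2 * a * z + 1) z := by
  have h := (((hasDerivAt_id z).pow 3).add (((hasDerivAt_id z).pow 2).const_mul a)).add
    (hasDerivAt_id z)
  refine h.congr_deriv ?_
  simp; ring

theorem deriv_f (a z : ℂ) : deriv (f a) z = 3 * z ^ 2 + 2 * a * z + 1 := (hasDerivAt_f a z).deriv

/-- One critical point of `f a`. -/
def critA (a : ℂ) : ℂ := (-a + csqrt (a ^ 2 - 3)) / 3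

/-- The other critical point of `f a`. -/
def critB (a : ℂ) : ℂ := (-a - csqrt (a ^ 2 - 3)) / 3

theorem crit_iff {a c : ℂ} : 3 * c ^ 2 + 2 * a * c + 1 = 0 ↔ c = critA a ∨ c = critB a := by
  have h := csqrt_sq (a ^ 2 - 3)
  have e : 3 * c ^ 2 + 2 * a * c + 1 = 3 * ((c - critA a) * (c - critB a)) := by
    unfold critA critB
    linear_combination (1 / 3) * h
  rw [e]
  simp [sub_eq_zero]

/-- The maximum of the Green function over the critical points. -/
def critGreen (a : ℂ) : ℝ := max (green a (critA a)) (green a (critB a))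

theorem green_le_critGreen {a c : ℂ} (h : 3 * c ^ 2 + 2 * a * c + 1 = 0) :
    green a c ≤ critGreen a := by
  rcases crit_iff.1 h with rfl | rfl
  · exact le_max_left _ _
  · exact le_max_right _ _

theorem critGreen_nonneg (a : ℂ) : 0 ≤ critGreen a := (green_nonneg _ _).trans (le_max_left _ _)

theorem exists_green_eq_critGreen (a : ℂ) :
    ∃ c, 3 * c ^ 2 + 2 * a * c + 1 = 0 ∧ green a c = critGreen a := by
  rcases max_choice (green a (critA a)) (green a (critB a)) with h | h
  · exact ⟨critA a, crit_iff.2 (Or.inl rfl), h.symm⟩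
  · exact ⟨critB a, crit_iff.2 (Or.inr rfl), h.symm⟩

theorem mem_bottcherDomain_iff {a z : ℂ} : z ∈ bottcherDomain a ↔ critGreen a < green a z := by
  constructor
  · intro h
    obtain ⟨c, hc, hg⟩ := exists_green_eq_critGreen a
    rw [← hg]
    exact h c (by rw [deriv_f]; exact hc)
  · intro h c hc
    rw [deriv_f] at hc
    exact (green_le_critGreen hc).trans_lt h

/-- The principal root jumps only by a sign. From `s² - s₀² = (s - s₀)(s + s₀)`, the root is near
`s₀` or near `-s₀`, and an even function does not distinguish them. Symmetric expressions in the two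
critical points are thus continuous in `a`. -/
theorem continuous_comp_csqrt_of_even {N : ℂ × ℂ → ℝ} (hN : Continuous N)
    (heven : ∀ a s, N (a, -s) = N (a, s)) {q : ℂ → ℂ} (hq : Continuous q) :
    Continuous fun a => N (a, csqrt (q a)) := by
  rw [continuous_iff_continuousAt]
  intro a₀
  rw [Metric.continuousAt_iff]
  intro ε hε
  set s₀ := csqrt (q a₀)
  obtain ⟨δ₁, h₁, H₁⟩ := Metric.continuousAt_iff.1 (hN.continuousAt (x := (a₀, s₀))) ε hε
  obtain ⟨δ₂, h₂, H₂⟩ := Metric.continuousAt_iff.1 (hN.continuousAt (x := (a₀, -s₀))) ε hε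
  set δ := min δ₁ δ₂
  have hδ : 0 < δ := lt_min h₁ h₂
  obtain ⟨η, hη, Hη⟩ := Metric.continuousAt_iff.1 (hq.continuousAt (x := a₀)) (δ ^ 2) (by positivity)
  refine ⟨min η δ, lt_min hη hδ, fun a ha => ?_⟩
  have ha1 : dist a a₀ < δ := ha.trans_le (min_le_right _ _)
  have h := Hη (ha.trans_le (min_le_left _ _))
  set s := csqrt (q a)
  have e : q a - q a₀ = (s - s₀) * (s + s₀) := by
    rw [← csqrt_sq (q a), ← csqrt_sq (q a₀)]; ring
  rw [dist_eq_norm, e, norm_mul] at h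
  have : ‖s - s₀‖ < δ ∨ ‖s + s₀‖ < δ := by
    by_contra! hc
    nlinarith [mul_le_mul hc.1 hc.2 hδ.le (norm_nonneg _)]
  rcases this with hs | hs
  · refine H₁ ?_
    rw [Prod.dist_eq]
    exact max_lt (ha1.trans_le (min_le_left _ _)) (by rw [dist_eq_norm]; exact hs.trans_le (min_le_left _ _))
  · have := H₂ (x := (a, s)) (by
      rw [Prod.dist_eq]
      refine max_lt (ha1.trans_le (min_le_right _ _)) ?_
      rw [dist_eq_norm, sub_neg_eq_add]; exact hs.trans_le (min_le_right _ _))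
    rwa [heven] at this

theorem continuous_critGreen : Continuous critGreen := by
  have h := continuous_comp_csqrt_of_even
    (N := fun p => max (green p.1 ((-p.1 + p.2) / 3)) (green p.1 ((-p.1 - p.2) / 3)))
    (Continuous.max
      (continuous_green.comp (g := fun p : ℂ × ℂ => green p.1 p.2)
        (f := fun p : ℂ × ℂ => (p.1, (-p.1 + p.2) / 3)) (by fun_prop))
      (continuous_green.comp (g := fun p : ℂ × ℂ => green p.1 p.2)
        (f := fun p : ℂ × ℂ => (p.1, (-p.1 - p.2) / 3)) (by fun_prop)))
    (fun a s => by
      simp only [sub_neg_eq_add, ← sub_eq_add_neg]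
      rw [max_comm]) (q := fun a => a ^ 2 - 3) (by fun_prop)
  exact h

/-! ### Lifting through the family -/

/-- The family of polynomials as a self-map of `ℂ × ℂ`. -/
def family (p : ℂ × ℂ) : ℂ × ℂ := (p.1, f p.1 p.2)

theorem isClosedMap_family : IsClosedMap family := by
  have hc : Continuous family := continuous_fst.prodMk continuous_f
  refine (isProperMap_iff_tendsto_cocompact.2 ⟨hc, ?_⟩).isClosedMap
  rw [← Metric.cobounded_eq_cocompact, ← tendsto_norm_atTop_iff_cobounded, tendsto_atTop]
  intro C
  -- The threshold puts `p.2` beyond the escape radius of every parameter of modulus less than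
  -- `|C|`, where `f` at least doubles the modulus.
  filter_upwards [eventually_cobounded_le_norm (4 * (1 + |C|) + |C|)] with p hp
  by_contra! h
  have hC : C ≤ |C| := le_abs_self C
  have h1 : ‖p.1‖ < |C| := ((norm_fst_le (family p)).trans_lt h).trans_le hC
  have h2 : ‖f p.1 p.2‖ < |C| := ((norm_snd_le (family p)).trans_lt h).trans_le hC
  have h3 : 4 * (1 + |C|) + |C| ≤ ‖p.2‖ := by
    rw [Prod.norm_def] at hp
    rcases le_max_iff.1 hp with h | h
    · linarith [abs_nonneg C]
    · exact h
  have h4 : escR p.1 ≤ ‖p.2‖ := by unfold escR; linarith [abs_nonneg C]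
  linarith [two_mul_norm_le h4, norm_nonneg p.2, abs_nonneg C]

/-- The derivative of `family` at a point with nonvanishing derivative in the fibre. -/
def familyDeriv (k d : ℂ) (hd : d ≠ 0) : (ℂ × ℂ) ≃L[ℂ] (ℂ × ℂ) :=
  ContinuousLinearEquiv.equivOfInverse
    ((ContinuousLinearMap.fst ℂ ℂ ℂ).prod
      (k • ContinuousLinearMap.fst ℂ ℂ ℂ + d • ContinuousLinearMap.snd ℂ ℂ ℂ))
    ((ContinuousLinearMap.fst ℂ ℂ ℂ).prod
      (d⁻¹ • (ContinuousLinearMap.snd ℂ ℂ ℂ - k • ContinuousLinearMap.fst ℂ ℂ ℂ)))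
    (fun p => by ext <;> simp; field_simp)
    (fun p => by ext <;> simp; field_simp; ring)

theorem hasStrictFDerivAt_family (p : ℂ × ℂ) (hd : 3 * p.2 ^ 2 + 2 * p.1 * p.2 + 1 ≠ 0) :
    HasStrictFDerivAt family
      (familyDeriv (p.2 ^ 2) (3 * p.2 ^ 2 + 2 * p.1 * p.2 + 1) hd : (ℂ × ℂ) →L[ℂ] (ℂ × ℂ)) p := by
  have h1 : HasStrictFDerivAt (fun p : ℂ × ℂ => p.1) (ContinuousLinearMap.fst ℂ ℂ ℂ) p :=
    hasStrictFDerivAt_fst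
  have h2 : HasStrictFDerivAt (fun p : ℂ × ℂ => p.2) (ContinuousLinearMap.snd ℂ ℂ ℂ) p :=
    hasStrictFDerivAt_snd
  have h := h1.prodMk (((h2.pow 3).add (h1.mul (h2.pow 2))).add h2)
  refine h.congr_fderiv ?_
  ext <;> simp [familyDeriv]
  ring

/-- A closed map with finite fibres that is a local homeomorphism over a set is a covering there.
Keeping the parameter as a coordinate makes lifts continuous in `(a, z)` jointly. -/
theorem isCoveringMapOn_family : IsCoveringMapOn family
    {q | ∀ c, 3 * c ^ 2 + 2 * q.1 * c + 1 = 0 → f q.1 c ≠ q.2} := by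
  refine isClosedMap_family.isCoveringMapOn_of_isLocalHomeomorphOn (fun q _ => ?_)
    fun p hp => ?_
  · have hfin : {z : ℂ | f q.1 z = q.2}.Finite := by
      set P : Polynomial ℂ := Polynomial.X ^ 3 + Polynomial.C q.1 * Polynomial.X ^ 2 +
        Polynomial.X - Polynomial.C q.2 with hP
      have h0 : P ≠ 0 := by
        intro h
        have h3 := congrArg (fun P => Polynomial.coeff P 3) h
        simp [hP, Polynomial.coeff_X] at h3
      refine (P.rootSet_finite ℂ).subset fun z hz => ?_
      have hz' : f q.1 z = q.2 := hz
      rw [Polynomial.mem_rootSet]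
      refine ⟨h0, ?_⟩
      rw [f] at hz'
      simp [hP, hz']
    refine (hfin.image fun z => (q.1, z)).subset ?_
    rintro ⟨a, z⟩ h
    have h' : (a, f a z) = q := h
    subst h'
    exact ⟨z, rfl, rfl⟩
  · have hd : 3 * p.2 ^ 2 + 2 * p.1 * p.2 + 1 ≠ 0 := fun h => hp p.2 h rfl
    have hs := hasStrictFDerivAt_family p hd
    exact ⟨hs.toOpenPartialHomeomorph family, hs.mem_toOpenPartialHomeomorph_source,
      by simp⟩

theorem exists_lift {X : Type*} [TopologicalSpace X] [SimplyConnectedSpace X]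
    [LocallyPathConnectedSpace X] {α y : X → ℂ} (hα : Continuous α) (hy : Continuous y)
    (h : ∀ x c, 3 * c ^ 2 + 2 * α x * c + 1 = 0 → f (α x) c ≠ y x) {x₀ : X} {z₀ : ℂ}
    (h₀ : f (α x₀) z₀ = y x₀) :
    ∃ u : X → ℂ, Continuous u ∧ u x₀ = z₀ ∧ ∀ x, f (α x) (u x) = y x := by
  obtain ⟨F, ⟨hF0, hF⟩, -⟩ := isCoveringMapOn_family.existsUnique_continuousMap_lifts
    (A := X) ⟨fun x => (α x, y x), hα.prodMk hy⟩ (a₀ := x₀) (e₀ := (α x₀, z₀))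
    (by simp [family, h₀]) (fun x => h x)
  have hF' : ∀ x, family (F x) = (α x, y x) := fun x => congrFun hF x
  refine ⟨fun x => (F x).2, continuous_snd.comp F.continuous, by simp [hF0], fun x => ?_⟩
  have h1 := congrArg Prod.fst (hF' x)
  have h2 := congrArg Prod.snd (hF' x)
  simp only [family] at h1 h2
  rw [← h1, h2]

/-! ### Uniqueness of lifts. -/

theorem f_sub_f (a z w : ℂ) :
    f a z - f a w = (z - w) * (z ^ 2 + z * w + w ^ 2 + a * (z + w) + 1) := by unfold f; ring

/-- When `u` and `v` have the same limit `z₀`, the second factor in `f_sub_f` tends to the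
derivative of `f a₀` at `z₀`, which is nonzero; so the first factor must vanish. -/
theorem eventuallyEq_of_f_eq {X : Type*} [TopologicalSpace X] {l : Filter X} {α u v : X → ℂ}
    {a₀ z₀ : ℂ} (hα : Tendsto α l (𝓝 a₀)) (hu : Tendsto u l (𝓝 z₀)) (hv : Tendsto v l (𝓝 z₀))
    (hd : 3 * z₀ ^ 2 + 2 * a₀ * z₀ + 1 ≠ 0) (h : ∀ᶠ x in l, f (α x) (u x) = f (α x) (v x)) :
    u =ᶠ[l] v := by
  have ht : Tendsto (fun x => u x ^ 2 + u x * v x + v x ^ 2 + α x * (u x + v x) + 1) l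
      (𝓝 (z₀ ^ 2 + z₀ * z₀ + z₀ ^ 2 + a₀ * (z₀ + z₀) + 1)) :=
    ((((hu.pow 2).add (hu.mul hv)).add (hv.pow 2)).add (hα.mul (hu.add hv))).add_const 1
  have hne := ht.eventually_ne (b₂ := 0) (by intro e; apply hd; linear_combination e)
  filter_upwards [h, hne] with x hx hx'
  have := f_sub_f (α x) (u x) (v x)
  rw [hx, sub_self, eq_comm, mul_eq_zero] at this
  exact sub_eq_zero.1 (this.resolve_right hx')

theorem eqOn_of_f_eq {X : Type*} [TopologicalSpace X] {S : Set X} (hS : IsPreconnected S)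
    {α u v : X → ℂ} (hα : ContinuousOn α S) (hu : ContinuousOn u S) (hv : ContinuousOn v S)
    (hd : ∀ x ∈ S, 3 * u x ^ 2 + 2 * α x * u x + 1 ≠ 0)
    (h : ∀ x ∈ S, f (α x) (u x) = f (α x) (v x)) {x₀ : X} (hx₀ : x₀ ∈ S) (h₀ : u x₀ = v x₀) :
    Set.EqOn u v S := by
  have : PreconnectedSpace S := Subtype.preconnectedSpace hS
  have hcl : IsClosed {x : S | u x = v x} :=
    isClosed_eq (continuousOn_iff_continuous_domRestrict.1 hu) (continuousOn_iff_continuous_domRestrict.1 hv)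
  have hop : IsOpen {x : S | u x = v x} := by
    rw [isOpen_iff_mem_nhds]
    intro x hx
    have hx' : u x = v x := hx
    refine eventuallyEq_of_f_eq (α := fun x : S => α x) (u := fun x : S => u x)
      (v := fun x : S => v x) (a₀ := α x) (z₀ := u x)
      ((continuousOn_iff_continuous_domRestrict.1 hα).continuousAt (x := x))
      ((continuousOn_iff_continuous_domRestrict.1 hu).continuousAt (x := x))
      (by rw [hx']; exact (continuousOn_iff_continuous_domRestrict.1 hv).continuousAt (x := x))
      (hd x x.2) (Eventually.of_forall fun y => h y y.2)
  have huniv := IsClopen.eq_univ ⟨hcl, hop⟩ ⟨⟨x₀, hx₀⟩, h₀⟩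
  intro x hx
  have : (⟨x, hx⟩ : S) ∈ {x : S | u x = v x} := by rw [huniv]; trivial
  exact this

/-- The half planes over the parameter plane with moving boundary `m`. -/
def overHalf (m : ℂ → ℝ) : Set (ℂ × ℂ) := {p | m p.1 < p.2.re}

theorem isOpen_overHalf {m : ℂ → ℝ} (hm : Continuous m) : IsOpen (overHalf m) :=
  isOpen_lt (hm.comp continuous_fst) (Complex.continuous_re.comp continuous_snd)

/-- Straightening of `overHalf m`. -/
def overHalfHomeomorph {m : ℂ → ℝ} (hm : Continuous m) : overHalf m ≃ₜ ℂ × ℂ where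
  toFun p := (p.1.1, ⟨Real.log (p.1.2.re - m p.1.1), p.1.2.im⟩)
  invFun q := ⟨(q.1, ⟨m q.1 + Real.exp q.2.re, q.2.im⟩),
    show m q.1 < m q.1 + Real.exp q.2.re by linarith [Real.exp_pos q.2.re]⟩
  left_inv := by
    rintro ⟨⟨a, z⟩, hp⟩
    have hp' : m a < z.re := hp
    simp only [Real.exp_log (sub_pos.2 hp')]
    simp
  right_inv := by
    rintro ⟨a, z⟩
    simp
  continuous_toFun := by
    refine Continuous.prodMk (by fun_prop) ?_
    have h1 : Continuous fun p : overHalf m => Real.log (p.1.2.re - m p.1.1) := by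
      refine Continuous.log ?_ fun p => (sub_pos.2 p.2).ne'
      exact (Complex.continuous_re.comp (by fun_prop)).sub (hm.comp (by fun_prop))
    have h2 : Continuous fun p : overHalf m => p.1.2.im := Complex.continuous_im.comp (by fun_prop)
    exact Complex.equivRealProdCLM.symm.continuous.comp (h1.prodMk h2)
  continuous_invFun := by
    refine Continuous.subtype_mk ?_ _
    refine Continuous.prodMk (by fun_prop) ?_
    have h1 : Continuous fun q : ℂ × ℂ => m q.1 + Real.exp q.2.re :=
      (hm.comp (by fun_prop)).add (Real.continuous_exp.comp (Complex.continuous_re.comp (by fun_prop)))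
    have h2 : Continuous fun q : ℂ × ℂ => q.2.im := Complex.continuous_im.comp (by fun_prop)
    exact Complex.equivRealProdCLM.symm.continuous.comp (h1.prodMk h2)

/-- Supplies the simple connectedness needed to lift over all parameters simultaneously. -/
theorem contractibleSpace_overHalf {m : ℂ → ℝ} (hm : Continuous m) :
    ContractibleSpace (overHalf m) := (overHalfHomeomorph hm).contractibleSpace

theorem isPreconnected_overHalf {m : ℂ → ℝ} (hm : Continuous m) :
    IsPreconnected (overHalf m) := by
  have := contractibleSpace_overHalf hm
  exact isPreconnected_iff_preconnectedSpace.2 inferInstance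

/-! ### The inverse Böttcher coordinate on its maximal half plane -/

/-- Lower bounds for the half planes reached after finitely many liftings. -/
def stageBound (n : ℕ) (a : ℂ) : ℝ := max (critGreen a) ((logR a + 2) / 3 ^ n)

theorem continuous_stageBound (n : ℕ) : Continuous (stageBound n) :=
  continuous_critGreen.max ((continuous_logR.add continuous_const).div_const _)

theorem overHalf_stage_mono {n m : ℕ} (h : n ≤ m) :
    overHalf (stageBound n) ⊆ overHalf (stageBound m) := by
  intro p hp
  have hp' : stageBound n p.1 < p.2.re := hp
  refine lt_of_le_of_lt (max_le_max le_rfl ?_) hp'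
  have := logR_pos p.1
  exact div_le_div_of_nonneg_left (by linarith) (by positivity)
    (pow_le_pow_right₀ (by norm_num) h)

theorem triple_mem_stage {n : ℕ} {p : ℂ × ℂ} (hp : p ∈ overHalf (stageBound (n + 1))) :
    (p.1, 3 * p.2) ∈ overHalf (stageBound n) := by
  have hp' : stageBound (n + 1) p.1 < p.2.re := hp
  have h1 := (max_lt_iff.1 hp').1
  have h2 := (max_lt_iff.1 hp').2
  have h0 := critGreen_nonneg p.1
  rw [pow_succ, div_lt_iff₀ (by positivity)] at h2
  change stageBound n p.1 < (3 * p.2).re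
  rw [Complex.mul_re]
  simp only [Complex.re_ofNat, Complex.im_ofNat, zero_mul, sub_zero]
  refine max_lt (by linarith) ?_
  rw [div_lt_iff₀ (by positivity)]
  linarith

/-- Properties of the partial inverse Böttcher coordinate at stage `n`. -/
structure IsStage (n : ℕ) (g : ℂ × ℂ → ℂ) : Prop where
  cont : ContinuousOn g (overHalf (stageBound n))
  base : ∀ p ∈ overHalf (stageBound 0), g p = psiInf p.1 p.2
  conj : ∀ p ∈ overHalf (stageBound n), f p.1 (g p) = g (p.1, 3 * p.2)
  green_eq : ∀ p ∈ overHalf (stageBound n), green p.1 (g p) = p.2.re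

theorem isStage_zero : IsStage 0 fun p => psiInf p.1 p.2 := by
  have key : ∀ p ∈ overHalf (stageBound 0), logR p.1 + 2 < p.2.re := fun p hp => by
    simpa using (max_lt_iff.1 (show stageBound 0 p.1 < p.2.re from hp)).2
  exact ⟨continuousOn_psiInf.mono key, fun _ _ => rfl, fun p hp => f_psiInf (key p hp).le,
    fun p hp => green_psiInf (key p hp).le⟩

theorem deriv_ne_zero_of_critGreen_lt {a z : ℂ} (h : critGreen a < green a z) :
    3 * z ^ 2 + 2 * a * z + 1 ≠ 0 := fun hc => (green_le_critGreen hc).not_gt h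

/-- Tripling maps the half plane of stage `n + 1` into that of stage `n`, so `(a, ζ) ↦ g (a, 3ζ)` is
defined there, and its lift through `f a` is the next stage. Uniqueness of lifts gives agreement
with `g` on the old half plane. -/
theorem IsStage.exists_succ {n : ℕ} {g : ℂ × ℂ → ℂ} (hg : IsStage n g) :
    ∃ g', IsStage (n + 1) g' ∧ Set.EqOn g g' (overHalf (stageBound n)) := by
  classical
  have hm := continuous_stageBound (n + 1)
  have := contractibleSpace_overHalf hm
  have := (isOpen_overHalf hm).locallyPathConnectedSpace
  have hS : ∀ p ∈ overHalf (stageBound (n + 1)), critGreen p.1 < p.2.re := fun p hp =>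
    (max_lt_iff.1 (show stageBound (n + 1) p.1 < p.2.re from hp)).1
  have htrip : Continuous fun p : ℂ × ℂ => (p.1, 3 * p.2) := by fun_prop
  have hre : ∀ z : ℂ, (3 * z).re = 3 * z.re := fun z => by simp
  -- A base point lying in every stage; prescribing the value `g q` there selects the lift that
  -- extends `g`.
  set q : ℂ × ℂ := (0, ((stageBound 0 0 + 1 : ℝ) : ℂ)) with hq
  have hq0 : q ∈ overHalf (stageBound 0) :=
    show stageBound 0 0 < _ by rw [hq, Complex.ofReal_re]; linarith
  have hqn := overHalf_stage_mono (Nat.zero_le n) hq0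
  have hqn' := overHalf_stage_mono (Nat.zero_le (n + 1)) hq0
  obtain ⟨u, hu, hu0, hlift⟩ := exists_lift (X := overHalf (stageBound (n + 1)))
    (α := fun p => p.1.1) (y := fun p => g (p.1.1, 3 * p.1.2)) (by fun_prop)
    (hg.cont.comp_continuous (htrip.comp continuous_subtype_val) fun p => triple_mem_stage p.2)
    -- No critical value is met: it would have Green value at most `3 * critGreen`, whereas the
    -- target has Green value `3 * Re ζ`, which is larger.
    (fun p c hc e => by
      have h1 := congrArg (green p.1.1) e
      rw [green_f, hg.green_eq _ (triple_mem_stage p.2), hre] at h1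
      have h2 := hS p.1 p.2
      linarith [green_le_critGreen hc])
    (x₀ := ⟨q, hqn'⟩) (z₀ := g q) (hg.conj q hqn)
  set g' : ℂ × ℂ → ℂ := fun p =>
    if h : p ∈ overHalf (stageBound (n + 1)) then u ⟨p, h⟩ else 0 with hg'
  have hval : ∀ p (h : p ∈ overHalf (stageBound (n + 1))), g' p = u ⟨p, h⟩ := fun p h => by
    simp only [hg', dif_pos h]
  have hlift' : ∀ p ∈ overHalf (stageBound (n + 1)), f p.1 (g' p) = g (p.1, 3 * p.2) :=
    fun p hp => by rw [hval p hp]; exact hlift ⟨p, hp⟩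
  have hcont : ContinuousOn g' (overHalf (stageBound (n + 1))) := by
    rw [continuousOn_iff_continuous_domRestrict]
    convert hu using 1
    ext p
    exact hval p.1 p.2
  have hgreen : ∀ p ∈ overHalf (stageBound (n + 1)), green p.1 (g' p) = p.2.re := by
    intro p hp
    have h1 := congrArg (green p.1) (hlift' p hp)
    rw [green_f, hg.green_eq _ (triple_mem_stage hp), hre] at h1
    linarith
  have hsub := overHalf_stage_mono (Nat.le_succ n)
  have heq : Set.EqOn g g' (overHalf (stageBound n)) := by
    refine eqOn_of_f_eq (isPreconnected_overHalf (continuous_stageBound n))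
      (α := Prod.fst) continuousOn_fst hg.cont (hcont.mono hsub) (fun p hp => ?_)
      (fun p hp => ?_) hqn (by rw [hval q hqn', hu0])
    · refine deriv_ne_zero_of_critGreen_lt ?_
      rw [hg.green_eq p hp]
      exact hS p (hsub hp)
    · rw [hlift' p (hsub hp), hg.conj p hp]
  refine ⟨g', ⟨hcont, fun p hp => ?_, fun p hp => ?_, hgreen⟩, heq⟩
  · rw [← heq (overHalf_stage_mono (Nat.zero_le n) hp), hg.base p hp]
  · rw [hlift' p hp, heq (triple_mem_stage hp)]

theorem exists_stages : ∃ g : ℕ → ℂ × ℂ → ℂ, ∀ n, IsStage n (g n) ∧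
    Set.EqOn (g n) (g (n + 1)) (overHalf (stageBound n)) := by
  choose s hs1 hs2 using fun (n : ℕ) (g : {g // IsStage n g}) => g.2.exists_succ
  let G : (n : ℕ) → {g // IsStage n g} := fun n =>
    Nat.rec ⟨_, isStage_zero⟩ (fun n g => ⟨s n g, hs1 n g⟩) n
  exact ⟨fun n => (G n).1, fun n => ⟨(G n).2, hs2 n (G n)⟩⟩

theorem exists_stage_mem {p : ℂ × ℂ} (hp : p ∈ overHalf critGreen) :
    ∃ n, p ∈ overHalf (stageBound n) := by
  have hp' : critGreen p.1 < p.2.re := hp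
  have h0 := (critGreen_nonneg p.1).trans_lt hp'
  have ht : Tendsto (fun n : ℕ => (logR p.1 + 2) * (1 / 3 : ℝ) ^ n) atTop (𝓝 0) := by
    simpa using (tendsto_pow_atTop_nhds_zero_of_lt_one (by norm_num) (by norm_num :
      (1 / 3 : ℝ) < 1)).const_mul (logR p.1 + 2)
  obtain ⟨n, hn⟩ := (ht.eventually_lt_const h0).exists
  refine ⟨n, show max _ _ < _ from max_lt hp' ?_⟩
  rwa [one_div, inv_pow, ← div_eq_mul_inv] at hn

/-- The stages are compatible, and their half planes exhaust `critGreen a < Re ζ` since `(logR a +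
2) / 3 ^ n → 0`; so they glue. -/
theorem exists_psi : ∃ g : ℂ × ℂ → ℂ, ContinuousOn g (overHalf critGreen) ∧
    (∀ p ∈ overHalf (stageBound 0), g p = psiInf p.1 p.2) ∧
    (∀ p ∈ overHalf critGreen, f p.1 (g p) = g (p.1, 3 * p.2)) ∧
    (∀ p ∈ overHalf critGreen, green p.1 (g p) = p.2.re) := by
  classical
  obtain ⟨G, hG⟩ := exists_stages
  have hmono : ∀ n k, Set.EqOn (G n) (G (n + k)) (overHalf (stageBound n)) := by
    intro n k
    induction k with
    | zero => exact fun _ _ => rfl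
    | succ k ih =>
      intro p hp
      rw [ih hp]
      exact (hG (n + k)).2 (overHalf_stage_mono (Nat.le_add_right n k) hp)
  set g : ℂ × ℂ → ℂ := fun p =>
    if h : ∃ n, p ∈ overHalf (stageBound n) then G h.choose p else 0 with hg
  have hgG : ∀ n, ∀ p ∈ overHalf (stageBound n), g p = G n p := by
    intro n p hp
    have h : ∃ n, p ∈ overHalf (stageBound n) := ⟨n, hp⟩
    simp only [hg, dif_pos h]
    rcases le_total h.choose n with hle | hle
    · obtain ⟨k, hk⟩ := Nat.exists_eq_add_of_le hle
      have := hmono _ k h.choose_spec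
      rwa [← hk] at this
    · obtain ⟨k, hk⟩ := Nat.exists_eq_add_of_le hle
      have := hmono n k hp
      rw [← hk] at this
      exact this.symm
  have htrip : ∀ n, ∀ p ∈ overHalf (stageBound n), (p.1, 3 * p.2) ∈ overHalf (stageBound n) :=
    fun n p hp => triple_mem_stage (overHalf_stage_mono (Nat.le_succ n) hp)
  refine ⟨g, fun p hp => ?_, fun p hp => ?_, fun p hp => ?_, fun p hp => ?_⟩
  · obtain ⟨n, hn⟩ := exists_stage_mem hp
    have hnhds := (isOpen_overHalf (continuous_stageBound n)).mem_nhds hn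
    refine (((hG n).1.cont.continuousAt hnhds).congr ?_).continuousWithinAt
    filter_upwards [hnhds] with q hq
    exact (hgG n q hq).symm
  · rw [hgG 0 p hp, (hG 0).1.base p hp]
  · obtain ⟨n, hn⟩ := exists_stage_mem hp
    rw [hgG n p hn, hgG n _ (htrip n p hn), (hG n).1.conj p hn]
  · obtain ⟨n, hn⟩ := exists_stage_mem hp
    rw [hgG n p hn, (hG n).1.green_eq p hn]

/-- The inverse Böttcher coordinate of `f a` in logarithmic coordinates, on the half plane
`critGreen a < Re ζ`. -/
def psi (a ζ : ℂ) : ℂ := exists_psi.choose (a, ζ)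

theorem continuousOn_psi : ContinuousOn (fun p : ℂ × ℂ => psi p.1 p.2) (overHalf critGreen) :=
  exists_psi.choose_spec.1

theorem continuousAt_psi {a ζ : ℂ} (h : critGreen a < ζ.re) :
    ContinuousAt (fun p : ℂ × ℂ => psi p.1 p.2) (a, ζ) :=
  continuousOn_psi.continuousAt ((isOpen_overHalf continuous_critGreen).mem_nhds h)

theorem psi_eq_psiInf {a ζ : ℂ} (h : critGreen a < ζ.re) (h' : logR a + 2 < ζ.re) :
    psi a ζ = psiInf a ζ :=
  exists_psi.choose_spec.2.1 (a, ζ) (show max _ _ < _ from max_lt h (by simpa using h'))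

theorem f_psi {a ζ : ℂ} (h : critGreen a < ζ.re) : f a (psi a ζ) = psi a (3 * ζ) :=
  exists_psi.choose_spec.2.2.1 (a, ζ) h

theorem green_psi {a ζ : ℂ} (h : critGreen a < ζ.re) : green a (psi a ζ) = ζ.re :=
  exists_psi.choose_spec.2.2.2 (a, ζ) h

/-! ### Analyticity, periodicity and injectivity of `psi`. -/

theorem critGreen_lt_pow_mul_re {a ζ : ℂ} (h : critGreen a < ζ.re) (n : ℕ) :
    critGreen a < ((3 : ℂ) ^ n * ζ).re := by
  have e : ((3 : ℂ) ^ n * ζ).re = 3 ^ n * ζ.re := by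
    have : ((3 : ℂ) ^ n) = ((3 ^ n : ℝ) : ℂ) := by push_cast; rfl
    rw [this, Complex.re_ofReal_mul]
  rw [e]
  have h0 := critGreen_nonneg a
  have h1 : (1 : ℝ) ≤ 3 ^ n := one_le_pow₀ (by norm_num)
  nlinarith

theorem f_iterate_psi {a ζ : ℂ} (h : critGreen a < ζ.re) (n : ℕ) :
    (f a)^[n] (psi a ζ) = psi a (3 ^ n * ζ) := by
  induction n with
  | zero => simp
  | succ n ih =>
    rw [Function.iterate_succ_apply', ih, f_psi (critGreen_lt_pow_mul_re h n), pow_succ]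
    ring_nf

theorem psi_deriv_ne_zero {a ζ : ℂ} (h : critGreen a < ζ.re) :
    3 * psi a ζ ^ 2 + 2 * a * psi a ζ + 1 ≠ 0 :=
  deriv_ne_zero_of_critGreen_lt (by rwa [green_psi h])

theorem continuousAt_psi_right {a ζ : ℂ} (h : critGreen a < ζ.re) : ContinuousAt (psi a) ζ :=
  ContinuousAt.comp (f := fun ζ : ℂ => (a, ζ)) (g := fun p : ℂ × ℂ => psi p.1 p.2)
    (continuousAt_psi h) (by fun_prop)

theorem differentiableAt_of_f_comp {a x : ℂ} {u y : ℂ → ℂ} (hu : ContinuousAt u x)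
    (hy : DifferentiableAt ℂ y x) (hd : 3 * u x ^ 2 + 2 * a * u x + 1 ≠ 0)
    (h : ∀ᶠ t in 𝓝 x, f a (u t) = y t) : DifferentiableAt ℂ u x := by
  have hs : HasStrictDerivAt (f a) (3 * u x ^ 2 + 2 * a * u x + 1) (u x) := by
    have hd : ContDiff ℂ 1 (f a) := by unfold f; fun_prop
    have := hd.contDiffAt.hasStrictDerivAt (x := u x) one_ne_zero
    rwa [deriv_f] at this
  have hloc := hs.eventually_left_inverse hd
  have e : u =ᶠ[𝓝 x] fun t => hs.localInverse _ _ _ hd (y t) := by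
    filter_upwards [hu.eventually hloc, h] with t ht1 ht2
    rw [← ht2]; exact ht1.symm
  have hyx : y x = f a (u x) := (h.self_of_nhds).symm
  refine DifferentiableAt.congr_of_eventuallyEq ?_ e
  have h1 := (hs.to_localInverse hd).hasDerivAt.differentiableAt
  rw [← hyx] at h1
  exact h1.comp x hy

/-- Induction on the stage: `psi a ζ` is a continuous solution of `f a (psi a ζ) = psi a (3ζ)` at a
noncritical point, hence a holomorphic local inverse applied to a function already known to be
holomorphic. -/
theorem differentiableAt_psi {a ζ : ℂ} (h : critGreen a < ζ.re) :
    DifferentiableAt ℂ (psi a) ζ := by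
  have key : ∀ n : ℕ, ∀ ζ : ℂ, critGreen a < ζ.re → stageBound n a < ζ.re →
      DifferentiableAt ℂ (psi a) ζ := by
    intro n
    induction n with
    | zero =>
      intro ζ h h'
      have h2 : logR a + 2 < ζ.re := by simpa using (max_lt_iff.1 h').2
      have ho : IsOpen {ζ : ℂ | logR a + 2 < ζ.re} :=
        isOpen_lt continuous_const Complex.continuous_re
      have ho' : IsOpen {ζ : ℂ | critGreen a < ζ.re} :=
        isOpen_lt continuous_const Complex.continuous_re
      refine ((differentiableOn_psiInf a).differentiableAt
        (ho.mem_nhds h2)).congr_of_eventuallyEq ?_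
      filter_upwards [ho.mem_nhds h2, ho'.mem_nhds h] with t h1 h2
      exact psi_eq_psiInf h2 h1
    | succ n ih =>
      intro ζ h h'
      have ho' : IsOpen {ζ : ℂ | critGreen a < ζ.re} :=
        isOpen_lt continuous_const Complex.continuous_re
      have h3 : stageBound n a < (3 * ζ).re := triple_mem_stage (p := (a, ζ)) h'
      have h3' : critGreen a < (3 * ζ).re := (max_lt_iff.1 h3).1
      refine differentiableAt_of_f_comp (a := a) (y := fun t => psi a (3 * t))
        (continuousAt_psi_right h) ?_ (psi_deriv_ne_zero h) ?_
      · exact DifferentiableAt.comp (g := psi a) (f := fun t => 3 * t) ζ (ih _ h3' h3)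
          (by fun_prop)
      · filter_upwards [ho'.mem_nhds h] with t ht
        exact f_psi ht
  obtain ⟨n, hn⟩ := exists_stage_mem (p := (a, ζ)) h
  exact key n ζ h hn

theorem analyticOnNhd_psi (a : ℂ) : AnalyticOnNhd ℂ (psi a) {ζ | critGreen a < ζ.re} :=
  DifferentiableOn.analyticOnNhd (fun _ hζ => (differentiableAt_psi hζ).differentiableWithinAt)
    (isOpen_lt continuous_const Complex.continuous_re)

theorem isPreconnected_half (m : ℝ) : IsPreconnected {ζ : ℂ | m < ζ.re} :=
  (convex_halfSpace_re_gt m).isPreconnected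

theorem eqOn_half_of_eventuallyEq {m : ℝ} {g h : ℂ → ℂ}
    (hg : AnalyticOnNhd ℂ g {ζ | m < ζ.re}) (hh : AnalyticOnNhd ℂ h {ζ | m < ζ.re}) {ζ₀ : ℂ}
    (h₀ : m < ζ₀.re) (e : g =ᶠ[𝓝 ζ₀] h) : ∀ ζ : ℂ, m < ζ.re → g ζ = h ζ :=
  fun _ hζ => hg.eqOn_of_preconnected_of_eventuallyEq hh (isPreconnected_half m) h₀ e hζ

theorem analyticOnNhd_psi_add (a d : ℂ) (hd : d.re = 0) :
    AnalyticOnNhd ℂ (fun ζ => psi a (ζ + d)) {ζ | critGreen a < ζ.re} := by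
  refine DifferentiableOn.analyticOnNhd (fun ζ hζ => ?_)
    (isOpen_lt continuous_const Complex.continuous_re)
  have : critGreen a < (ζ + d).re := by rw [Complex.add_re, hd, add_zero]; exact hζ
  exact (DifferentiableAt.comp (g := psi a) (f := fun ζ => ζ + d) ζ (differentiableAt_psi this)
    (by fun_prop)).differentiableWithinAt

theorem re_int_mul_two_pi_I (k : ℤ) : ((k : ℂ) * (2 * Real.pi * Complex.I)).re = 0 := by simp

/-- A real number beyond which the inverse Böttcher coordinate is given by `psiInf`. -/
def farBound (a : ℂ) : ℝ := max (critGreen a) (logR a + 2)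

theorem psi_add_int_mul {a ζ : ℂ} (h : critGreen a < ζ.re) (k : ℤ) :
    psi a (ζ + k * (2 * Real.pi * Complex.I)) = psi a ζ := by
  set ζ₀ : ℂ := ((farBound a + 1 : ℝ) : ℂ)
  have hre : farBound a < ζ₀.re := by rw [Complex.ofReal_re]; linarith
  refine eqOn_half_of_eventuallyEq (analyticOnNhd_psi_add a _ (re_int_mul_two_pi_I k))
    (analyticOnNhd_psi a) (ζ₀ := ζ₀) ((le_max_left _ _).trans_lt hre) ?_ ζ h
  have ho : IsOpen {ζ : ℂ | farBound a < ζ.re} := isOpen_lt continuous_const Complex.continuous_re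
  filter_upwards [ho.mem_nhds hre] with t ht
  have ht1 := (max_lt_iff.1 (show max _ _ < t.re from ht)).1
  have ht2 := (max_lt_iff.1 (show max _ _ < t.re from ht)).2
  have e : (t + k * (2 * Real.pi * Complex.I)).re = t.re := by
    rw [Complex.add_re, re_int_mul_two_pi_I, add_zero]
  rw [psi_eq_psiInf ht1 ht2, psi_eq_psiInf (by rw [e]; exact ht1) (by rw [e]; exact ht2)]
  exact (psiInf_eq_iff (by rw [e]; exact ht2.le) ht2.le).2 ⟨k, rfl⟩

theorem exists_farBound_lt {a ζ : ℂ} (h : 0 < ζ.re) :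
    ∀ᶠ n : ℕ in atTop, farBound a < ((3 : ℂ) ^ n * ζ).re := by
  have ht : Tendsto (fun n : ℕ => (3 : ℝ) ^ n * ζ.re) atTop atTop :=
    (tendsto_pow_atTop_atTop_of_one_lt (by norm_num)).atTop_mul_const h
  filter_upwards [ht.eventually_gt_atTop (farBound a)] with n hn
  have : ((3 : ℂ) ^ n) = ((3 ^ n : ℝ) : ℂ) := by push_cast; rfl
  rwa [this, Complex.re_ofReal_mul]

/-- Above the critical level the forward orbit never meets a critical point, so iterates can be
cancelled one at a time by `eventuallyEq_of_f_eq`. -/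
theorem eventuallyEq_of_f_iterate_eq {X : Type*} [TopologicalSpace X] {x₀ : X} {α u v : X → ℂ}
    (hα : ContinuousAt α x₀) (hu : ContinuousAt u x₀) (hv : ContinuousAt v x₀)
    (h₀ : u x₀ = v x₀) (hd : critGreen (α x₀) < green (α x₀) (u x₀)) (n : ℕ)
    (h : ∀ᶠ x in 𝓝 x₀, (f (α x))^[n] (u x) = (f (α x))^[n] (v x)) : u =ᶠ[𝓝 x₀] v := by
  induction n with
  | zero => exact h.mono fun x hx => hx
  | succ n ih =>
    refine ih ?_
    have hc : ∀ w : X → ℂ, ContinuousAt w x₀ →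
        ContinuousAt (fun x => (f (α x))^[n] (w x)) x₀ := fun w hw =>
      ContinuousAt.comp (f := fun x => (α x, w x)) (g := fun p : ℂ × ℂ => (f p.1)^[n] p.2)
        (continuous_f_iterate n).continuousAt (hα.prodMk hw)
    refine eventuallyEq_of_f_eq (a₀ := α x₀) (z₀ := (f (α x₀))^[n] (u x₀)) hα (hc u hu)
      (by rw [h₀]; exact hc v hv) (deriv_ne_zero_of_critGreen_lt ?_) ?_
    · rw [green_f_iterate]
      have h1 : (1 : ℝ) ≤ 3 ^ n := one_le_pow₀ (by norm_num)
      nlinarith [green_nonneg (α x₀) (u x₀)]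
    · filter_upwards [h] with x hx
      simpa only [Function.iterate_succ_apply'] using hx

/-- Put `d = ζ - ζ'`. Iterating into the far region gives only `3 ^ n * d ∈ 2πiℤ`. But then `psi a
(t + d)` and `psi a t` have equal `n`-th iterates and agree at `ζ'`, hence agree near it, hence on
the whole half plane. Far to the right this forces `d ∈ 2πiℤ`. -/
theorem psi_eq_iff {a ζ ζ' : ℂ} (h : critGreen a < ζ.re) (h' : critGreen a < ζ'.re) :
    psi a ζ = psi a ζ' ↔ ∃ k : ℤ, ζ = ζ' + k * (2 * Real.pi * Complex.I) := by
  refine ⟨fun e => ?_, fun ⟨k, hk⟩ => by rw [hk, psi_add_int_mul h']⟩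
  have hpos := (critGreen_nonneg a).trans_lt h
  have hpos' := (critGreen_nonneg a).trans_lt h'
  obtain ⟨n, hn, hn'⟩ := ((exists_farBound_lt (a := a) hpos).and
    (exists_farBound_lt (a := a) hpos')).exists
  have hre : ζ.re = ζ'.re := by rw [← green_psi h, e, green_psi h']
  set d := ζ - ζ' with hd
  have hdre : d.re = 0 := by rw [hd, Complex.sub_re, hre, sub_self]
  have e1 : psi a (3 ^ n * ζ) = psi a (3 ^ n * ζ') := by
    rw [← f_iterate_psi h, ← f_iterate_psi h', e]
  rw [psi_eq_psiInf (max_lt_iff.1 hn).1 (max_lt_iff.1 hn).2,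
    psi_eq_psiInf (max_lt_iff.1 hn').1 (max_lt_iff.1 hn').2,
    psiInf_eq_iff (max_lt_iff.1 hn).2.le (max_lt_iff.1 hn').2.le] at e1
  obtain ⟨k, hk⟩ := e1
  have ho : IsOpen {ζ : ℂ | critGreen a < ζ.re} := isOpen_lt continuous_const Complex.continuous_re
  have hshift : ∀ t : ℂ, (t + d).re = t.re := fun t => by rw [Complex.add_re, hdre, add_zero]
  have hev : (fun t => psi a (t + d)) =ᶠ[𝓝 ζ'] psi a := by
    refine eventuallyEq_of_f_iterate_eq (α := fun _ => a) continuousAt_const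
      ((analyticOnNhd_psi_add a d hdre ζ' h').continuousAt) (continuousAt_psi_right h')
      (by rw [← e, hd]; simp) ?_ n ?_
    · rw [green_psi (by rw [hshift]; exact h'), hshift]; exact h'
    · filter_upwards [ho.mem_nhds h'] with t ht
      rw [f_iterate_psi (by rw [hshift]; exact ht), f_iterate_psi ht,
        show (3 : ℂ) ^ n * (t + d) = 3 ^ n * t + k * (2 * Real.pi * Complex.I) by
          rw [hd]; linear_combination hk,
        psi_add_int_mul (critGreen_lt_pow_mul_re ht n)]
  have hall := eqOn_half_of_eventuallyEq (analyticOnNhd_psi_add a d hdre) (analyticOnNhd_psi a)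
    h' hev
  set ζ₀ : ℂ := ((farBound a + 1 : ℝ) : ℂ)
  have h₀ : farBound a < ζ₀.re := by rw [Complex.ofReal_re]; linarith
  have e2 := hall ζ₀ (max_lt_iff.1 h₀).1
  rw [psi_eq_psiInf (max_lt_iff.1 h₀).1 (max_lt_iff.1 h₀).2,
    psi_eq_psiInf (by rw [hshift]; exact (max_lt_iff.1 h₀).1)
      (by rw [hshift]; exact (max_lt_iff.1 h₀).2),
    psiInf_eq_iff (by rw [hshift]; exact (max_lt_iff.1 h₀).2.le) (max_lt_iff.1 h₀).2.le] at e2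
  obtain ⟨j, hj⟩ := e2
  exact ⟨j, by linear_combination hj + hd⟩

/-! ### Surjectivity of the inverse Böttcher coordinate -/

/-- Vieta for a fibre of three distinct points; besides the factorization below, it controls the
limits of three rays in `sum_lands`. -/
theorem sum_roots {a y x₀ x₁ x₂ : ℂ} (h01 : x₀ ≠ x₁) (h02 : x₀ ≠ x₂) (h12 : x₁ ≠ x₂)
    (h0 : f a x₀ = y) (h1 : f a x₁ = y) (h2 : f a x₂ = y) : x₀ + x₁ + x₂ = -a := by
  have e1 := f_sub_f a x₀ x₁
  have e2 := f_sub_f a x₀ x₂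
  rw [h0, h1, sub_self, eq_comm, mul_eq_zero, or_iff_right (sub_ne_zero.2 h01)] at e1
  rw [h0, h2, sub_self, eq_comm, mul_eq_zero, or_iff_right (sub_ne_zero.2 h02)] at e2
  have e3 : (x₁ - x₂) * (x₀ + x₁ + x₂ + a) = 0 := by linear_combination e1 - e2
  have := (mul_eq_zero.1 e3).resolve_left (sub_ne_zero.2 h12)
  linear_combination this

theorem f_sub_eq_prod {a y x₀ x₁ x₂ : ℂ} (h01 : x₀ ≠ x₁) (h02 : x₀ ≠ x₂) (h12 : x₁ ≠ x₂)
    (h0 : f a x₀ = y) (h1 : f a x₁ = y) (h2 : f a x₂ = y) (w : ℂ) :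
    f a w - y = (w - x₀) * (w - x₁) * (w - x₂) := by
  have hs := sum_roots h01 h02 h12 h0 h1 h2
  have e1 := f_sub_f a x₀ x₁
  rw [h0, h1, sub_self, eq_comm, mul_eq_zero, or_iff_right (sub_ne_zero.2 h01)] at e1
  have ha : a = -(x₀ + x₁ + x₂) := by rw [hs, neg_neg]
  rw [← h0]
  unfold f
  subst ha
  linear_combination (w - x₀) * e1

/-- The translation by `k / 3` of a full turn in logarithmic coordinates. -/
def turn (k : ℕ) : ℂ := (k : ℂ) / 3 * (2 * Real.pi * Complex.I)

theorem turn_re (k : ℕ) : (turn k).re = 0 := by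
  unfold turn
  have : (k : ℂ) / 3 * (2 * Real.pi * Complex.I) =
    ((k / 3 * (2 * Real.pi) : ℝ) : ℂ) * Complex.I := by push_cast; ring
  rw [this, Complex.re_ofReal_mul, Complex.I_re, mul_zero]

theorem add_turn_re (ζ : ℂ) (k : ℕ) : (ζ + turn k).re = ζ.re := by
  rw [Complex.add_re, turn_re, add_zero]

theorem f_psi_turn {a ζ : ℂ} (h : critGreen a < ζ.re) (k : ℕ) :
    f a (psi a (ζ + turn k)) = psi a (3 * ζ) := by
  have h3 : critGreen a < (3 * ζ).re := by
    have := critGreen_lt_pow_mul_re h 1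
    rwa [pow_one] at this
  rw [f_psi (by rwa [add_turn_re]), ← psi_add_int_mul h3 k]
  congr 1
  unfold turn
  push_cast
  ring

theorem psi_turn_ne {a ζ : ℂ} (h : critGreen a < ζ.re) {j k : ℕ} (hjk : j < k) (hk : k < j + 3) :
    psi a (ζ + turn j) ≠ psi a (ζ + turn k) := by
  intro e
  obtain ⟨m, hm⟩ := (psi_eq_iff (by rwa [add_turn_re]) (by rwa [add_turn_re])).1 e
  unfold turn at hm
  have h1 : ((j : ℂ) - k - 3 * m) * (2 * Real.pi * Complex.I) = 0 := by
    linear_combination 3 * hm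
  rw [mul_eq_zero, or_iff_left Complex.two_pi_I_ne_zero] at h1
  have h2 : (j : ℤ) - k - 3 * m = 0 := by exact_mod_cast h1
  omega

theorem exists_turn_of_f_eq {a z ζ : ℂ} (h : critGreen a < ζ.re) (e : f a z = psi a (3 * ζ)) :
    ∃ k < 3, z = psi a (ζ + turn k) := by
  have := f_sub_eq_prod (psi_turn_ne h (j := 0) (k := 1) (by norm_num) (by norm_num))
    (psi_turn_ne h (j := 0) (k := 2) (by norm_num) (by norm_num))
    (psi_turn_ne h (j := 1) (k := 2) (by norm_num) (by norm_num))
    (f_psi_turn h 0) (f_psi_turn h 1) (f_psi_turn h 2) z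
  rw [e, sub_self, eq_comm, mul_eq_zero, mul_eq_zero, sub_eq_zero, sub_eq_zero, sub_eq_zero] at this
  rcases this with (h | h) | h
  · exact ⟨0, by norm_num, h⟩
  · exact ⟨1, by norm_num, h⟩
  · exact ⟨2, by norm_num, h⟩

theorem psi_logB_log {a z : ℂ} (hz : Real.exp 1 * escR a ≤ ‖z‖) (hg : farBound a < green a z) :
    (logB a (Complex.log z)).re = green a z ∧ psi a (logB a (Complex.log z)) = z := by
  have hR := escR_pos a
  have hz0 : z ≠ 0 := norm_pos_iff.1 (lt_of_lt_of_le (by positivity) hz)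
  have h1 : logR a + 1 ≤ (Complex.log z).re := by
    have := Real.log_le_log (by positivity) hz
    rw [Real.log_mul (Real.exp_pos 1).ne' hR.ne', Real.log_exp] at this
    rw [Complex.log_re, logR]; linarith
  have h2 : (logB a (Complex.log z)).re = green a z := by
    rw [logB_re (by linarith), Complex.exp_log hz0]
  obtain ⟨h3, h4⟩ := max_lt_iff.1 (show max _ _ < _ from hg)
  refine ⟨h2, ?_⟩
  rw [psi_eq_psiInf (by rwa [h2]) (by rwa [h2]), psiInf_logB h1 (by rw [h2]; exact h4.le),
    Complex.exp_log hz0]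

/-- The three points `psi a (ζ / 3 + turn k)` are distinct and exhaust the fibre over `psi a ζ`, so
the range of `psi a` can be pulled back along the orbit as long as the Green value exceeds
`critGreen a`. -/
theorem exists_psi_eq_of_iterate {a : ℂ} (n : ℕ) : ∀ z, critGreen a < green a z →
    (∃ ζ : ℂ, critGreen a < ζ.re ∧ psi a ζ = (f a)^[n] z) →
    ∃ ζ : ℂ, critGreen a < ζ.re ∧ psi a ζ = z := by
  induction n with
  | zero => exact fun z _ h => h
  | succ n ih =>
    intro z hz h
    have h0 := critGreen_nonneg a
    rw [Function.iterate_succ_apply] at h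
    obtain ⟨ζ, hζ, e⟩ := ih (f a z) (by rw [green_f]; linarith) h
    have hre : ζ.re = 3 * green a z := by rw [← green_psi hζ, e, green_f]
    have h3 : critGreen a < (ζ / 3).re := by
      rw [Complex.div_ofNat_re, hre]; linarith
    obtain ⟨k, -, hk⟩ := exists_turn_of_f_eq (z := z) h3 (by rw [← e]; congr 1; ring)
    exact ⟨ζ / 3 + turn k, by rwa [add_turn_re], hk.symm⟩

theorem exists_psi_eq {a z : ℂ} (h : critGreen a < green a z) :
    ∃ ζ : ℂ, critGreen a < ζ.re ∧ psi a ζ = z := by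
  have hpos := (critGreen_nonneg a).trans_lt h
  have ht : Tendsto (fun n : ℕ => (3 : ℝ) ^ n * green a z) atTop atTop :=
    (tendsto_pow_atTop_atTop_of_one_lt (by norm_num)).atTop_mul_const hpos
  obtain ⟨n, hn1, hn2⟩ := ((ht.eventually_gt_atTop (farBound a)).and
    ((tendsto_norm_iterate hpos).eventually_ge_atTop (Real.exp 1 * escR a))).exists
  rw [← green_f_iterate] at hn1
  obtain ⟨h1, h2⟩ := psi_logB_log hn2 hn1
  exact exists_psi_eq_of_iterate n z h
    ⟨_, by rw [h1]; exact (le_max_left _ _).trans_lt hn1, h2⟩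

/-! ### Holomorphic dependence -/

theorem continuous_farBound : Continuous farBound :=
  continuous_critGreen.max (continuous_logR.add continuous_const)

/-- After `n` iterations the point is in the region where `logB` is an explicit holomorphic
function. Taking an analytic logarithm there and dividing by `3 ^ n` defines `Z`; cancelling the
iterates near `t₀` shows that it solves the original equation. -/
theorem exists_analytic_psi_preimage {α w : ℂ → ℂ} {t₀ ζ₀ : ℂ} (hα : AnalyticAt ℂ α t₀)
    (hw : AnalyticAt ℂ w t₀) (hζ₀ : critGreen (α t₀) < ζ₀.re) (h₀ : psi (α t₀) ζ₀ = w t₀) :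
    ∃ Z : ℂ → ℂ, AnalyticAt ℂ Z t₀ ∧ Z t₀ = ζ₀ ∧
      ∀ᶠ t in 𝓝 t₀, critGreen (α t) < (Z t).re ∧ psi (α t) (Z t) = w t := by
  obtain ⟨n, hn⟩ := (exists_farBound_lt (a := α t₀)
    ((critGreen_nonneg _).trans_lt hζ₀)).exists
  obtain ⟨hn1, hn2⟩ := max_lt_iff.1 (show max _ _ < _ from hn)
  set ξ₀ := logBInv (α t₀) (3 ^ n * ζ₀) with hξ₀
  have hξre := logBInv_re hn2.le
  have hξB := logB_logBInv hn2.le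
  set y : ℂ → ℂ := fun t => (f (α t))^[n] (w t) with hy
  have hy0 : y t₀ = Complex.exp ξ₀ := by
    simp only [hy]
    rw [← h₀, f_iterate_psi hζ₀, psi_eq_psiInf hn1 hn2, psiInf]
  have hyan : AnalyticAt ℂ y t₀ := by
    have hev : ∀ᶠ t in 𝓝 t₀, AnalyticAt ℂ α t ∧ AnalyticAt ℂ w t :=
      hα.eventually_analyticAt.and hw.eventually_analyticAt
    obtain ⟨U, hU, hUo, hmem⟩ := eventually_nhds_iff.1 hev
    exact DifferentiableOn.analyticAt (differentiableOn_f_iterate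
      (fun t ht => (hU t ht).1.differentiableAt.differentiableWithinAt)
      (fun t ht => (hU t ht).2.differentiableAt.differentiableWithinAt) n) (hUo.mem_nhds hmem)
  -- Dividing by `y t₀` brings the argument near `1`, where the principal logarithm is analytic;
  -- `ξ₀` restores the required branch.
  set ξ : ℂ → ℂ := fun t => ξ₀ + Complex.log (y t / y t₀) with hξ
  have hy0' : y t₀ ≠ 0 := by rw [hy0]; exact Complex.exp_ne_zero _
  have hξan : AnalyticAt ℂ ξ t₀ := by
    refine analyticAt_const.add ((hyan.div analyticAt_const hy0').clog ?_)
    rw [Pi.div_apply, div_self hy0']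
    exact Complex.one_mem_slitPlane
  have hξt : ξ t₀ = ξ₀ := by simp [hξ, div_self hy0']
  have hexp : ∀ᶠ t in 𝓝 t₀, Complex.exp (ξ t) = y t := by
    filter_upwards [hyan.continuousAt.eventually_ne hy0'] with t ht
    simp only [hξ]
    rw [Complex.exp_add, Complex.exp_log (div_ne_zero ht hy0'), ← hy0]
    field_simp
  have hcα : ContinuousAt α t₀ := hα.continuousAt
  have hξR : ∀ᶠ t in 𝓝 t₀, logR (α t) + 1 < (ξ t).re := by
    refine ContinuousAt.eventually_lt
      ((continuous_logR.continuousAt.comp hcα).add continuousAt_const)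
      (Complex.continuous_re.continuousAt.comp hξan.continuousAt) ?_
    simp only [hξt]
    linarith
  have hBan : AnalyticAt ℂ (fun t => logB (α t) (ξ t)) t₀ := by
    refine hξan.add ?_
    obtain ⟨U, hU, hUo, hmem⟩ := eventually_nhds_iff.1
      ((hα.eventually_analyticAt.and hξan.eventually_analyticAt).and hξR)
    refine DifferentiableOn.analyticAt (s := U) (differentiableOn_hinf hUo
      (fun t ht => (hU t ht).1.1.differentiableAt.differentiableWithinAt)
      (fun t ht => ((hU t ht).1.2.differentiableAt.cexp).differentiableWithinAt)
      fun t ht => escR_le_norm_exp.2 (by linarith [(hU t ht).2])) (hUo.mem_nhds hmem)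
  set Z : ℂ → ℂ := fun t => logB (α t) (ξ t) / 3 ^ n with hZ
  have hZan : AnalyticAt ℂ Z t₀ := hBan.div_const
  have hZ3 : ∀ t, 3 ^ n * Z t = logB (α t) (ξ t) := fun t => by
    simp only [hZ]; field_simp
  have hZ0 : Z t₀ = ζ₀ := by
    simp only [hZ, hξt]
    rw [hξ₀, hξB]; field_simp
  have hZre : ∀ᶠ t in 𝓝 t₀, critGreen (α t) < (Z t).re := by
    refine ContinuousAt.eventually_lt (continuous_critGreen.continuousAt.comp hcα)
      (Complex.continuous_re.continuousAt.comp hZan.continuousAt) ?_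
    simp only [hZ0]
    exact hζ₀
  have hfar : ∀ᶠ t in 𝓝 t₀, farBound (α t) < (logB (α t) (ξ t)).re := by
    refine ContinuousAt.eventually_lt (continuous_farBound.continuousAt.comp hcα)
      (Complex.continuous_re.continuousAt.comp hBan.continuousAt) ?_
    simp only [hξt]
    rw [hξ₀, hξB]; exact hn
  refine ⟨Z, hZan, hZ0, hZre.and ?_⟩
  have hcpsi : ContinuousAt (fun t => psi (α t) (Z t)) t₀ :=
    ContinuousAt.comp (f := fun t => (α t, Z t)) (g := fun p : ℂ × ℂ => psi p.1 p.2)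
      (continuousAt_psi (by rw [hZ0]; exact hζ₀)) (hcα.prodMk hZan.continuousAt)
  refine eventuallyEq_of_f_iterate_eq hcα hcpsi hw.continuousAt (by rw [hZ0, h₀])
    (by rw [hZ0, green_psi hζ₀]; exact hζ₀) n ?_
  filter_upwards [hZre, hfar, hξR, hexp] with t h1 h2 h3 h4
  obtain ⟨h5, h6⟩ := max_lt_iff.1 (show max _ _ < _ from h2)
  rw [f_iterate_psi h1, hZ3, psi_eq_psiInf h5 h6, psiInf_logB h3.le h6.le, h4]

/-! ### The Böttcher coordinate -/

theorem continuous_green_right (a : ℂ) : Continuous (green a) :=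
  Continuous.comp (g := fun p : ℂ × ℂ => green p.1 p.2) (f := fun z : ℂ => (a, z))
    continuous_green (by fun_prop)

theorem isOpen_bottcherDomain (a : ℂ) : IsOpen (bottcherDomain a) := by
  have : bottcherDomain a = {z | critGreen a < green a z} :=
    Set.ext fun z => mem_bottcherDomain_iff
  rw [this]
  exact isOpen_lt continuous_const (continuous_green_right a)

open Classical in
/-- The Böttcher coordinate, as the inverse of `psi`. -/
def bott (a z : ℂ) : ℂ :=
  if h : critGreen a < green a z then Complex.exp (exists_psi_eq h).choose else 0

theorem bott_psi {a ζ : ℂ} (h : critGreen a < ζ.re) : bott a (psi a ζ) = Complex.exp ζ := by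
  have h' : critGreen a < green a (psi a ζ) := by rwa [green_psi h]
  rw [bott, dif_pos h']
  obtain ⟨h1, h2⟩ := (exists_psi_eq h').choose_spec
  exact Complex.exp_eq_exp_iff_exists_int.2 ((psi_eq_iff h1 h).1 h2)

theorem bott_eq_of_large {a z : ℂ} (hz : Real.exp 1 * escR a ≤ ‖z‖) (hg : farBound a < green a z) :
    bott a z = z * Complex.exp (hinf a z) := by
  obtain ⟨h1, h2⟩ := psi_logB_log hz hg
  have hR := escR_pos a
  have hz0 : z ≠ 0 := norm_pos_iff.1 (lt_of_lt_of_le (by positivity) hz)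
  have h3 : critGreen a < (logB a (Complex.log z)).re := by
    rw [h1]; exact (le_max_left _ _).trans_lt hg
  have := bott_psi h3
  rwa [h2, logB, Complex.exp_add, Complex.exp_log hz0] at this

theorem eventually_large (a : ℂ) : ∀ᶠ z in Bornology.cobounded ℂ,
    Real.exp 1 * escR a ≤ ‖z‖ ∧ farBound a < green a z := by
  have hR := escR_pos a
  filter_upwards [eventually_cobounded_le_norm (Real.exp 1 * escR a),
    eventually_cobounded_le_norm (Real.exp (farBound a + 1 + Real.log 2))] with z h1 h2
  refine ⟨h1, ?_⟩
  have h3 : escR a ≤ ‖z‖ := by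
    have := Real.add_one_le_exp 1
    nlinarith
  have h4 := Real.log_le_log (Real.exp_pos _) h2
  rw [Real.log_exp] at h4
  linarith [log_norm_sub_le_green h3]

theorem tendsto_bott_div (a : ℂ) :
    Tendsto (fun z => bott a z / z) (Bornology.cobounded ℂ) (𝓝 1) := by
  have h0 : Tendsto (fun z => hinf a z) (Bornology.cobounded ℂ) (𝓝 0) := by
    rw [tendsto_zero_iff_norm_tendsto_zero]
    have ht : Tendsto (fun z : ℂ => 3 / 4 * ((1 + ‖a‖) / ‖z‖)) (Bornology.cobounded ℂ) (𝓝 0) := by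
      have := (tendsto_norm_cobounded_atTop (E := ℂ)).const_div_atTop (1 + ‖a‖)
      simpa using this.const_mul (3 / 4)
    refine squeeze_zero' (Eventually.of_forall fun _ => norm_nonneg _) ?_ ht
    filter_upwards [eventually_cobounded_le_norm (escR a)] with z hz
    exact norm_hinf_le_div hz
  have h1 := (Complex.continuous_exp.tendsto 0).comp h0
  rw [Complex.exp_zero] at h1
  refine h1.congr' ?_
  filter_upwards [eventually_large a] with z hz
  have hR := escR_pos a
  have hz0 : z ≠ 0 := norm_pos_iff.1 (lt_of_lt_of_le (by positivity) hz.1)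
  rw [bott_eq_of_large hz.1 hz.2]
  simp [hz0]

theorem isBottcher_bott (a : ℂ) : IsBottcher a (bott a) where
  holomorphic := by
    intro z hz
    rw [mem_bottcherDomain_iff] at hz
    obtain ⟨ζ, hζ, e⟩ := exists_psi_eq hz
    obtain ⟨Z, hZ, -, hev⟩ := exists_analytic_psi_preimage (α := fun _ => a) (w := fun t => t)
      analyticAt_const analyticAt_id hζ e
    refine (hZ.differentiableAt.cexp.congr_of_eventuallyEq ?_).differentiableWithinAt
    filter_upwards [hev] with t ht
    have := bott_psi ht.1
    rwa [ht.2] at this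
  conj := by
    intro z hz
    rw [mem_bottcherDomain_iff] at hz
    obtain ⟨ζ, hζ, rfl⟩ := exists_psi_eq hz
    have h3 := critGreen_lt_pow_mul_re hζ 1
    rw [pow_one] at h3
    rw [f_psi hζ, bott_psi h3, bott_psi hζ, ← Complex.exp_nat_mul]
    norm_num
  tangent := tendsto_bott_div a

theorem eq_one_of_pow_three_pow_near {q : ℂ} (h : ∀ n : ℕ, ‖q ^ 3 ^ n - 1‖ ≤ 1 / 2) : q = 1 := by
  -- The point `1` is repelling for cubing: with `x = q ^ 3 ^ n - 1` the next difference is `x (3 +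
  -- 3x + x²)`, and `‖x‖ ≤ 1/2` keeps the second factor at least `3 - 7/4 = 5/4`.
  have key : ∀ n : ℕ, (5 / 4 : ℝ) ^ n * ‖q - 1‖ ≤ ‖q ^ 3 ^ n - 1‖ := by
    intro n
    induction n with
    | zero => simp
    | succ n ih =>
      set x := q ^ 3 ^ n - 1 with hx
      have e : q ^ 3 ^ (n + 1) - 1 = x * (3 + (3 * x + x ^ 2)) := by
        rw [pow_succ, pow_mul, hx]; ring
      have hx2 := h n
      rw [← hx] at hx2
      have h1 : (5 / 4 : ℝ) ≤ ‖3 + (3 * x + x ^ 2)‖ := by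
        have h2 : ‖3 * x + x ^ 2‖ ≤ 3 * ‖x‖ + ‖x‖ ^ 2 := by
          refine (norm_add_le _ _).trans (le_of_eq ?_); simp
        have h3 : ‖(3 : ℂ)‖ - ‖3 * x + x ^ 2‖ ≤ ‖3 + (3 * x + x ^ 2)‖ := by
          simpa using norm_sub_norm_le (3 : ℂ) (-(3 * x + x ^ 2))
        rw [Complex.norm_ofNat] at h3
        nlinarith [norm_nonneg x]
      rw [e, norm_mul, pow_succ]
      nlinarith [norm_nonneg x, mul_le_mul ih h1 (by norm_num) (norm_nonneg x)]
  by_contra hq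
  have hpos : 0 < ‖q - 1‖ := norm_pos_iff.2 (sub_ne_zero.2 hq)
  have ht : Tendsto (fun n : ℕ => (5 / 4 : ℝ) ^ n * ‖q - 1‖) atTop atTop :=
    (tendsto_pow_atTop_atTop_of_one_lt (by norm_num)).atTop_mul_const hpos
  obtain ⟨n, hn⟩ := (ht.eventually_gt_atTop (1 / 2)).exists
  linarith [key n, h n]

theorem bott_ne_zero {a z : ℂ} (h : critGreen a < green a z) : bott a z ≠ 0 := by
  rw [bott, dif_pos h]; exact Complex.exp_ne_zero _

/-- The ratio of two Böttcher coordinates tends to `1` at infinity and is cubed by `f a`, so all its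
`3 ^ n`-th powers at a far point remain near `1`, and it equals `1` there. The identity theorem,
applied after composing with `psi a`, spreads the equality to the whole domain. This identifies the
coordinate picked by `Classical.epsilon`. -/
theorem IsBottcher.eq_bott {a : ℂ} {φ : ℂ → ℂ} (hφ : IsBottcher a φ) {z : ℂ}
    (hz : z ∈ bottcherDomain a) : φ z = bott a z := by
  have hq : Tendsto (fun z => φ z / bott a z) (Bornology.cobounded ℂ) (𝓝 1) := by
    have := hφ.tangent.div (tendsto_bott_div a) one_ne_zero
    rw [div_one] at this
    refine this.congr' ?_
    filter_upwards [eventually_cobounded_le_norm (escR a)] with z hz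
    have := ne_zero_of_escR_le hz
    simp only [Pi.div_apply]
    rw [div_div_div_cancel_right₀ this]
  have hq' : ∀ᶠ z in Bornology.cobounded ℂ, ‖φ z / bott a z - 1‖ ≤ 1 / 2 := by
    have := (tendsto_iff_norm_sub_tendsto_zero.1 hq).eventually_le_const
      (show (0 : ℝ) < 1 / 2 by norm_num)
    exact this
  obtain ⟨C, hC⟩ := (hasBasis_cobounded_norm (E := ℂ)).eventually_iff.1 (hq'.and (eventually_large a))
  have hfar : ∀ z, max C (escR a) ≤ ‖z‖ → φ z = bott a z := by
    intro z hz
    have hzC : C ≤ ‖z‖ := (le_max_left _ _).trans hz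
    have hzR : escR a ≤ ‖z‖ := (le_max_right _ _).trans hz
    have hdom : ∀ n, critGreen a < green a ((f a)^[n] z) := fun n =>
      (le_max_left _ _).trans_lt (hC.2 (hzC.trans (norm_le_norm_iterate hzR n))).2.2
    have hpow : ∀ n : ℕ, φ ((f a)^[n] z) / bott a ((f a)^[n] z) = (φ z / bott a z) ^ 3 ^ n := by
      intro n
      induction n with
      | zero => simp
      | succ n ih =>
        have hd := mem_bottcherDomain_iff.2 (hdom n)
        rw [Function.iterate_succ_apply', hφ.conj _ hd, (isBottcher_bott a).conj _ hd, ← div_pow, ih,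
          ← pow_mul, pow_succ]
    have := eq_one_of_pow_three_pow_near (q := φ z / bott a z) fun n => by
      rw [← hpow]
      exact (hC.2 (hzC.trans (norm_le_norm_iterate hzR n))).1
    exact (div_eq_one_iff_eq (bott_ne_zero (hdom 0))).1 this
  obtain ⟨ζ, hζ, rfl⟩ := exists_psi_eq (mem_bottcherDomain_iff.1 hz)
  rw [bott_psi hζ]
  set C' := max (max C (escR a)) 1
  -- A Green value above `m` forces `|z| > C'`, by `green_le_posLog_add`.
  set m := max (critGreen a) (Real.posLog C' + greenBound a) with hm
  set ζ₀ : ℂ := ((m + 1 : ℝ) : ℂ)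
  have hre : m < ζ₀.re := by rw [Complex.ofReal_re]; linarith
  refine eqOn_half_of_eventuallyEq (m := critGreen a) (g := fun ζ => φ (psi a ζ)) (h := Complex.exp)
    ?_ (fun z _ => analyticAt_cexp) (ζ₀ := ζ₀) ((le_max_left _ _).trans_lt hre) ?_ ζ hζ
  · refine DifferentiableOn.analyticOnNhd (fun ζ hζ => ?_)
      (isOpen_lt continuous_const Complex.continuous_re)
    have hmem : psi a ζ ∈ bottcherDomain a :=
      mem_bottcherDomain_iff.2 (by rw [green_psi hζ]; exact hζ)
    exact (DifferentiableAt.comp ζ (hφ.holomorphic.differentiableAt ((isOpen_bottcherDomain a).mem_nhds hmem))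
      (differentiableAt_psi hζ)).differentiableWithinAt
  · have ho : IsOpen {ζ : ℂ | m < ζ.re} := isOpen_lt continuous_const Complex.continuous_re
    filter_upwards [ho.mem_nhds hre] with t ht
    have ht' : m < t.re := ht
    have h1 := (le_max_left _ _).trans_lt ht'
    have h2 := (le_max_right _ _).trans_lt ht'
    rw [hfar, bott_psi h1]
    by_contra! hlt
    have h3 := green_le_posLog_add a (psi a t)
    rw [green_psi h1] at h3
    have h4 := Real.posLog_le_posLog (norm_nonneg _) (hlt.le.trans (le_max_left _ 1))
    linarith

theorem isBottcher_bottcher (a : ℂ) : IsBottcher a (bottcher a) :=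
  Classical.epsilon_spec ⟨bott a, isBottcher_bott a⟩

theorem bottcher_psi {a ζ : ℂ} (h : critGreen a < ζ.re) :
    bottcher a (psi a ζ) = Complex.exp ζ := by
  rw [(isBottcher_bottcher a).eq_bott (mem_bottcherDomain_iff.2 (by rwa [green_psi h])), bott_psi h]

/-! ### A critical point with bounded orbit -/

theorem f_zero (a : ℂ) : f a 0 = 0 := by simp [f]

theorem f_iterate_zero (a : ℂ) (n : ℕ) : (f a)^[n] 0 = 0 := by
  induction n with
  | zero => rfl
  | succ n ih => rw [Function.iterate_succ_apply', ih, f_zero]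

theorem green_zero (a : ℂ) : green a 0 = 0 :=
  green_eq_zero_of_bounded (C := 0) fun n => by rw [f_iterate_zero, norm_zero]

theorem exists_crit_green_eq_zero_of_zero : ∃ c : ℂ, 3 * c ^ 2 + 2 * 0 * c + 1 = 0 ∧
    green 0 c = 0 := by
  refine ⟨critA 0, crit_iff.2 (Or.inl rfl), green_eq_zero_of_bounded (C := 1) fun n => ?_⟩
  have hc : 3 * critA 0 ^ 2 + 2 * 0 * critA 0 + 1 = 0 := crit_iff.2 (Or.inl rfl)
  -- For `a = 0` the square of the orbit evolves by `x ↦ x (x + 1)²`, which preserves `[-1, 0]`, and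
  -- it starts at `-1/3`.
  have key : ∃ s : ℝ, 0 ≤ s ∧ s ≤ 1 ∧ ((f 0)^[n] (critA 0)) ^ 2 = ((-s : ℝ) : ℂ) := by
    induction n with
    | zero =>
      refine ⟨1 / 3, by norm_num, by norm_num, ?_⟩
      push_cast
      simp only [Function.iterate_zero, id]
      linear_combination (1 / 3) * hc
    | succ n ih =>
      obtain ⟨s, h0, h1, hs⟩ := ih
      refine ⟨s * (1 - s) ^ 2, by positivity, ?_, ?_⟩
      · have : (1 - s) ^ 2 ≤ 1 := by nlinarith
        nlinarith [sq_nonneg (1 - s)]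
      · rw [Function.iterate_succ_apply']
        set z := (f 0)^[n] (critA 0)
        have : f 0 z ^ 2 = z ^ 2 * (z ^ 2 + 1) ^ 2 := by unfold f; ring
        rw [this, hs]
        push_cast
        ring
  obtain ⟨s, h0, h1, hs⟩ := key
  have h2 := congrArg norm hs
  rw [norm_pow, Complex.norm_real, Real.norm_eq_abs, abs_neg, abs_of_nonneg h0] at h2
  have := norm_nonneg ((f 0)^[n] (critA 0))
  nlinarith

/-- Inverse branches of the iterates fixing the parabolic point. Inverse steps divide the Green
function by `3`, so values stay below the critical level `m` and the next branch meets no critical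
value. A point outside the escape disc has its image outside too, which keeps all the branches
uniformly bounded. -/
theorem exists_inverse_branch {a : ℂ} {m δ : ℝ} (hδ : 0 < δ) (hδ1 : δ ≤ 1)
    (hm : ∀ c, 3 * c ^ 2 + 2 * a * c + 1 = 0 → m ≤ green a c)
    (hball : ∀ x ∈ Metric.ball (0 : ℂ) δ, green a x < m) (n : ℕ) :
    ∃ g : ℂ → ℂ, DifferentiableOn ℂ g (Metric.ball 0 δ) ∧ g 0 = 0 ∧ deriv g 0 = 1 ∧
      deriv (deriv g) 0 = -2 * a * n ∧ ∀ x ∈ Metric.ball (0 : ℂ) δ, ‖g x‖ ≤ escR a ∧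
        green a (g x) < m := by
  classical
  have h0mem : (0 : ℂ) ∈ Metric.ball (0 : ℂ) δ := Metric.mem_ball_self hδ
  have hnhds : ∀ x ∈ Metric.ball (0 : ℂ) δ, Metric.ball (0 : ℂ) δ ∈ 𝓝 x := fun x hx =>
    Metric.isOpen_ball.mem_nhds hx
  induction n with
  | zero =>
    refine ⟨id, differentiableOn_id, rfl, by simp, by simp, fun x hx => ⟨?_, hball x hx⟩⟩
    have := mem_ball_zero_iff.1 hx
    simp only [id]
    linarith [four_le_escR a]
  | succ n ih =>
    obtain ⟨g, hg, hg0, hg1, hg2, hgb⟩ := ih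
    have : ContractibleSpace (Metric.ball (0 : ℂ) δ) :=
      (convex_ball (0 : ℂ) δ).contractibleSpace ⟨0, h0mem⟩
    have : LocallyPathConnectedSpace (Metric.ball (0 : ℂ) δ) :=
      Metric.isOpen_ball.locallyPathConnectedSpace
    have hcv : ∀ x ∈ Metric.ball (0 : ℂ) δ, ∀ c, 3 * c ^ 2 + 2 * a * c + 1 = 0 → f a c ≠ g x := by
      intro x hx c hc e
      have h1 := (hgb x hx).2
      rw [← e, green_f] at h1
      linarith [hm c hc, green_nonneg a c]
    obtain ⟨u, hu, hu0, hlift⟩ := exists_lift (X := Metric.ball (0 : ℂ) δ) (α := fun _ => a)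
      (y := fun x => g x) continuous_const
      (hg.continuousOn.comp_continuous continuous_subtype_val fun x => x.2)
      (fun x c hc => hcv x x.2 c hc) (x₀ := ⟨0, h0mem⟩) (z₀ := 0)
      (by simp only [hg0, f_zero])
    set h : ℂ → ℂ := fun x => if hx : x ∈ Metric.ball (0 : ℂ) δ then u ⟨x, hx⟩ else 0 with hh
    have hval : ∀ x (hx : x ∈ Metric.ball (0 : ℂ) δ), h x = u ⟨x, hx⟩ := fun x hx => by
      simp only [hh, dif_pos hx]
    have hl : ∀ x ∈ Metric.ball (0 : ℂ) δ, f a (h x) = g x := fun x hx => by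
      rw [hval x hx]; exact hlift ⟨x, hx⟩
    have hcont : ContinuousOn h (Metric.ball 0 δ) := by
      rw [continuousOn_iff_continuous_domRestrict]
      convert hu using 1
      ext x
      exact hval x.1 x.2
    have hd : ∀ x ∈ Metric.ball (0 : ℂ) δ, DifferentiableAt ℂ h x := fun x hx => by
      refine differentiableAt_of_f_comp (a := a) (hcont.continuousAt (hnhds x hx))
        (hg.differentiableAt (hnhds x hx)) (fun hc => hcv x hx _ hc (hl x hx)) ?_
      filter_upwards [hnhds x hx] with t ht
      exact hl t ht
    have hh0 : h 0 = 0 := by rw [hval 0 h0mem, hu0]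
    have hderiv : ∀ x ∈ Metric.ball (0 : ℂ) δ,
        (3 * h x ^ 2 + 2 * a * h x + 1) * deriv h x = deriv g x := by
      intro x hx
      have h1 := (hasDerivAt_f a (h x)).comp x (hd x hx).hasDerivAt
      refine h1.deriv.symm.trans (Filter.EventuallyEq.deriv_eq ?_)
      filter_upwards [hnhds x hx] with t ht
      exact hl t ht
    have hh1 : deriv h 0 = 1 := by
      have := hderiv 0 h0mem
      rw [hh0, hg1] at this
      simpa using this
    have hdd : DifferentiableAt ℂ (deriv h) 0 := by
      have : DifferentiableOn ℂ h (Metric.ball 0 δ) := fun x hx => (hd x hx).differentiableWithinAt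
      exact (this.deriv Metric.isOpen_ball).differentiableAt (hnhds 0 h0mem)
    refine ⟨h, fun x hx => (hd x hx).differentiableWithinAt, hh0, hh1, ?_, fun x hx => ⟨?_, ?_⟩⟩
    -- Differentiating `f'(h) h' = g'` at `0` gives `h''(0) + 2a = g''(0)`: each inverse step adds
    -- `-2a` to the second derivative.
    · have hD := (hd 0 h0mem).hasDerivAt
      have h1 : HasDerivAt (fun x => (3 * h x ^ 2 + 2 * a * h x + 1) * deriv h x) _ 0 :=
        ((((hD.pow 2).const_mul 3).add (hD.const_mul (2 * a))).add_const 1).mul hdd.hasDerivAt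
      have hev : deriv g =ᶠ[𝓝 0] fun x => (3 * h x ^ 2 + 2 * a * h x + 1) * deriv h x := by
        filter_upwards [hnhds 0 h0mem] with t ht
        exact (hderiv t ht).symm
      have h2 := hev.deriv_eq.trans h1.deriv
      rw [hg2] at h2
      simp [hh0, hh1] at h2
      push_cast
      linear_combination -h2
    · by_contra! hlt
      have h1 := two_mul_norm_le hlt.le
      rw [hl x hx] at h1
      linarith [(hgb x hx).1, escR_pos a]
    · have h1 := (hgb x hx).2
      rw [← hl x hx, green_f] at h1
      linarith [green_nonneg a (h x)]

/-- If both critical points escaped, inverse branches of every iterate would exist on one disc about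
`0` with a common bound. Cauchy's estimate bounds their second derivatives, which are `-2 a n`. This
is impossible for `a ≠ 0`; the case `a = 0` is computed directly. -/
theorem exists_crit_green_eq_zero (a : ℂ) :
    ∃ c : ℂ, 3 * c ^ 2 + 2 * a * c + 1 = 0 ∧ green a c = 0 := by
  by_cases ha : a = 0
  · subst ha; exact exists_crit_green_eq_zero_of_zero
  by_contra! hne
  have hpos : ∀ c, 3 * c ^ 2 + 2 * a * c + 1 = 0 → 0 < green a c := fun c hc =>
    lt_of_le_of_ne (green_nonneg a c) (hne c hc).symm
  set m := min (green a (critA a)) (green a (critB a)) with hmdef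
  have hm0 : 0 < m := lt_min (hpos _ (crit_iff.2 (Or.inl rfl))) (hpos _ (crit_iff.2 (Or.inr rfl)))
  have hm : ∀ c, 3 * c ^ 2 + 2 * a * c + 1 = 0 → m ≤ green a c := by
    intro c hc
    rcases crit_iff.1 hc with rfl | rfl
    · exact min_le_left _ _
    · exact min_le_right _ _
  have hnh : {x | green a x < m} ∈ 𝓝 (0 : ℂ) :=
    (isOpen_lt (continuous_green_right a) continuous_const).mem_nhds
      (show green a 0 < m by rw [green_zero]; exact hm0)
  obtain ⟨δ₀, hδ₀, hsub⟩ := Metric.mem_nhds_iff.1 hnh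
  set δ := min δ₀ 1
  have hδ : 0 < δ := lt_min hδ₀ one_pos
  have hball : ∀ x ∈ Metric.ball (0 : ℂ) δ, green a x < m := fun x hx =>
    hsub (Metric.ball_subset_ball (min_le_left _ _) hx)
  have bound : ∀ n : ℕ, 2 * ‖a‖ * n ≤ 2 * escR a / (δ / 2) ^ 2 := by
    intro n
    obtain ⟨g, hg, -, -, hg2, hgb⟩ := exists_inverse_branch hδ (min_le_right _ _) hm hball n
    have hsub2 : Metric.closedBall (0 : ℂ) (δ / 2) ⊆ Metric.ball 0 δ :=
      Metric.closedBall_subset_ball (by linarith)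
    have := Complex.norm_iteratedDeriv_le_of_forall_mem_sphere_norm_le (c := (0 : ℂ)) (f := g) 2
      (by linarith : 0 < δ / 2) ((hg.mono hsub2).diffContOnCl_ball subset_rfl) (C := escR a)
      fun x hx => (hgb x (hsub2 (Metric.sphere_subset_closedBall hx))).1
    rw [iteratedDeriv_succ, iteratedDeriv_one, hg2] at this
    simpa using this
  have hapos : 0 < ‖a‖ := norm_pos_iff.2 ha
  obtain ⟨n, hn⟩ := exists_nat_gt (2 * escR a / (δ / 2) ^ 2 / (2 * ‖a‖))
  rw [div_lt_iff₀ (by positivity)] at hn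
  linarith [bound n]

/-! ### Parametrization by the critical point -/

/-- The parameter for which `c` is a critical point. -/
def paramOf (c : ℂ) : ℂ := -(3 * c ^ 2 + 1) / (2 * c)

theorem crit_ne_zero {a c : ℂ} (h : 3 * c ^ 2 + 2 * a * c + 1 = 0) : c ≠ 0 := by
  rintro rfl; simp at h

theorem crit_paramOf {c : ℂ} (hc : c ≠ 0) : 3 * c ^ 2 + 2 * paramOf c * c + 1 = 0 := by
  unfold paramOf; field_simp; ring

theorem eq_paramOf {a c : ℂ} (h : 3 * c ^ 2 + 2 * a * c + 1 = 0) : a = paramOf c := by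
  have := crit_ne_zero h
  unfold paramOf; field_simp; linear_combination h

theorem crit_other {a c : ℂ} (h : 3 * c ^ 2 + 2 * a * c + 1 = 0) :
    3 * (1 / (3 * c)) ^ 2 + 2 * a * (1 / (3 * c)) + 1 = 0 := by
  have := crit_ne_zero h
  field_simp; linear_combination h

theorem crit_eq_or {a c d : ℂ} (hc : 3 * c ^ 2 + 2 * a * c + 1 = 0)
    (hd : 3 * d ^ 2 + 2 * a * d + 1 = 0) : d = c ∨ d = 1 / (3 * c) := by
  have h0 := crit_ne_zero hc
  have e : (d - c) * (3 * c * d - 1) = 0 := by linear_combination c * hd - d * hc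
  rcases mul_eq_zero.1 e with h | h
  · exact Or.inl (sub_eq_zero.1 h)
  · right; field_simp; linear_combination h

/-- The critical points have product `1/3`, and at least one of them does not escape. -/
theorem green_other_eq_zero {a c : ℂ} (hc : 3 * c ^ 2 + 2 * a * c + 1 = 0)
    (hg : 0 < green a c) : green a (1 / (3 * c)) = 0 := by
  obtain ⟨d, hd, h0⟩ := exists_crit_green_eq_zero a
  rcases crit_eq_or hc hd with rfl | rfl
  · exact absurd h0 hg.ne'
  · exact h0

theorem f_crit {a c : ℂ} (h : 3 * c ^ 2 + 2 * a * c + 1 = 0) : f a c = c * (1 - c ^ 2) / 2 := by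
  unfold f; linear_combination (c / 2) * h

theorem norm_param_le {a c : ℂ} (h : 3 * c ^ 2 + 2 * a * c + 1 = 0) :
    2 * ‖a‖ * ‖c‖ ≤ 3 * ‖c‖ ^ 2 + 1 := by
  have e : 2 * a * c = -(3 * c ^ 2 + 1) := by linear_combination h
  have := congrArg norm e
  rw [norm_mul, norm_mul, norm_neg, Complex.norm_ofNat] at this
  rw [this]
  refine (norm_add_le _ _).trans (le_of_eq ?_)
  simp

theorem escR_le_norm_f_crit {a c : ℂ} (h : 3 * c ^ 2 + 2 * a * c + 1 = 0) (hc : 10 ≤ ‖c‖) :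
    escR a ≤ ‖f a c‖ := by
  have h1 := norm_param_le h
  have h2 : ‖a‖ ≤ 2 * ‖c‖ := by nlinarith [norm_nonneg a]
  have h3 : ‖c‖ ^ 2 - 1 ≤ ‖1 - c ^ 2‖ := by
    have := norm_sub_norm_le (c ^ 2) 1
    rw [norm_sub_rev] at this
    simpa using this
  rw [f_crit h, norm_div, norm_mul, Complex.norm_ofNat]
  unfold escR
  have h4 : ‖c‖ * (‖c‖ ^ 2 - 1) ≤ ‖c‖ * ‖1 - c ^ 2‖ := by gcongr
  nlinarith [mul_nonneg (norm_nonneg c) (by nlinarith : (0 : ℝ) ≤ ‖c‖ ^ 2 - 100)]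

theorem green_pos_of_large_crit {a c : ℂ} (h : 3 * c ^ 2 + 2 * a * c + 1 = 0) (hc : 10 ≤ ‖c‖) :
    0 < green a c := by
  have := green_pos_of_escR_le (escR_le_norm_f_crit h hc)
  rw [green_f] at this
  linarith

open ComplexConjugate in
theorem green_conj {a : ℂ} (ha : conj a = a) (z : ℂ) : green a (conj z) = green a z := by
  have key : ∀ n, (f a)^[n] (conj z) = conj ((f a)^[n] z) := by
    intro n
    induction n with
    | zero => rfl
    | succ n ih =>
      rw [Function.iterate_succ_apply', ih, Function.iterate_succ_apply']
      simp [f, ha]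
  unfold green
  simp only [key, Complex.norm_conj]

open ComplexConjugate in
-- On the circle `3|c|² = 1` the other critical point `1 / (3c)` is the conjugate of `c` and the
-- parameter is real. By symmetry both critical points have the same Green value, and one of these
-- values is `0`.
theorem green_eq_zero_of_norm_sq_eq {a c : ℂ} (h : 3 * c ^ 2 + 2 * a * c + 1 = 0)
    (hc : 3 * ‖c‖ ^ 2 = 1) : green a c = 0 := by
  have h0 := crit_ne_zero h
  have hcc : 3 * c * conj c = 1 := by
    rw [mul_assoc, Complex.mul_conj, Complex.normSq_eq_norm_sq]
    exact_mod_cast hc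
  have hother : 1 / (3 * c) = conj c := by
    field_simp; linear_combination -hcc
  have hc0 : conj c ≠ 0 := by simpa using h0
  have ha : conj a = a := by
    have h2 := congrArg conj h
    simp only [map_add, map_mul, map_pow, map_one, map_zero, map_ofNat] at h2
    have e : 2 * (c * conj c) * (conj a - a) = 0 := by
      linear_combination c * h2 - conj c * h + (c - conj c) * hcc
    have : c * conj c ≠ 0 := mul_ne_zero h0 hc0
    rw [mul_eq_zero, or_iff_right (mul_ne_zero two_ne_zero this)] at e
    exact sub_eq_zero.1 e
  by_contra hne
  have hpos := lt_of_le_of_ne (green_nonneg a c) (Ne.symm hne)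
  have := green_other_eq_zero h hpos
  rw [hother, green_conj ha] at this
  exact hne this

theorem differentiableOn_paramOf : DifferentiableOn ℂ paramOf {0}ᶜ := by
  unfold paramOf
  refine DifferentiableOn.div (by fun_prop) (by fun_prop) fun c hc => ?_
  exact mul_ne_zero two_ne_zero hc

/-- Maximum principle in the variable `c`. Suppose `c` escapes for some `c` inside the circle `3|c|²
= 1`. Very small `c` do not escape, because their partner `1 / (3c)` is large and does. So on the
frontier of the set `E` of escaping `c` inside the circle the Green value is `0`. The iterates of
the critical point are holomorphic in `c` and uniformly bounded there, hence bounded on `E`,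
contradicting escape. -/
theorem one_lt_of_green_pos {a c : ℂ} (h : 3 * c ^ 2 + 2 * a * c + 1 = 0)
    (hg : 0 < green a c) : 1 < 3 * ‖c‖ ^ 2 := by
  set E : Set ℂ := {c | (1 / 100 < ‖c‖ ∧ 3 * ‖c‖ ^ 2 < 1) ∧ 0 < green (paramOf c) c} with hE
  have hcontA : ContinuousOn paramOf {0}ᶜ := differentiableOn_paramOf.continuousOn
  have hcontG : ContinuousOn (fun c => green (paramOf c) c) {0}ᶜ :=
    Continuous.comp_continuousOn (g := fun p : ℂ × ℂ => green p.1 p.2)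
      (f := fun c => (paramOf c, c)) continuous_green (hcontA.prodMk continuousOn_id)
  have hEopen : IsOpen E := by
    have h1 : IsOpen {c : ℂ | 1 / 100 < ‖c‖ ∧ 3 * ‖c‖ ^ 2 < 1} :=
      IsOpen.and (isOpen_lt continuous_const continuous_norm)
        (isOpen_lt (f := fun c : ℂ => 3 * ‖c‖ ^ 2) (by fun_prop) continuous_const)
    have hsub : {c : ℂ | 1 / 100 < ‖c‖ ∧ 3 * ‖c‖ ^ 2 < 1} ⊆ {0}ᶜ := fun c hc => by
      rintro rfl
      have := hc.1
      norm_num at this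
    exact (hcontG.mono hsub).isOpen_inter_preimage h1 isOpen_Ioi (t := Set.Ioi 0)
  have hcl : closure E ⊆ {c | 1 / 100 ≤ ‖c‖ ∧ 3 * ‖c‖ ^ 2 ≤ 1} := by
    refine closure_minimal (fun c hc => ⟨hc.1.1.le, hc.1.2.le⟩) ?_
    have h1 : IsClosed {c : ℂ | 1 / 100 ≤ ‖c‖} := isClosed_le continuous_const continuous_norm
    have h2 : IsClosed {c : ℂ | 3 * ‖c‖ ^ 2 ≤ 1} :=
      isClosed_le (f := fun c : ℂ => 3 * ‖c‖ ^ 2) (by fun_prop) continuous_const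
    exact h1.inter h2
  have hcl0 : closure E ⊆ {0}ᶜ := fun c hc => by
    rintro rfl
    have := (hcl hc).1
    simp at this
    linarith
  have hsmall : ∀ {a c : ℂ}, 3 * c ^ 2 + 2 * a * c + 1 = 0 → 0 < green a c → 1 / 100 < ‖c‖ := by
    intro a c h hg
    by_contra! hle
    have hc0 := crit_ne_zero h
    have hcpos : 0 < ‖c‖ := norm_pos_iff.2 hc0
    have h10 : 10 ≤ ‖1 / (3 * c)‖ := by
      rw [norm_div, norm_mul, norm_one, Complex.norm_ofNat, le_div_iff₀ (by positivity)]
      linarith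
    exact (green_pos_of_large_crit (crit_other h) h10).ne' (green_other_eq_zero h hg)
  have hfr : ∀ c ∈ frontier E, green (paramOf c) c = 0 := by
    intro c hc
    have hc1 := hcl (frontier_subset_closure hc)
    have hc0 : c ≠ 0 := hcl0 (frontier_subset_closure hc)
    have hcE : c ∉ E := by
      rw [hEopen.frontier_eq] at hc
      exact hc.2
    by_contra hne
    have hpos := lt_of_le_of_ne (green_nonneg _ c) (Ne.symm hne)
    rcases lt_or_eq_of_le hc1.2 with hlt | heq
    · exact hcE ⟨⟨hsmall (crit_paramOf hc0) hpos, hlt⟩, hpos⟩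
    · exact hne (green_eq_zero_of_norm_sq_eq (crit_paramOf hc0) heq)
  have hbd : Bornology.IsBounded E :=
    (Metric.isBounded_closedBall (x := (0 : ℂ)) (r := 1)).subset fun c hc => by
      rw [mem_closedBall_zero_iff]
      nlinarith [hc.1.2, norm_nonneg c]
  have hempty : E = ∅ := by
    by_contra hne
    obtain ⟨c, hc⟩ := Set.nonempty_iff_ne_empty.2 hne
    -- On the frontier `1/100 ≤ |c|` and `3|c|² ≤ 1` give `|a| ≤ 100`, hence an escape radius at
    -- most `404`; the point is that one constant serves every `n`.
    have hn : ∀ n, ‖(f (paramOf c))^[n] c‖ ≤ 1000 := by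
      intro n
      refine Complex.norm_le_of_forall_mem_frontier_norm_le (f := fun c => (f (paramOf c))^[n] c)
        hbd ?_ (fun d hd => ?_) (subset_closure hc)
      · exact ((differentiableOn_f_iterate differentiableOn_paramOf differentiableOn_id n).mono
          hcl0).diffContOnCl
      · refine (norm_iterate_lt_of_green_eq_zero (hfr d hd) n).le.trans ?_
        have hd1 := hcl (frontier_subset_closure hd)
        have := norm_param_le (crit_paramOf (hcl0 (frontier_subset_closure hd)))
        have hle : ‖paramOf d‖ ≤ 100 := by
          by_contra! hlt
          nlinarith [hd1.1, hd1.2]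
        unfold escR; linarith
    exact hc.2.ne' (green_eq_zero_of_bounded hn)
  by_contra! hle
  rcases lt_or_eq_of_le hle with hlt | heq
  · have : c ∈ E := ⟨⟨hsmall h hg, hlt⟩, by rwa [← eq_paramOf h]⟩
    rw [hempty] at this
    exact this
  · exact hg.ne' (green_eq_zero_of_norm_sq_eq h heq)

/-- For `a` in the slit the critical points are conjugate, possibly equal, with product `1/3`; both
then satisfy `3|c|² = 1`. -/
theorem not_mem_slit_of_crit {a c : ℂ} (h : 3 * c ^ 2 + 2 * a * c + 1 = 0)
    (hc : 1 < 3 * ‖c‖ ^ 2) : a ∉ slit := by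
  rintro ⟨him, hre⟩
  have hsq : a.re ^ 2 ≤ 3 := by
    have := sq_le_sq' (by linarith [abs_le.1 hre, Real.sqrt_nonneg 3, neg_abs_le a.re])
      ((le_abs_self _).trans hre)
    rwa [Real.sq_sqrt (by norm_num)] at this
  have e1 := congrArg Complex.re h
  have e2 := congrArg Complex.im h
  simp [pow_two, him] at e1 e2
  rw [← Complex.normSq_eq_norm_sq, Complex.normSq_apply] at hc
  have e3 : c.im * (3 * c.re + a.re) = 0 := by linarith
  rcases mul_eq_zero.1 e3 with h0 | h0
  · rw [h0] at e1 hc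
    nlinarith [sq_nonneg (3 * c.re ^ 2 - 1), mul_nonneg (sq_nonneg c.re) (sub_nonneg.2 hsq)]
  · have : a.re = -3 * c.re := by linarith
    rw [this] at e1
    nlinarith

theorem crit_cMinus {a : ℂ} (ha : a ≠ 0) : 3 * cMinus a ^ 2 + 2 * a * cMinus a + 1 = 0 := by
  have h := csqrt_sq (1 - 3 / a ^ 2)
  have h2 : a ^ 2 * csqrt (1 - 3 / a ^ 2) ^ 2 = a ^ 2 - 3 := by rw [h]; field_simp
  unfold cMinus
  linear_combination (1 / 3) * h2

/-- The critical points are `-(a/3)(1 ± w)` with `Re w > 0`, so the one with the plus sign is the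
larger, and their product is `1/3`. -/
theorem one_lt_cMinus {a : ℂ} (ha : a ∉ slit) : 1 < 3 * ‖cMinus a‖ ^ 2 := by
  have h0 := ne_zero_of_not_mem_slit ha
  have hw := csqrt_re_pos (slit_aux ha)
  have hw2 := csqrt_sq (1 - 3 / a ^ 2)
  set w := csqrt (1 - 3 / a ^ 2) with hwdef
  have hc : cMinus a = -(a / 3) * (1 + w) := by rw [cMinus, ← hwdef]; ring
  have hprod : (-(a / 3) * (1 + w)) * (-(a / 3) * (1 - w)) = 1 / 3 := by
    have : a ^ 2 * w ^ 2 = a ^ 2 - 3 := by rw [hw2]; field_simp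
    linear_combination (-1 / 9) * this
  have hlt : ‖1 - w‖ < ‖1 + w‖ := by
    rw [← sq_lt_sq₀ (norm_nonneg _) (norm_nonneg _), ← Complex.normSq_eq_norm_sq,
      ← Complex.normSq_eq_norm_sq, Complex.normSq_apply, Complex.normSq_apply]
    simp
    nlinarith
  have hn := congrArg norm hprod
  rw [norm_mul, norm_mul, norm_mul] at hn
  rw [hc, norm_mul]
  have ha3 : 0 < ‖-(a / 3)‖ := by simpa using h0
  have h1 : ‖(1 / 3 : ℂ)‖ = 1 / 3 := by simp
  rw [h1] at hn
  have hp : 0 < ‖1 + w‖ := (norm_nonneg _).trans_lt hlt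
  nlinarith [mul_pos (mul_pos ha3 ha3) (mul_pos hp (sub_pos.2 hlt))]

/-- The facts about critical points for parameters in the escape locus. -/
theorem escape_facts {a : ℂ} (h : 0 < critGreen a) :
    a ∉ slit ∧ 3 * cMinus a ^ 2 + 2 * a * cMinus a + 1 = 0 ∧ green a (cMinus a) = critGreen a := by
  obtain ⟨c, hc, hg⟩ := exists_green_eq_critGreen a
  have h1 := one_lt_of_green_pos hc (by rwa [hg])
  have hs := not_mem_slit_of_crit hc h1
  have hm := crit_cMinus (ne_zero_of_not_mem_slit hs)
  refine ⟨hs, hm, ?_⟩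
  rcases crit_eq_or hc hm with e | e
  · rw [e, hg]
  · exfalso
    have h2 := one_lt_cMinus hs
    rw [e, norm_div, norm_mul, norm_one, Complex.norm_ofNat] at h2
    have hcpos : 0 < ‖c‖ := norm_pos_iff.2 (crit_ne_zero hc)
    field_simp at h2
    nlinarith

/-! ### The cocritical point and a cube root of the parameter map -/

/-- The parameters for which some critical point escapes. -/
def escaping : Set ℂ := {a | 0 < critGreen a}

theorem isOpen_escaping : IsOpen escaping := isOpen_lt continuous_const continuous_critGreen

/-- The cocritical point of `cMinus a`: the second preimage of `vMinus a`. -/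
def coCrit (a : ℂ) : ℂ := -a - 2 * cMinus a

theorem analyticAt_cMinus {a : ℂ} (ha : a ∉ slit) : AnalyticAt ℂ cMinus a := by
  have h0 := ne_zero_of_not_mem_slit ha
  unfold cMinus csqrt
  have h1 : AnalyticAt ℂ (fun a : ℂ => 1 - 3 / a ^ 2) a :=
    analyticAt_const.sub (analyticAt_const.div (analyticAt_id.pow 2) (pow_ne_zero 2 h0))
  have h2 : AnalyticAt ℂ (fun a : ℂ => (1 - 3 / a ^ 2) ^ (1 / 2 : ℂ)) a :=
    h1.cpow analyticAt_const (slit_aux ha)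
  exact (analyticAt_id.neg.sub (analyticAt_id.mul h2)).div_const

theorem analyticAt_vMinus {a : ℂ} (ha : a ∉ slit) : AnalyticAt ℂ vMinus a := by
  have h := analyticAt_cMinus ha
  exact ((h.pow 3).add (analyticAt_id.mul (h.pow 2))).add h

theorem f_sub_vMinus {a : ℂ} (ha : a ∈ escaping) (z : ℂ) :
    f a z - vMinus a = (z - cMinus a) ^ 2 * (z - coCrit a) := by
  have h := (escape_facts ha).2.1
  unfold vMinus coCrit f
  linear_combination (z - cMinus a) * h

theorem f_coCrit {a : ℂ} (ha : a ∈ escaping) : f a (coCrit a) = vMinus a := by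
  have := f_sub_vMinus ha (coCrit a)
  rw [sub_self, mul_zero] at this
  exact sub_eq_zero.1 this

theorem cMinus_ne_coCrit {a : ℂ} (ha : a ∈ escaping) : cMinus a ≠ coCrit a := by
  intro e
  obtain ⟨hs, hc, -⟩ := escape_facts ha
  have h1 := one_lt_cMinus hs
  have h2 : 3 * cMinus a ^ 2 = 1 := by
    unfold coCrit at e
    linear_combination -hc + 2 * cMinus a * e
  have h3 := congrArg norm h2
  rw [norm_mul, norm_pow, Complex.norm_ofNat, norm_one] at h3
  linarith

theorem green_vMinus {a : ℂ} (ha : a ∈ escaping) : green a (vMinus a) = 3 * critGreen a := by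
  rw [vMinus, green_f, (escape_facts ha).2.2]

theorem critGreen_lt_green_vMinus {a : ℂ} (ha : a ∈ escaping) :
    critGreen a < green a (vMinus a) := by
  have : 0 < critGreen a := ha
  rw [green_vMinus ha]; linarith

/-! ### Landing of rays at the critical and cocritical points. -/

/-- The dynamic ray through `ζ` lands at `w`. -/
def Lands (a ζ w : ℂ) : Prop := Tendsto (fun ε : ℝ => psi a (ζ + ε)) (𝓝[>] 0) (𝓝 w)

theorem add_ofReal_re (ζ : ℂ) (ε : ℝ) : (ζ + ε).re = ζ.re + ε := by simp

/-- Along the ray, the point `x` satisfies `(x - c_-)² (x - coCrit) = η` with `η → 0`, so `x` is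
close to one of two separated points. The choice cannot change over the connected set `Q` of nearby
parameters and small `ε`; the landing point is thus locally constant in type, which later makes
`coPhi` analytic. -/
theorem exists_landing_nhds {a₀ : ℂ} (ha₀ : a₀ ∈ escaping) {Z : ℂ → ℂ} (hZ : AnalyticAt ℂ Z a₀)
    (hev : ∀ᶠ a in 𝓝 a₀, critGreen a < (Z a).re ∧ psi a (Z a) = vMinus a) (j : ℕ) :
    (∀ᶠ a in 𝓝 a₀, Lands a (Z a / 3 + turn j) (cMinus a)) ∨
      (∀ᶠ a in 𝓝 a₀, Lands a (Z a / 3 + turn j) (coCrit a)) := by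
  have hs := (escape_facts ha₀).1
  have hc := (analyticAt_cMinus hs).continuousAt
  have hv := (analyticAt_vMinus hs).continuousAt
  have hco : ContinuousAt coCrit a₀ := (continuousAt_id.neg).sub (continuousAt_const.mul hc)
  have hZc := hZ.continuousAt
  set η : ℂ × ℝ → ℂ := fun p => psi p.1 (Z p.1 + 3 * p.2) - vMinus p.1 with hη
  have hself := hev.self_of_nhds
  have hη0 : ContinuousAt η (a₀, 0) := by
    have h1 : ContinuousAt (fun p : ℂ × ℝ => (p.1, Z p.1 + 3 * (p.2 : ℂ))) (a₀, 0) := by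
      refine continuousAt_fst.prodMk ?_
      exact (hZc.comp' continuousAt_fst).add (by fun_prop)
    refine ContinuousAt.sub ?_ (hv.comp' continuousAt_fst)
    refine ContinuousAt.comp' (g := fun p : ℂ × ℂ => psi p.1 p.2) (f := fun p : ℂ × ℝ =>
      (p.1, Z p.1 + 3 * (p.2 : ℂ))) ?_ h1
    refine continuousAt_psi ?_
    simpa using hself.1
  have hηz : η (a₀, 0) = 0 := by simp [hη, hself.2]
  have hsmall : ∀ᶠ p : ℂ × ℝ in 𝓝 (a₀, 0),
      ‖η p‖ < (‖cMinus p.1 - coCrit p.1‖ / 2) ^ 3 := by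
    refine ContinuousAt.eventually_lt hη0.norm ?_ ?_
    · exact ((((hc.comp' continuousAt_fst).sub (hco.comp' continuousAt_fst)).norm).div_const
        2).pow 3
    · rw [hηz, norm_zero]
      have := norm_pos_iff.2 (sub_ne_zero.2 (cMinus_ne_coCrit ha₀))
      positivity
  have hall : ∀ᶠ a in 𝓝 a₀, (critGreen a < (Z a).re ∧ psi a (Z a) = vMinus a) ∧
      a ∈ escaping ∧ a ∉ slit ∧ AnalyticAt ℂ Z a := by
    filter_upwards [hev, isOpen_escaping.mem_nhds ha₀, hZ.eventually_analyticAt] with a h1 h2 h3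
    exact ⟨h1, h2, (escape_facts h2).1, h3⟩
  obtain ⟨r₁, hr₁, H₁⟩ := Metric.eventually_nhds_iff.1 hsmall
  obtain ⟨r₂, hr₂, H₂⟩ := Metric.eventually_nhds_iff.1 hall
  set r := min r₁ r₂ with hr
  have hrpos : 0 < r := lt_min hr₁ hr₂
  set Q : Set (ℂ × ℝ) := Metric.ball a₀ r ×ˢ Set.Ioo 0 r with hQ
  have hQconn : IsPreconnected Q :=
    ((convex_ball a₀ r).isPreconnected).prod isPreconnected_Ioo
  have hB : ∀ a ∈ Metric.ball a₀ r, (critGreen a < (Z a).re ∧ psi a (Z a) = vMinus a) ∧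
      a ∈ escaping ∧ a ∉ slit ∧ AnalyticAt ℂ Z a := fun a ha =>
    H₂ ((Metric.mem_ball.1 ha).trans_le (min_le_right _ _))
  have hre : ∀ a ∈ Metric.ball a₀ r, (Z a / 3).re = critGreen a := fun a ha => by
    have h := hB a ha
    have h1 := green_psi h.1.1
    rw [h.1.2, green_vMinus h.2.1] at h1
    rw [Complex.div_ofNat_re, ← h1]; ring
  have hre' : ∀ p ∈ Q, critGreen p.1 < (Z p.1 / 3 + turn j + (p.2 : ℂ)).re := by
    intro p hp
    rw [add_ofReal_re, add_turn_re, hre p.1 hp.1]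
    linarith [hp.2.1]
  set x : ℂ × ℝ → ℂ := fun p => psi p.1 (Z p.1 / 3 + turn j + p.2) with hx
  have hxη : ∀ p ∈ Q, (x p - cMinus p.1) ^ 2 * (x p - coCrit p.1) = η p := by
    intro p hp
    have h1 : critGreen p.1 < (Z p.1 / 3 + (p.2 : ℂ)).re := by
      rw [add_ofReal_re, hre p.1 hp.1]; linarith [hp.2.1]
    have h2 := f_psi_turn h1 j
    rw [← f_sub_vMinus (hB p.1 hp.1).2.1]
    simp only [hx, hη]
    rw [show Z p.1 / 3 + turn j + (p.2 : ℂ) = Z p.1 / 3 + (p.2 : ℂ) + turn j by ring, h2]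
    congr 2
    ring
  have hηs : ∀ p ∈ Q, ‖η p‖ < (‖cMinus p.1 - coCrit p.1‖ / 2) ^ 3 := by
    intro p hp
    refine H₁ ?_
    rw [Prod.dist_eq]
    refine max_lt ((Metric.mem_ball.1 hp.1).trans_le (min_le_left _ _)) ?_
    rw [Real.dist_eq, sub_zero, abs_of_pos hp.2.1]
    exact hp.2.2.trans_le (min_le_left _ _)
  have hZcont : ContinuousOn (fun p : ℂ × ℝ => Z p.1) Q := fun p hp =>
    ((hB p.1 hp.1).2.2.2.continuousAt.comp' continuousAt_fst).continuousWithinAt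
  have hccont : ContinuousOn (fun p : ℂ × ℝ => cMinus p.1) Q := fun p hp =>
    ((analyticAt_cMinus (hB p.1 hp.1).2.2.1).continuousAt.comp'
      continuousAt_fst).continuousWithinAt
  have hcocont : ContinuousOn (fun p : ℂ × ℝ => coCrit p.1) Q :=
    (continuousOn_fst.neg).sub (continuousOn_const.mul hccont)
  have hxcont : ContinuousOn x Q := by
    have h1 : ContinuousOn (fun p : ℂ × ℝ => (p.1, Z p.1 / 3 + turn j + (p.2 : ℂ))) Q :=
      continuousOn_fst.prodMk (((hZcont.div_const 3).add continuousOn_const).add (by fun_prop))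
    exact ContinuousOn.comp (g := fun p : ℂ × ℂ => psi p.1 p.2) continuousOn_psi h1 hre'
  -- The sign of `D` tells which of the two points is nearer. Where `D = 0` both distances are at
  -- least half the separation, so `‖η‖` would be at least its cube, against the choice of `r`.
  set D : ℂ × ℝ → ℝ := fun p => ‖x p - cMinus p.1‖ - ‖x p - coCrit p.1‖ with hD
  have hDcont : ContinuousOn D Q := (hxcont.sub hccont).norm.sub (hxcont.sub hcocont).norm
  have hDne : ∀ p ∈ Q, D p ≠ 0 := by
    intro p hp h0
    have e := sub_eq_zero.1 h0
    have h1 := congrArg norm (hxη p hp)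
    rw [norm_mul, norm_pow, ← e] at h1
    have h2 : ‖cMinus p.1 - coCrit p.1‖ / 2 ≤ ‖x p - cMinus p.1‖ := by
      have : ‖cMinus p.1 - coCrit p.1‖ ≤ ‖x p - coCrit p.1‖ + ‖x p - cMinus p.1‖ := by
        have := norm_sub_le (x p - coCrit p.1) (x p - cMinus p.1)
        rwa [sub_sub_sub_cancel_left] at this
      linarith
    have h3 := pow_le_pow_left₀ (by positivity) h2 3
    have h4 := hηs p hp
    rw [← h1] at h4
    nlinarith
  have hlim : ∀ a ∈ Metric.ball a₀ r, Tendsto (fun ε : ℝ => ‖η (a, ε)‖) (𝓝[>] 0) (𝓝 0) := by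
    intro a ha
    have h := hB a ha
    have h1 : ContinuousAt (fun ε : ℝ => η (a, ε)) 0 := by
      refine ContinuousAt.sub ?_ continuousAt_const
      refine ContinuousAt.comp' (g := psi a) (f := fun ε : ℝ => Z a + 3 * (ε : ℂ)) ?_ (by fun_prop)
      exact continuousAt_psi_right (by simpa using h.1.1)
    have h2 : η (a, 0) = 0 := by simp [hη, h.1.2]
    have h3 := h1.norm.tendsto.mono_left (nhdsWithin_le_nhds (s := Set.Ioi (0 : ℝ)))
    rwa [h2, norm_zero] at h3
  have hIoo : Set.Ioo 0 r ∈ 𝓝[>] (0 : ℝ) := Ioo_mem_nhdsGT hrpos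
  have hball : Metric.ball a₀ r ∈ 𝓝 a₀ := Metric.ball_mem_nhds a₀ hrpos
  have hland : ∀ (a w : ℂ), a ∈ Metric.ball a₀ r →
      (∀ ε ∈ Set.Ioo 0 r, ‖x (a, ε) - w‖ ^ 3 ≤ ‖η (a, ε)‖) →
      Lands a (Z a / 3 + turn j) w := by
    intro a w ha hle
    rw [Lands, tendsto_iff_norm_sub_tendsto_zero]
    have h3 : Tendsto (fun ε : ℝ => ‖x (a, ε) - w‖ ^ 3) (𝓝[>] 0) (𝓝 0) := by
      refine squeeze_zero' (Eventually.of_forall fun _ => by positivity) ?_ (hlim a ha)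
      filter_upwards [hIoo] with ε hε
      exact hle ε hε
    have h4 := h3.rpow_const (p := 1 / 3) (Or.inr (by norm_num))
    rw [Real.zero_rpow (by norm_num)] at h4
    refine h4.congr fun ε => ?_
    rw [← Real.rpow_natCast, ← Real.rpow_mul (norm_nonneg _)]
    norm_num [hx]
  by_cases hneg : ∃ p ∈ Q, D p < 0
  · left
    obtain ⟨p, hp, hDp⟩ := hneg
    have hallneg : ∀ q ∈ Q, D q < 0 := by
      intro q hq
      by_contra! hge
      obtain ⟨s, hs, hs0⟩ := hQconn.intermediate_value hp hq hDcont ⟨hDp.le, hge⟩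
      exact hDne s hs hs0
    filter_upwards [hball] with a ha
    refine hland a _ ha fun ε hε => ?_
    have h1 := hallneg (a, ε) ⟨ha, hε⟩
    rw [← hxη (a, ε) ⟨ha, hε⟩, norm_mul, norm_pow]
    have : ‖x (a, ε) - cMinus a‖ ≤ ‖x (a, ε) - coCrit a‖ := by
      simp only [hD] at h1; linarith
    nlinarith [sq_nonneg ‖x (a, ε) - cMinus a‖]
  · right
    push Not at hneg
    filter_upwards [hball] with a ha
    refine hland a _ ha fun ε hε => ?_
    have h1 := hneg (a, ε) ⟨ha, hε⟩
    rw [← hxη (a, ε) ⟨ha, hε⟩, norm_mul, norm_pow]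
    have h2 : ‖x (a, ε) - coCrit a‖ ≤ ‖x (a, ε) - cMinus a‖ := by
      simp only [hD] at h1; linarith
    have h3 := pow_le_pow_left₀ (norm_nonneg _) h2 2
    nlinarith [norm_nonneg (x (a, ε) - coCrit a)]

theorem exists_analytic_preimage_vMinus {a₀ : ℂ} (ha₀ : a₀ ∈ escaping) :
    ∃ Z : ℂ → ℂ, AnalyticAt ℂ Z a₀ ∧
      ∀ᶠ a in 𝓝 a₀, critGreen a < (Z a).re ∧ psi a (Z a) = vMinus a := by
  obtain ⟨ζ, hζ, e⟩ := exists_psi_eq (critGreen_lt_green_vMinus ha₀)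
  obtain ⟨Z, hZ, -, hev⟩ := exists_analytic_psi_preimage (α := fun t => t) analyticAt_id
    (analyticAt_vMinus (escape_facts ha₀).1) hζ e
  exact ⟨Z, hZ, hev⟩

theorem re_div_three {a ζ : ℂ} (ha : a ∈ escaping) (hζ : critGreen a < ζ.re)
    (e : psi a ζ = vMinus a) : (ζ / 3).re = critGreen a := by
  have h1 := green_psi hζ
  rw [e, green_vMinus ha] at h1
  rw [Complex.div_ofNat_re, ← h1]; ring

theorem lands_cases {a ζ : ℂ} (ha : a ∈ escaping) (hζ : critGreen a < ζ.re)
    (e : psi a ζ = vMinus a) (j : ℕ) :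
    Lands a (ζ / 3 + turn j) (cMinus a) ∨ Lands a (ζ / 3 + turn j) (coCrit a) := by
  obtain ⟨Z, hZ, hZ0, hev⟩ := exists_analytic_psi_preimage (α := fun t => t) analyticAt_id
    (analyticAt_vMinus (escape_facts ha).1) hζ e
  rcases exists_landing_nhds ha hZ hev j with h | h
  · left; simpa [hZ0] using h.self_of_nhds
  · right; simpa [hZ0] using h.self_of_nhds

/-- Limit of Vieta's relation for the three distinct points on the rays above the critical level. -/
theorem sum_lands {a ζ l₀ l₁ l₂ : ℂ} (hζ : critGreen a ≤ ζ.re) (h0 : Lands a (ζ + turn 0) l₀)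
    (h1 : Lands a (ζ + turn 1) l₁) (h2 : Lands a (ζ + turn 2) l₂) : l₀ + l₁ + l₂ = -a := by
  have h := (Tendsto.add h0 h1).add h2
  refine tendsto_nhds_unique h (Tendsto.congr' ?_ tendsto_const_nhds)
  filter_upwards [self_mem_nhdsWithin] with ε hε
  have hε' : (0 : ℝ) < ε := hε
  have hre : critGreen a < (ζ + (ε : ℂ)).re := by rw [add_ofReal_re]; linarith
  have e : ∀ k, ζ + turn k + (ε : ℂ) = ζ + ε + turn k := fun k => by ring
  rw [e, e, e]
  exact (sum_roots (psi_turn_ne hre (j := 0) (k := 1) (by norm_num) (by norm_num))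
    (psi_turn_ne hre (j := 0) (k := 2) (by norm_num) (by norm_num))
    (psi_turn_ne hre (j := 1) (k := 2) (by norm_num) (by norm_num))
    (f_psi_turn hre 0) (f_psi_turn hre 1) (f_psi_turn hre 2)).symm

/-- Exactly one of the three rays over the critical value lands at the cocritical point. -/
theorem lands_trichotomy {a ζ : ℂ} (ha : a ∈ escaping) (hζ : critGreen a < ζ.re)
    (e : psi a ζ = vMinus a) :
    (Lands a (ζ / 3 + turn 0) (coCrit a) ∧ Lands a (ζ / 3 + turn 1) (cMinus a) ∧
      Lands a (ζ / 3 + turn 2) (cMinus a)) ∨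
    (Lands a (ζ / 3 + turn 0) (cMinus a) ∧ Lands a (ζ / 3 + turn 1) (coCrit a) ∧
      Lands a (ζ / 3 + turn 2) (cMinus a)) ∨
    (Lands a (ζ / 3 + turn 0) (cMinus a) ∧ Lands a (ζ / 3 + turn 1) (cMinus a) ∧
      Lands a (ζ / 3 + turn 2) (coCrit a)) := by
  have hne := cMinus_ne_coCrit ha
  have hre := (re_div_three ha hζ e).ge
  have hco : coCrit a = -a - 2 * cMinus a := rfl
  -- The landing points sum to `-a = 2 c_- + coCrit` and each is `c_-` or `coCrit`. Since these
  -- differ, any other distribution is excluded.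
  rcases lands_cases ha hζ e 0 with h0 | h0 <;> rcases lands_cases ha hζ e 1 with h1 | h1 <;>
    rcases lands_cases ha hζ e 2 with h2 | h2 <;> have hs := sum_lands hre h0 h1 h2
  · exact absurd (by linear_combination hs - hco) hne
  · exact Or.inr (Or.inr ⟨h0, h1, h2⟩)
  · exact Or.inr (Or.inl ⟨h0, h1, h2⟩)
  · exact absurd (by linear_combination -hs + hco) hne
  · exact Or.inl ⟨h0, h1, h2⟩
  · exact absurd (by linear_combination -hs + hco) hne
  · exact absurd (by linear_combination -hs + hco) hne
  · exact absurd (by linear_combination (-1 / 2) * hs + (1 / 2) * hco) hne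

theorem Lands.unique {a ζ w w' : ℂ} (h : Lands a ζ w) (h' : Lands a ζ w') : w = w' :=
  tendsto_nhds_unique h h'

theorem Lands.add_int {a ζ w : ℂ} (hζ : critGreen a ≤ ζ.re) (k : ℤ) (h : Lands a ζ w) :
    Lands a (ζ + k * (2 * Real.pi * Complex.I)) w := by
  refine Tendsto.congr' ?_ h
  filter_upwards [self_mem_nhdsWithin] with ε hε
  have hε' : (0 : ℝ) < ε := hε
  rw [show ζ + k * (2 * Real.pi * Complex.I) + (ε : ℂ) =
    ζ + ε + k * (2 * Real.pi * Complex.I) by ring, psi_add_int_mul]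
  rw [add_ofReal_re]; linarith

theorem critGreen_lt_three_mul_re {a ζ : ℂ} (ha : a ∈ escaping) (hζ : ζ.re = critGreen a) :
    critGreen a < (3 * ζ).re := by
  have : 0 < critGreen a := ha
  simp [hζ]; linarith

theorem Lands.psi_three_mul {a ζ : ℂ} (ha : a ∈ escaping) (hζ : ζ.re = critGreen a)
    (h : Lands a ζ (coCrit a)) : psi a (3 * ζ) = vMinus a := by
  have h3 := critGreen_lt_three_mul_re ha hζ
  have hf : Continuous (f a) := by unfold f; fun_prop
  have h1 : Tendsto (fun ε : ℝ => f a (psi a (ζ + ε))) (𝓝[>] 0) (𝓝 (vMinus a)) := by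
    rw [← f_coCrit ha]
    exact (hf.tendsto _).comp h
  have h2 : Tendsto (fun ε : ℝ => psi a (3 * (ζ + ε))) (𝓝[>] 0) (𝓝 (psi a (3 * ζ))) := by
    have : ContinuousAt (fun ε : ℝ => psi a (3 * (ζ + ε))) 0 := by
      refine ContinuousAt.comp' (g := psi a) (f := fun ε : ℝ => 3 * (ζ + (ε : ℂ))) ?_ (by fun_prop)
      exact continuousAt_psi_right (by simpa using h3)
    have := this.tendsto.mono_left (nhdsWithin_le_nhds (s := Set.Ioi (0 : ℝ)))
    simpa using this
  refine tendsto_nhds_unique h2 (h1.congr' ?_)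
  filter_upwards [self_mem_nhdsWithin] with ε hε
  have hε' : (0 : ℝ) < ε := hε
  exact f_psi (by rw [add_ofReal_re]; linarith)

theorem turn_zero : turn 0 = 0 := by simp [turn]

/-- Two rays landing at the cocritical point both map to rays through `v_-`, so they differ by a
multiple of a third of a turn; by the trichotomy only whole turns are possible. This makes `coPhi`
well defined. -/
theorem exp_eq_of_lands {a ζ ζ' : ℂ} (ha : a ∈ escaping) (hζ : ζ.re = critGreen a)
    (hζ' : ζ'.re = critGreen a) (h : Lands a ζ (coCrit a)) (h' : Lands a ζ' (coCrit a)) :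
    Complex.exp ζ = Complex.exp ζ' := by
  have h3 := critGreen_lt_three_mul_re ha hζ
  have h3' := critGreen_lt_three_mul_re ha hζ'
  have e := h.psi_three_mul ha hζ
  have e' := h'.psi_three_mul ha hζ'
  obtain ⟨k, hk⟩ := (psi_eq_iff h3 h3').1 (e.trans e'.symm)
  have hne := cMinus_ne_coCrit ha
  have h0 : 3 * ζ' / 3 = ζ' := by ring
  have hl := lands_trichotomy ha h3' e'
  rw [h0, turn_zero, add_zero] at hl
  -- Here `ζ - ζ'` is `k / 3` of a turn; `k` is split into its residue modulo `3` and whole turns.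
  have hmod : ∃ (j : ℕ) (q : ℤ), j < 3 ∧ ζ' + turn j = ζ + q * (2 * Real.pi * Complex.I) := by
    refine ⟨(k % 3).toNat, -(k / 3), by omega, ?_⟩
    have h1 : (((k % 3).toNat : ℤ) : ℂ) = ((k - 3 * (k / 3) : ℤ) : ℂ) := by
      congr 1; omega
    have h2 : (((k % 3).toNat : ℕ) : ℂ) = (k : ℂ) - 3 * ((k / 3 : ℤ) : ℂ) := by
      rw [← Int.cast_natCast, h1]; push_cast; ring
    unfold turn
    rw [h2]
    push_cast
    linear_combination (-1 / 3) * hk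
  obtain ⟨j, q, hj, hq⟩ := hmod
  have hj' : Lands a (ζ' + turn j) (coCrit a) := by
    rw [hq]; exact h.add_int hζ.ge q
  have hj0 : j = 0 := by
    rcases hl with ⟨-, h1, h2⟩ | ⟨h1, -, -⟩ | ⟨h1, -, -⟩
    · interval_cases j
      · rfl
      · exact absurd (h1.unique hj') hne
      · exact absurd (h2.unique hj') hne
    · exact absurd (h1.unique h') hne
    · exact absurd (h1.unique h') hne
  rw [hj0, turn_zero, add_zero] at hq
  rw [hq]
  exact (Complex.exp_eq_exp_iff_exists_int.2 ⟨q, rfl⟩).symm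

theorem exists_lands_coCrit {a : ℂ} (ha : a ∈ escaping) :
    ∃ ζ : ℂ, ζ.re = critGreen a ∧ Lands a ζ (coCrit a) := by
  obtain ⟨ζ, hζ, e⟩ := exists_psi_eq (critGreen_lt_green_vMinus ha)
  have hre := re_div_three ha hζ e
  rcases lands_trichotomy ha hζ e with h | h | h
  · exact ⟨_, by rw [add_turn_re, hre], h.1⟩
  · exact ⟨_, by rw [add_turn_re, hre], h.2.1⟩
  · exact ⟨_, by rw [add_turn_re, hre], h.2.2⟩

theorem exp_add_turn_ne (ζ : ℂ) {j k : ℕ} (hjk : j < k) (hk : k < j + 3) :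
    Complex.exp (ζ + turn j) ≠ Complex.exp (ζ + turn k) := by
  intro e
  obtain ⟨m, hm⟩ := Complex.exp_eq_exp_iff_exists_int.1 e
  unfold turn at hm
  have h1 : ((j : ℂ) - k - 3 * m) * (2 * Real.pi * Complex.I) = 0 := by
    linear_combination 3 * hm
  rw [mul_eq_zero, or_iff_left Complex.two_pi_I_ne_zero] at h1
  have h2 : (j : ℤ) - k - 3 * m = 0 := by exact_mod_cast h1
  omega

theorem exists_lands_cMinus {a : ℂ} (ha : a ∈ escaping) :
    ∃ ζ ζ' : ℂ, ζ.re = critGreen a ∧ ζ'.re = critGreen a ∧ Complex.exp ζ ≠ Complex.exp ζ' ∧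
      Lands a ζ (cMinus a) ∧ Lands a ζ' (cMinus a) := by
  obtain ⟨ζ, hζ, e⟩ := exists_psi_eq (critGreen_lt_green_vMinus ha)
  have hre := re_div_three ha hζ e
  have hre' : ∀ k, (ζ / 3 + turn k).re = critGreen a := fun k => by rw [add_turn_re, hre]
  rcases lands_trichotomy ha hζ e with h | h | h
  · exact ⟨_, _, hre' 1, hre' 2, exp_add_turn_ne _ (by norm_num) (by norm_num), h.2.1, h.2.2⟩
  · exact ⟨_, _, hre' 0, hre' 2, exp_add_turn_ne _ (by norm_num) (by norm_num), h.1, h.2.2⟩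
  · exact ⟨_, _, hre' 0, hre' 1, exp_add_turn_ne _ (by norm_num) (by norm_num), h.1, h.2.1⟩

open Classical in
/-- The Böttcher coordinate of the cocritical point, a cube root of the parameter map. -/
def coPhi (a : ℂ) : ℂ :=
  if h : ∃ ζ : ℂ, ζ.re = critGreen a ∧ Lands a ζ (coCrit a) then Complex.exp h.choose else 0

theorem coPhi_eq {a ζ : ℂ} (ha : a ∈ escaping) (hζ : ζ.re = critGreen a)
    (h : Lands a ζ (coCrit a)) : coPhi a = Complex.exp ζ := by
  have hex : ∃ ζ : ℂ, ζ.re = critGreen a ∧ Lands a ζ (coCrit a) := ⟨ζ, hζ, h⟩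
  rw [coPhi, dif_pos hex]
  exact exp_eq_of_lands ha hex.choose_spec.1 hζ hex.choose_spec.2 h

theorem norm_coPhi {a : ℂ} (ha : a ∈ escaping) : ‖coPhi a‖ = Real.exp (critGreen a) := by
  obtain ⟨ζ, hζ, h⟩ := exists_lands_coCrit ha
  rw [coPhi_eq ha hζ h, Complex.norm_exp, hζ]

theorem coPhi_pow_three {a : ℂ} (ha : a ∈ escaping) : coPhi a ^ 3 = Phi a := by
  obtain ⟨ζ, hζ, h⟩ := exists_lands_coCrit ha
  rw [Phi, ← h.psi_three_mul ha hζ, bottcher_psi (critGreen_lt_three_mul_re ha hζ),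
    coPhi_eq ha hζ h, ← Complex.exp_nat_mul]
  norm_num

/-- One index `j` has its ray landing at the cocritical point for all nearby parameters, so `coPhi`
is locally `exp (Z a / 3 + turn j)` with `Z` analytic. -/
theorem analyticAt_coPhi {a₀ : ℂ} (ha₀ : a₀ ∈ escaping) : AnalyticAt ℂ coPhi a₀ := by
  obtain ⟨Z, hZ, hev⟩ := exists_analytic_preimage_vMinus ha₀
  have hne := cMinus_ne_coCrit ha₀
  have key : ∃ j, ∀ᶠ a in 𝓝 a₀, Lands a (Z a / 3 + turn j) (coCrit a) := by
    by_contra! hno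
    have hall : ∀ j, Lands a₀ (Z a₀ / 3 + turn j) (cMinus a₀) := fun j =>
      ((exists_landing_nhds ha₀ hZ hev j).resolve_right (by simpa using hno j)).self_of_nhds
    rcases lands_trichotomy ha₀ hev.self_of_nhds.1 hev.self_of_nhds.2 with h | h | h
    · exact hne ((hall 0).unique h.1)
    · exact hne ((hall 1).unique h.2.1)
    · exact hne ((hall 2).unique h.2.2)
  obtain ⟨j, hj⟩ := key
  have han : AnalyticAt ℂ (fun a => Complex.exp (Z a / 3 + turn j)) a₀ :=
    (hZ.div_const.add analyticAt_const).cexp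
  refine han.congr ?_
  filter_upwards [hj, hev, isOpen_escaping.mem_nhds ha₀] with a h1 h2 h3
  exact (coPhi_eq h3 (by rw [add_turn_re, re_div_three h3 h2.1 h2.2]) h1).symm

/-! ### Connectedness of the Julia set -/

theorem isPreconnected_iInter_of_antitone {X : Type*} [TopologicalSpace X] [T2Space X]
    {C : ℕ → Set X} (hanti : Antitone C) (hcomp : ∀ n, IsCompact (C n))
    (hconn : ∀ n, IsPreconnected (C n)) : IsPreconnected (⋂ n, C n) := by
  rw [isPreconnected_closed_iff]
  intro A B hA hB hsub hIA hIB
  by_contra hne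
  rw [Set.not_nonempty_iff_eq_empty] at hne
  have hI : IsCompact (⋂ n, C n) := 
    (hcomp 0).of_isClosed_subset (isClosed_iInter fun n => (hcomp n).isClosed) (Set.iInter_subset _ 0)
  have hdisj : Disjoint ((⋂ n, C n) ∩ A) ((⋂ n, C n) ∩ B) := by
    rw [Set.disjoint_iff]
    rintro x ⟨⟨h1, h2⟩, -, h3⟩
    exact hne.subset ⟨h1, h2, h3⟩
  obtain ⟨U, V, hU, hV, hAU, hBV, hUV⟩ :=
    SeparatedNhds.of_isCompact_isCompact (hI.inter_right hA) (hI.inter_right hB) hdisj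
  have hex : ∃ n, C n ⊆ U ∪ V := by
    by_contra! hno
    have hcl : ∀ n, IsClosed (C n) := fun n => (hcomp n).isClosed
    obtain ⟨x, hx⟩ := IsCompact.nonempty_iInter_of_sequence_nonempty_isCompact_isClosed
      (fun n => C n \ (U ∪ V))
      (fun n => Set.sdiff_subset_sdiff_left (hanti (Nat.le_succ n)))
      (fun n => Set.sdiff_nonempty.2 (hno n))
      ((hcomp 0).diff (hU.union hV)) (fun n => (hcl n).sdiff (hU.union hV))
    have hx1 : x ∈ ⋂ n, C n := Set.mem_iInter.2 fun n => (Set.mem_iInter.1 hx n).1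
    refine (Set.mem_iInter.1 hx 0).2 ?_
    rcases hsub hx1 with h | h
    · exact Or.inl (hAU ⟨hx1, h⟩)
    · exact Or.inr (hBV ⟨hx1, h⟩)
  obtain ⟨n, hn⟩ := hex
  obtain ⟨x, hx⟩ := hIA
  obtain ⟨y, hy⟩ := hIB
  obtain ⟨z, -, hzU, hzV⟩ := hconn n U V hU hV hn
    ⟨x, Set.mem_iInter.1 hx.1 n, hAU hx⟩ ⟨y, Set.mem_iInter.1 hy.1 n, hBV hy⟩
  exact Set.disjoint_left.1 hUV hzU hzV

theorem filledJulia_eq (a : ℂ) : filledJulia a = {z | green a z = 0} :=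
  Set.ext fun _ => mem_filledJulia_iff

theorem isClosed_filledJulia (a : ℂ) : IsClosed (filledJulia a) := by
  rw [filledJulia_eq]
  exact isClosed_eq (continuous_green_right a) continuous_const

theorem isBounded_green_le (a : ℂ) (M : ℝ) : Bornology.IsBounded {z | green a z ≤ M} := by
  refine isBounded_iff_forall_norm_le.2 ⟨max (escR a) (Real.exp (M + Real.log 2)), fun z hz => ?_⟩
  have hz' : green a z ≤ M := hz
  rcases le_total (escR a) ‖z‖ with h | h
  · have h1 := log_norm_sub_le_green h
    have h0 := (escR_pos a).trans_le h
    refine le_trans ?_ (le_max_right _ _)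
    rw [← Real.log_le_iff_le_exp h0]
    linarith
  · exact h.trans (le_max_left _ _)

theorem isCompact_filledJulia (a : ℂ) : IsCompact (filledJulia a) :=
  Metric.isCompact_of_isClosed_isBounded (isClosed_filledJulia a)
    ((isBounded_green_le a 0).subset fun _ hz => (mem_filledJulia_iff.1 hz).le)

/-- Here `psi a` is defined on the whole right half plane. The Julia set is the decreasing
intersection of the compact closures of the images of the strips `0 < Re ζ < 1 / (n + 1)`, and each
image is connected. -/
theorem isConnected_julia_of_critGreen_eq_zero {a : ℂ} (h : critGreen a = 0) :
    IsConnected (julia a) := by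
  set S : ℕ → Set ℂ := fun n => {z | 0 < green a z ∧ green a z < 1 / ((n : ℝ) + 1)} with hS
  set C : ℕ → Set ℂ := fun n => closure (S n) with hC
  have hg := continuous_green_right a
  have hSimage : ∀ n, S n = psi a '' {ζ | 0 < ζ.re ∧ ζ.re < 1 / ((n : ℝ) + 1)} := by
    intro n
    ext z
    constructor
    · rintro ⟨h1, h2⟩
      obtain ⟨ζ, hζ, rfl⟩ := exists_psi_eq (by rw [h]; exact h1)
      rw [green_psi hζ] at h1 h2
      exact ⟨ζ, ⟨h1, h2⟩, rfl⟩
    · rintro ⟨ζ, ⟨h1, h2⟩, rfl⟩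
      have := green_psi (show critGreen a < ζ.re by rw [h]; exact h1)
      exact ⟨by rw [this]; exact h1, by rw [this]; exact h2⟩
  have hSconn : ∀ n, IsPreconnected (S n) := by
    intro n
    rw [hSimage]
    refine IsPreconnected.image ?_ _ fun ζ hζ =>
      (continuousAt_psi_right (by rw [h]; exact hζ.1)).continuousWithinAt
    exact ((convex_halfSpace_re_gt 0).inter (convex_halfSpace_re_lt _)).isPreconnected
  have hanti : Antitone C := by
    intro n m hnm
    refine closure_mono fun z hz => ⟨hz.1, hz.2.trans_le ?_⟩
    exact one_div_le_one_div_of_le (by positivity) (by exact_mod_cast Nat.succ_le_succ hnm)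
  have hle : ∀ n, C n ⊆ {z | green a z ≤ 1 / ((n : ℝ) + 1)} := fun n =>
    closure_minimal (fun z hz => le_of_lt hz.2) (isClosed_le hg continuous_const)
  have hcomp : ∀ n, IsCompact (C n) := fun n =>
    Metric.isCompact_of_isClosed_isBounded isClosed_closure ((isBounded_green_le a _).subset (hle n))
  have hne : ∀ n, (C n).Nonempty := by
    intro n
    refine Set.Nonempty.closure ?_
    rw [hSimage]
    refine Set.Nonempty.image _ ⟨((1 / ((n : ℝ) + 1) / 2 : ℝ) : ℂ), ?_, ?_⟩
    · rw [Complex.ofReal_re]; positivity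
    · rw [Complex.ofReal_re]; exact half_lt_self (by positivity)
  have heq : julia a = ⋂ n, C n := by
    ext z
    rw [julia, frontier_eq_closure_inter_closure, (isClosed_filledJulia a).closure_eq,
      Set.mem_iInter]
    constructor
    · rintro ⟨hz, hz'⟩ n
      rw [mem_closure_iff] at hz' ⊢
      intro U hU hzU
      have hz0 := mem_filledJulia_iff.1 hz
      obtain ⟨w, ⟨hwU, hw⟩, hwK⟩ := hz' (U ∩ {z | green a z < 1 / ((n : ℝ) + 1)})
        (hU.inter (isOpen_lt hg continuous_const))
        ⟨hzU, show green a z < _ by rw [hz0]; positivity⟩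
      refine ⟨w, hwU, ?_, hw⟩
      exact lt_of_le_of_ne (green_nonneg a w) fun e => hwK (mem_filledJulia_iff.2 e.symm)
    · intro hz
      constructor
      · refine mem_filledJulia_iff.2 (le_antisymm ?_ (green_nonneg a z))
        exact ge_of_tendsto' tendsto_one_div_add_atTop_nhds_zero_nat fun n => hle n (hz n)
      · refine closure_mono (fun w hw => ?_) (hz 0)
        exact fun hK => hw.1.ne' (mem_filledJulia_iff.1 hK)
  rw [heq]
  exact ⟨IsCompact.nonempty_iInter_of_sequence_nonempty_isCompact_isClosed C
    (fun n => hanti (Nat.le_succ n)) hne (hcomp 0) fun n => isClosed_closure,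
    isPreconnected_iInter_of_antitone hanti hcomp fun n => (hSconn n).closure⟩

/-! ### Disconnectedness of the Julia set for escaping parameters. -/

theorem isPreconnected_of_frontier {K : Set ℂ} (hK : IsCompact K)
    (h : IsPreconnected (frontier K)) : IsPreconnected K := by
  -- A nonempty compact piece of a separation has a frontier point, since the plane is connected and
  -- not compact. Near that point the other piece is absent, so it is a frontier point of `K`
  -- itself.
  have key : ∀ A B : Set ℂ, IsClosed A → IsClosed B → K ⊆ A ∪ B → (K ∩ A).Nonempty →
      K ∩ (A ∩ B) = ∅ → (frontier K ∩ A).Nonempty := by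
    intro A B hA hB hsub hne hempty
    have hKA : IsCompact (K ∩ A) := hK.inter_right hA
    have hfr : (frontier (K ∩ A)).Nonempty := by
      rw [nonempty_frontier_iff]
      refine ⟨hne, fun hu => ?_⟩
      exact noncompact_univ ℂ (hu ▸ hKA)
    obtain ⟨z, hz⟩ := hfr
    have hzKA : z ∈ K ∩ A := hKA.isClosed.frontier_subset hz
    refine ⟨z, ?_, hzKA.2⟩
    rw [hK.isClosed.frontier_eq]
    refine ⟨hzKA.1, fun hint => ?_⟩
    rw [hKA.isClosed.frontier_eq] at hz
    refine hz.2 (mem_interior_iff_mem_nhds.2 ?_)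
    have hzB : z ∉ B := fun hzB => hempty.subset ⟨hzKA.1, hzKA.2, hzB⟩
    filter_upwards [mem_interior_iff_mem_nhds.1 hint, hB.isOpen_compl.mem_nhds hzB] with w h1 h2
    exact ⟨h1, (hsub h1).resolve_right h2⟩
  rw [isPreconnected_closed_iff] at h ⊢
  intro A B hA hB hsub hneA hneB
  by_contra hne
  rw [Set.not_nonempty_iff_eq_empty] at hne
  have h1 := key A B hA hB hsub hneA hne
  have h2 := key B A hB hA (by rwa [Set.union_comm]) hneB (by rwa [Set.inter_comm B A])
  obtain ⟨z, hz, hz'⟩ := h A B hA hB (hK.isClosed.frontier_subset.trans hsub) h1 h2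
  exact hne.subset ⟨hK.isClosed.frontier_subset hz, hz'⟩

/-- Two points of a connected compact set cannot be separated by winding around them in a closed
set at positive distance. -/
theorem exists_continuous_log_ratio {K S : Set ℂ} (hK : IsCompact K) (hKc : IsPreconnected K)
    (hS : IsClosed S) (hd : Disjoint K S) {b₀ b : ℂ} (hb₀ : b₀ ∈ K) (hb : b ∈ K) :
    ∃ l : ℂ → ℂ, ContinuousOn l S ∧ ∀ z ∈ S, Complex.exp (l z) = (z - b) / (z - b₀) := by
  obtain ⟨r, hr, hdist⟩ := Metric.exists_pos_forall_lt_edist hK hS hd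
  have hdist' : ∀ b ∈ K, ∀ z ∈ S, (r : ℝ) < ‖z - b‖ := by
    intro b hb z hz
    have := hdist b hb z hz
    rw [edist_nndist, ENNReal.coe_lt_coe] at this
    have h2 : (r : ℝ) < dist b z := by exact_mod_cast this
    rwa [dist_comm, dist_eq_norm] at h2
  have hne : ∀ b ∈ K, ∀ z ∈ S, z - b ≠ 0 := fun b hb z hz =>
    norm_pos_iff.1 (lt_of_le_of_lt (NNReal.coe_nonneg r) (hdist' b hb z hz))
  set P : K → Prop := fun b => ∃ l : ℂ → ℂ, ContinuousOn l S ∧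
    ∀ z ∈ S, Complex.exp (l z) = (z - b) / (z - b₀) with hP
  -- Moving `b` by less than the distance `r` to `S` multiplies the ratio by a factor within `1` of
  -- `1`, which has a principal logarithm. Hence `P` is open and closed in `K`.
  have step : ∀ b b' : K, dist b' b < r → P b → P b' := by
    rintro b b' hbb ⟨l, hl, he⟩
    have hmem : ∀ z ∈ S, (z - b') / (z - b) ∈ Complex.slitPlane := by
      intro z hz
      have h0 := hne b b.2 z hz
      have e : (z - (b' : ℂ)) / (z - b) = 1 + (b - b') / (z - b) := by field_simp; ring
      rw [e]
      refine Complex.mem_slitPlane_of_norm_lt_one ?_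
      rw [norm_div, div_lt_one (norm_pos_iff.2 h0), ← dist_eq_norm, dist_comm]
      exact (show dist (b' : ℂ) b < r from hbb).trans (hdist' b b.2 z hz)
    refine ⟨fun z => l z + Complex.log ((z - b') / (z - b)), hl.add (ContinuousOn.clog ?_ hmem),
      fun z hz => ?_⟩
    · exact ContinuousOn.div (by fun_prop) (by fun_prop) fun z hz => hne b b.2 z hz
    · have h0 := hne b b.2 z hz
      have h1 := hne b' b'.2 z hz
      have h2 := hne b₀ hb₀ z hz
      rw [Complex.exp_add, he z hz, Complex.exp_log (div_ne_zero h1 h0)]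
      field_simp
  have hr' : (0 : ℝ) < r := hr
  have hopen : IsOpen {b | P b} := Metric.isOpen_iff.2 fun b hb =>
    ⟨r, hr', fun b' hb' => step b b' hb' hb⟩
  have hopen' : IsOpen {b | P b}ᶜ := Metric.isOpen_iff.2 fun b hb =>
    ⟨r, hr', fun b' hb' hPb' => hb (step b' b (by rw [dist_comm]; exact hb') hPb')⟩
  have : PreconnectedSpace K := Subtype.preconnectedSpace hKc
  have huniv := IsClopen.eq_univ ⟨isOpen_compl_iff.1 hopen', hopen⟩
    ⟨⟨b₀, hb₀⟩, fun _ => 0, continuousOn_const, fun z hz => by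
      rw [Complex.exp_zero, div_self (hne b₀ hb₀ z hz)]⟩
  have : (⟨b, hb⟩ : K) ∈ {b | P b} := by rw [huniv]; trivial
  exact this

theorem constant_of_pow_eq_one {S : Set ℂ} (hS : IsPreconnected S) {k : ℂ → ℂ} {n : ℕ}
    (hn : 0 < n) (hk : ContinuousOn k S) (h : ∀ z ∈ S, k z ^ n = 1) {x y : ℂ} (hx : x ∈ S)
    (hy : y ∈ S) : k x = k y := by
  have hfin : {w : ℂ | w ^ n = 1}.Finite := by
    refine ((Polynomial.nthRoots n (1 : ℂ)).toFinset.finite_toSet).subset fun w hw => ?_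
    rw [Finset.mem_coe, Multiset.mem_toFinset, Polynomial.mem_nthRoots hn]
    exact hw

  exact hS.constant_of_mapsTo (T := {w : ℂ | w ^ n = 1}) hfin.isDiscrete hk h hx hy

/-- If the Julia set were connected, so would be the filled one, which contains all zeros of `f a`.
Then `f a z / z ^ 3` has a continuous logarithm on `{green ≥ critGreen}`, so each iterate has a
continuous `3 ^ N`-th root there, including at `c_-`. Such a root remembers the external angle and
would take two different values along the two rays landing at `c_-`. -/
theorem not_isPreconnected_julia {a : ℂ} (ha : a ∈ escaping) : ¬IsPreconnected (julia a) := by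
  intro hJ
  have hM : 0 < critGreen a := ha
  have hKc := isPreconnected_of_frontier (isCompact_filledJulia a) hJ
  set S : Set ℂ := {z | critGreen a ≤ green a z} with hSdef
  have hS : IsClosed S := isClosed_le continuous_const (continuous_green_right a)
  have hdisj : Disjoint (filledJulia a) S := by
    rw [Set.disjoint_left]
    intro z hz hzS
    have h1 : critGreen a ≤ green a z := hzS
    rw [mem_filledJulia_iff.1 hz] at h1
    linarith
  have h0K : (0 : ℂ) ∈ filledJulia a := mem_filledJulia_iff.2 (green_zero a)
  have hSf : ∀ z ∈ S, f a z ∈ S := fun z hz => by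
    have h1 : critGreen a ≤ green a z := hz
    change critGreen a ≤ green a (f a z)
    rw [green_f]; linarith
  have hS0 : ∀ z ∈ S, z ≠ 0 := by
    rintro z hz rfl
    exact Set.disjoint_left.1 hdisj h0K hz
  set s := csqrt (a ^ 2 - 4) with hs
  have hs2 : s ^ 2 = a ^ 2 - 4 := csqrt_sq _
  have hfac : ∀ z, f a z = z * ((z - (-a + s) / 2) * (z - (-a - s) / 2)) := fun z => by
    unfold f; linear_combination (z / 4) * hs2
  have hroot : ∀ b, f a b = 0 → b ∈ filledJulia a := by
    intro b hb
    have := green_f a b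
    rw [hb, green_zero] at this
    exact mem_filledJulia_iff.2 (by linarith)
  obtain ⟨l₁, hl₁, he₁⟩ := exists_continuous_log_ratio (isCompact_filledJulia a) hKc hS hdisj h0K
    (hroot ((-a + s) / 2) (by rw [hfac]; ring))
  obtain ⟨l₂, hl₂, he₂⟩ := exists_continuous_log_ratio (isCompact_filledJulia a) hKc hS hdisj h0K
    (hroot ((-a - s) / 2) (by rw [hfac]; ring))
  have hstep : ∀ z ∈ S, f a z = z ^ 3 * Complex.exp (l₁ z + l₂ z) := by
    intro z hz
    have := hS0 z hz
    rw [Complex.exp_add, he₁ z hz, he₂ z hz, hfac, sub_zero]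
    field_simp
  have hfc : Continuous (f a) := by unfold f; fun_prop
  have hSn : ∀ n : ℕ, ∀ z ∈ S, (f a)^[n] z ∈ S := by
    intro n z hz
    induction n with
    | zero => exact hz
    | succ n ih => rw [Function.iterate_succ_apply']; exact hSf _ ih
  have hlog : ∀ n : ℕ, ∃ L : ℂ → ℂ, ContinuousOn L S ∧
      ∀ z ∈ S, (f a)^[n] z = z ^ 3 ^ n * Complex.exp (L z) := by
    intro n
    induction n with
    | zero => exact ⟨fun _ => 0, continuousOn_const, fun z _ => by simp⟩
    | succ n ih =>
      obtain ⟨L, hL, he⟩ := ih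
      refine ⟨fun z => 3 * L z + (l₁ ((f a)^[n] z) + l₂ ((f a)^[n] z)), ?_, fun z hz => ?_⟩
      · have hc : ContinuousOn (f a)^[n] S := (hfc.iterate n).continuousOn
        exact (continuousOn_const.mul hL).add ((hl₁.comp hc (hSn n)).add (hl₂.comp hc (hSn n)))
      · rw [Function.iterate_succ_apply', hstep _ (hSn n z hz), Complex.exp_add (3 * L z), he z hz,
          mul_pow, ← pow_mul, ← pow_succ, ← Complex.exp_nat_mul, mul_assoc]
        norm_num
  obtain ⟨ζ, ζ', hζ, hζ', hne, hland, hland'⟩ := exists_lands_cMinus ha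
  obtain ⟨N, hN, hN'⟩ := ((exists_farBound_lt (a := a) (ζ := ζ) (by rw [hζ]; exact hM)).and
    (exists_farBound_lt (a := a) (ζ := ζ') (by rw [hζ']; exact hM))).exists
  have hre3 : ∀ z : ℂ, ((3 : ℂ) ^ N * z).re = 3 ^ N * z.re := fun z => by
    have : ((3 : ℂ) ^ N) = ((3 ^ N : ℝ) : ℂ) := by push_cast; rfl
    rw [this, Complex.re_ofReal_mul]
  have hfar : ∀ z : ℂ, critGreen a ≤ z.re → farBound a < ((3 : ℂ) ^ N * z).re := by
    intro z hz
    rw [hre3] at hN ⊢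
    rw [hζ] at hN
    have : (3 : ℝ) ^ N * critGreen a ≤ 3 ^ N * z.re := by gcongr
    linarith
  obtain ⟨L, hL, he⟩ := hlog N
  -- The continuous `3 ^ N`-th root of the `N`-th iterate on `S`.
  set q : ℂ → ℂ := fun z => z * Complex.exp (L z / 3 ^ N) with hq
  have hqc : ContinuousOn q S := continuousOn_id.mul (hL.div_const _).cexp
  have hq3 : ∀ z ∈ S, q z ^ 3 ^ N = (f a)^[N] z := by
    intro z hz
    rw [he z hz]
    simp only [hq]
    rw [mul_pow, ← Complex.exp_nat_mul]
    congr 2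
    push_cast
    field_simp
  -- The same root read in the variable `t = log φ`. Since `3 ^ N * t` is already in the far region,
  -- `e` is continuous up to the line `Re t = critGreen a`, and `q (psi a t) / e t` is a root of
  -- unity, hence constant.
  set e : ℂ → ℂ := fun t => Complex.exp (logBInv a (3 ^ N * t) / 3 ^ N) with hedef
  have he3 : ∀ t, e t ^ 3 ^ N = Complex.exp (logBInv a (3 ^ N * t)) := by
    intro t
    simp only [hedef]
    rw [← Complex.exp_nat_mul]
    congr 1
    push_cast
    field_simp
  have hec : ∀ t : ℂ, critGreen a ≤ t.re → ContinuousAt e t := by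
    intro t ht
    have h1 : logR a + 2 < ((3 : ℂ) ^ N * t).re := (le_max_right _ _).trans_lt (hfar t ht)
    have h2 : ContinuousAt (logBInv a) (3 ^ N * t) := ((differentiableOn_logBInv a).differentiableAt
      ((isOpen_lt continuous_const Complex.continuous_re).mem_nhds h1)).continuousAt
    exact ((ContinuousAt.comp' (f := fun t : ℂ => (3 : ℂ) ^ N * t) h2
      (by fun_prop)).div_const _).cexp
  have he0 : ∀ t, e t ≠ 0 := fun t => Complex.exp_ne_zero _
  have hpsiS : ∀ t : ℂ, critGreen a < t.re → psi a t ∈ S := fun t ht => by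
    change critGreen a ≤ green a (psi a t)
    rw [green_psi ht]; exact ht.le
  set k : ℂ → ℂ := fun t => q (psi a t) / e t with hk
  have hkc : ContinuousOn k {t | critGreen a < t.re} := by
    refine ContinuousOn.div ?_ (fun t ht => (hec t (le_of_lt ht)).continuousWithinAt)
      fun t _ => he0 t
    exact hqc.comp (fun t ht => (continuousAt_psi_right ht).continuousWithinAt)
      fun t ht => hpsiS t ht
  have hk1 : ∀ t ∈ {t : ℂ | critGreen a < t.re}, k t ^ 3 ^ N = 1 := by
    intro t ht
    have ht' : critGreen a < t.re := ht
    have h1 := hfar t ht'.le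
    simp only [hk]
    rw [div_pow, hq3 _ (hpsiS t ht), he3, f_iterate_psi ht',
      psi_eq_psiInf ((le_max_left _ _).trans_lt h1) ((le_max_right _ _).trans_lt h1), psiInf,
      div_self (Complex.exp_ne_zero _)]
  set t₀ : ℂ := ((critGreen a + 1 : ℝ) : ℂ)
  have ht₀ : t₀ ∈ {t : ℂ | critGreen a < t.re} := by
    change critGreen a < t₀.re
    rw [Complex.ofReal_re]; linarith
  have hkconst : ∀ t : ℂ, critGreen a < t.re → q (psi a t) = k t₀ * e t := by
    intro t ht
    rw [← constant_of_pow_eq_one (isPreconnected_half _) (by positivity) hkc hk1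
      (show t ∈ {t : ℂ | critGreen a < t.re} from ht) ht₀]
    simp only [hk]
    rw [div_mul_cancel₀ _ (he0 t)]
  have hcS : cMinus a ∈ S := (escape_facts ha).2.2.ge
  have hlim : ∀ ζ : ℂ, ζ.re = critGreen a → Lands a ζ (cMinus a) →
      q (cMinus a) = k t₀ * e ζ := by
    intro ζ hζ hland
    have hpos : ∀ᶠ ε : ℝ in 𝓝[>] 0, critGreen a < (ζ + (ε : ℂ)).re := by
      filter_upwards [self_mem_nhdsWithin] with ε hε
      have hε' : (0 : ℝ) < ε := hε
      rw [add_ofReal_re, hζ]; linarith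
    have h1 : Tendsto (fun ε : ℝ => q (psi a (ζ + ε))) (𝓝[>] 0) (𝓝 (q (cMinus a))) := by
      refine (hqc (cMinus a) hcS).tendsto.comp
        (tendsto_nhdsWithin_iff.2 ⟨hland, ?_⟩)
      filter_upwards [hpos] with ε hε
      exact hpsiS _ hε
    have h2 : Tendsto (fun ε : ℝ => k t₀ * e (ζ + ε)) (𝓝[>] 0) (𝓝 (k t₀ * e ζ)) := by
      have hc : ContinuousAt (fun ε : ℝ => e (ζ + ε)) 0 := by
        refine ContinuousAt.comp' (g := e) (f := fun ε : ℝ => ζ + (ε : ℂ)) ?_ (by fun_prop)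
        exact hec _ (by simp [hζ])
      have := (hc.tendsto.mono_left (nhdsWithin_le_nhds (s := Set.Ioi (0 : ℝ)))).const_mul (k t₀)
      simpa using this
    refine tendsto_nhds_unique h1 (h2.congr' ?_)
    filter_upwards [hpos] with ε hε
    exact (hkconst _ hε).symm
  have hk0 : k t₀ ≠ 0 := by
    intro h0
    have := hk1 t₀ ht₀
    rw [h0, zero_pow (by positivity)] at this
    exact zero_ne_one this
  have hee : e ζ = e ζ' :=
    mul_left_cancel₀ hk0 ((hlim ζ hζ hland).symm.trans (hlim ζ' hζ' hland'))
  obtain ⟨m, hm⟩ := Complex.exp_eq_exp_iff_exists_int.1 hee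
  have hR := (le_max_right _ _).trans_lt hN
  have hR' := (le_max_right _ _).trans_lt hN'
  have h3 : (3 : ℂ) ^ N ≠ 0 := pow_ne_zero _ three_ne_zero
  have hm' : logBInv a (3 ^ N * ζ) = logBInv a (3 ^ N * ζ') +
      ((3 ^ N * m : ℤ) : ℂ) * (2 * Real.pi * Complex.I) := by
    push_cast
    field_simp at hm
    linear_combination hm
  have hB := congrArg (logB a) hm'
  rw [logB_add_int_mul, logB_logBInv hR.le, logB_logBInv hR'.le] at hB
  refine hne (Complex.exp_eq_exp_iff_exists_int.2 ⟨m, mul_left_cancel₀ h3 ?_⟩)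
  rw [hB]
  push_cast
  ring

theorem escapeLocus_eq : escapeLocus = escaping := by
  ext a
  constructor
  · intro h
    refine lt_of_le_of_ne (critGreen_nonneg a) fun e => h ?_
    exact isConnected_julia_of_critGreen_eq_zero e.symm
  · exact fun h hc => not_isPreconnected_julia h hc.isPreconnected

/-! ### Behaviour of the parameter map at infinity -/

theorem norm_le_three_mul_norm_cMinus (a : ℂ) : ‖a‖ ≤ 3 * ‖cMinus a‖ := by
  have h := csqrt_re_nonneg (1 - 3 / a ^ 2)
  have e : 3 * cMinus a = -a * (1 + csqrt (1 - 3 / a ^ 2)) := by unfold cMinus; ring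
  have h1 : 1 ≤ ‖1 + csqrt (1 - 3 / a ^ 2)‖ := by
    refine le_trans ?_ (Complex.re_le_norm _)
    simpa using h
  have e2 := congrArg norm e
  rw [norm_mul, norm_mul, norm_neg, Complex.norm_ofNat] at e2
  rw [e2]
  exact le_mul_of_one_le_right (norm_nonneg a) h1

theorem le_norm_vMinus {a : ℂ} (ha : 300 ≤ ‖a‖) : 100 * (1 + ‖a‖) ≤ ‖vMinus a‖ := by
  have h0 : a ≠ 0 := by rintro rfl; norm_num at ha
  have h := crit_cMinus h0
  have h2 := norm_le_three_mul_norm_cMinus a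
  have h3 : ‖cMinus a‖ ^ 2 - 1 ≤ ‖1 - cMinus a ^ 2‖ := by
    have := norm_sub_norm_le (cMinus a ^ 2) 1
    rw [norm_sub_rev] at this
    simpa using this
  rw [vMinus, f_crit h, norm_div, norm_mul, Complex.norm_ofNat]
  have h4 : ‖cMinus a‖ * (‖cMinus a‖ ^ 2 - 1) ≤ ‖cMinus a‖ * ‖1 - cMinus a ^ 2‖ := by gcongr
  nlinarith [mul_nonneg (norm_nonneg (cMinus a)) (by nlinarith : (0 : ℝ) ≤ ‖cMinus a‖ ^ 2 - 10000)]

theorem log_le_three_mul_critGreen {a : ℂ} (ha : 300 ≤ ‖a‖) :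
    Real.log ‖vMinus a‖ - Real.log 2 ≤ 3 * critGreen a := by
  have h0 : a ≠ 0 := by rintro rfl; norm_num at ha
  have h1 : escR a ≤ ‖vMinus a‖ := by
    have := le_norm_vMinus ha
    unfold escR
    linarith
  have h2 := log_norm_sub_le_green h1
  have h3 := green_le_critGreen (crit_cMinus h0)
  rw [vMinus, green_f] at h2
  rw [vMinus]
  linarith

theorem tendsto_critGreen : Tendsto critGreen (Bornology.cobounded ℂ) atTop := by
  have h : Tendsto (fun a : ℂ => (Real.log ‖a‖ - Real.log 2) / 3) (Bornology.cobounded ℂ) atTop :=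
    (tendsto_atTop_add_const_right _ _
      (Real.tendsto_log_atTop.comp tendsto_norm_cobounded_atTop)).atTop_div_const (by norm_num)
  refine tendsto_atTop_mono' _ ?_ h
  filter_upwards [tendsto_norm_cobounded_atTop.eventually (eventually_ge_atTop 300)] with a ha
  have h1 := log_le_three_mul_critGreen ha
  have h2 := le_norm_vMinus ha
  have h3 : Real.log ‖a‖ ≤ Real.log ‖vMinus a‖ := Real.log_le_log (by linarith) (by linarith)
  linarith

theorem eventually_mem_escaping : ∀ᶠ a in Bornology.cobounded ℂ, a ∈ escaping :=
  tendsto_critGreen.eventually (eventually_gt_atTop 0)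

theorem tendsto_coPhi : Tendsto coPhi (Bornology.cobounded ℂ) (Bornology.cobounded ℂ) := by
  rw [← tendsto_norm_atTop_iff_cobounded]
  refine (Real.tendsto_exp_atTop.comp tendsto_critGreen).congr' ?_
  filter_upwards [eventually_mem_escaping] with a ha
  exact (norm_coPhi ha).symm

theorem Phi_eq_of_large {a : ℂ} (ha : 300 ≤ ‖a‖) :
    Phi a = vMinus a * Complex.exp (hinf a (vMinus a)) := by
  have h2 := le_norm_vMinus ha
  have hv : 0 < ‖vMinus a‖ := by linarith
  have h1 := log_le_three_mul_critGreen ha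
  have hlog : logR a + 2 < Real.log ‖vMinus a‖ - Real.log 2 := by
    have he := Real.exp_one_lt_d9
    have h5 : Real.exp (logR a + 2 + Real.log 2) < ‖vMinus a‖ := by
      rw [Real.exp_add, Real.exp_add, Real.exp_log (by norm_num), logR, Real.exp_log (escR_pos a),
        show (2 : ℝ) = 1 + 1 by norm_num, Real.exp_add]
      have h6 : Real.exp 1 * Real.exp 1 ≤ 2.72 * 2.72 := by gcongr <;> linarith
      have h7 := escR_pos a
      calc escR a * (Real.exp 1 * Real.exp 1) * (1 + 1) ≤ escR a * (2.72 * 2.72) * (1 + 1) := by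
            gcongr
        _ < ‖vMinus a‖ := by unfold escR; nlinarith
    have := (Real.lt_log_iff_exp_lt hv).2 h5
    linarith
  have hpos := logR_pos a
  have hesc : a ∈ escaping := by
    change 0 < critGreen a
    linarith
  have hmem : vMinus a ∈ bottcherDomain a :=
    mem_bottcherDomain_iff.2 (critGreen_lt_green_vMinus hesc)
  rw [Phi, (isBottcher_bottcher a).eq_bott hmem]
  refine bott_eq_of_large ?_ (max_lt (critGreen_lt_green_vMinus hesc) ?_)
  · have he := Real.exp_one_lt_d9
    calc Real.exp 1 * escR a ≤ 3 * escR a := by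
          gcongr
          · exact (escR_pos a).le
          · linarith
      _ ≤ ‖vMinus a‖ := by unfold escR; linarith
  · rw [green_vMinus hesc]; linarith

theorem tendsto_cMinus_div : Tendsto (fun a => cMinus a / a) (Bornology.cobounded ℂ)
    (𝓝 (-2 / 3)) := by
  have h1 : Tendsto (fun a : ℂ => 1 - 3 / a ^ 2) (Bornology.cobounded ℂ) (𝓝 1) := by
    have h : Tendsto (fun a : ℂ => a⁻¹) (Bornology.cobounded ℂ) (𝓝 0) := tendsto_inv₀_cobounded
    have := ((h.pow 2).const_mul 3).const_sub 1
    simpa [div_eq_mul_inv] using this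
  have h2 : Tendsto csqrt (𝓝 1) (𝓝 (csqrt 1)) :=
    continuousAt_cpow_const (Or.inl (by simp))
  have h3 : csqrt 1 = 1 := by simp [csqrt]
  rw [h3] at h2
  have h4 := ((h2.comp h1).const_sub (-1)).div_const 3
  norm_num at h4
  norm_num
  refine h4.congr' ?_
  filter_upwards [(Bornology.eventually_ne_cobounded (0 : ℂ))] with a ha
  simp only [cMinus]
  field_simp

/-- With `v_- = c_- (1 - c_-²) / 2` and `c_- ~ -2a/3`, the limit is `(8/27) / 2`. -/
theorem tendsto_vMinus_div : Tendsto (fun a => vMinus a / a ^ 3) (Bornology.cobounded ℂ)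
    (𝓝 (4 / 27)) := by
  have h : Tendsto (fun a : ℂ => a⁻¹) (Bornology.cobounded ℂ) (𝓝 0) := tendsto_inv₀_cobounded
  have h1 := ((tendsto_cMinus_div.mul ((h.pow 2).sub (tendsto_cMinus_div.pow 2))).div_const 2)
  norm_num at h1
  refine h1.congr' ?_
  filter_upwards [(Bornology.eventually_ne_cobounded (0 : ℂ))] with a ha
  rw [vMinus, f_crit (crit_cMinus ha)]
  field_simp

theorem tendsto_hinf_vMinus :
    Tendsto (fun a => hinf a (vMinus a)) (Bornology.cobounded ℂ) (𝓝 0) := by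
  have h : Tendsto (fun a : ℂ => a⁻¹) (Bornology.cobounded ℂ) (𝓝 0) := tendsto_inv₀_cobounded
  have hc : (4 / 27 : ℂ) ≠ 0 := by norm_num
  have h1 : Tendsto (fun a : ℂ => 3 / 4 * ((‖a⁻¹‖ ^ 3 + ‖a⁻¹‖ ^ 2) / ‖vMinus a / a ^ 3‖))
      (Bornology.cobounded ℂ) (𝓝 (3 / 4 * ((‖(0 : ℂ)‖ ^ 3 + ‖(0 : ℂ)‖ ^ 2) / ‖(4 / 27 : ℂ)‖))) :=
    ((((h.norm.pow 3).add (h.norm.pow 2)).div tendsto_vMinus_div.norm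
      (norm_ne_zero_iff.2 hc))).const_mul _
  simp only [norm_zero, ne_eq, OfNat.ofNat_ne_zero, not_false_eq_true, zero_pow, add_zero, zero_div,
    mul_zero] at h1
  refine squeeze_zero_norm' ?_ h1
  filter_upwards [tendsto_norm_cobounded_atTop.eventually (eventually_ge_atTop 300)] with a ha
  have h2 := le_norm_vMinus ha
  refine (norm_hinf_le_div (by unfold escR; linarith)).trans (le_of_eq ?_)
  have : ‖a‖ ≠ 0 := by linarith
  rw [norm_div, norm_pow, norm_inv]
  field_simp

theorem tendsto_Phi_div : Tendsto (fun a => Phi a / a ^ 3) (Bornology.cobounded ℂ)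
    (𝓝 (4 / 27)) := by
  have h := tendsto_vMinus_div.mul ((Complex.continuous_exp.tendsto 0).comp tendsto_hinf_vMinus)
  rw [Complex.exp_zero, mul_one] at h
  refine h.congr' ?_
  filter_upwards [tendsto_norm_cobounded_atTop.eventually (eventually_ge_atTop 300)] with a ha
  rw [Phi_eq_of_large ha]
  simp only [Function.comp]
  ring

theorem eventually_injOn_of_deriv_ne_zero {g : ℂ → ℂ} {z₀ : ℂ} (hg : AnalyticAt ℂ g z₀)
    (hd : deriv g z₀ ≠ 0) : ∃ s ∈ 𝓝 z₀, Set.InjOn g s :=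
  ⟨_, hg.hasStrictDerivAt.eventually_left_inverse hd, fun x hx y hy hxy => by
    have h1 : _ = x := hx
    have h2 : _ = y := hy
    rw [← h1, ← h2, hxy]⟩

/-- In the coordinate `s = 1 / a`, the function `1 / coPhi` extends analytically to `s = 0`, by
removability. The cube of its derivative there is the inverse of `lim Phi a / a³ = 4/27`, so it is
locally injective. -/
theorem exists_injOn_coPhi :
    ∃ R : ℝ, ∀ a b : ℂ, R < ‖a‖ → R < ‖b‖ → coPhi a = coPhi b → a = b := by
  set u : ℂ → ℂ := Function.update (fun s => (coPhi s⁻¹)⁻¹) 0 0 with hu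
  have hus : ∀ s, s ≠ 0 → u s = (coPhi s⁻¹)⁻¹ := fun s hs => by simp [hu, hs]
  have hu0 : u 0 = 0 := by simp [hu]
  have hinv : Tendsto (fun s : ℂ => s⁻¹) (𝓝[≠] 0) (Bornology.cobounded ℂ) :=
    tendsto_inv₀_nhdsNE_zero
  have hcont : ContinuousAt u 0 := by
    rw [hu, continuousAt_update_same]
    exact tendsto_inv₀_cobounded.comp (tendsto_coPhi.comp hinv)
  have hdiff : ∀ᶠ s in 𝓝[≠] (0 : ℂ), DifferentiableAt ℂ u s := by
    filter_upwards [hinv.eventually eventually_mem_escaping, self_mem_nhdsWithin] with s hs hs0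
    have hs0 : s ≠ 0 := hs0
    have hne : coPhi s⁻¹ ≠ 0 := by
      rw [← norm_ne_zero_iff, norm_coPhi hs]
      exact (Real.exp_pos _).ne'
    have h1 : DifferentiableAt ℂ (fun s : ℂ => (coPhi s⁻¹)⁻¹) s :=
      (DifferentiableAt.comp (g := coPhi) s (analyticAt_coPhi hs).differentiableAt
        (differentiableAt_inv hs0)).inv hne
    refine h1.congr_of_eventuallyEq ?_
    filter_upwards [isOpen_ne.mem_nhds hs0] with t ht using hus t ht
  have han := Complex.analyticAt_of_differentiable_on_punctured_nhds_of_continuousAt hdiff hcont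
  have hd : deriv u 0 ^ 3 = 27 / 4 := by
    have h1 := (hasDerivAt_iff_tendsto_slope.1 han.differentiableAt.hasDerivAt).pow 3
    have h2 : Tendsto (fun s : ℂ => (Phi s⁻¹ / s⁻¹ ^ 3)⁻¹) (𝓝[≠] 0) (𝓝 (4 / 27)⁻¹) :=
      (tendsto_Phi_div.comp hinv).inv₀ (by norm_num)
    have h3 : (27 / 4 : ℂ) = (4 / 27)⁻¹ := by norm_num
    rw [h3]
    refine tendsto_nhds_unique h1 (h2.congr' ?_)
    filter_upwards [hinv.eventually eventually_mem_escaping, self_mem_nhdsWithin] with s hs hs0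
    have hs0 : s ≠ 0 := hs0
    rw [← coPhi_pow_three hs, slope_def_field, hus s hs0, hu0]
    simp only [sub_zero, div_eq_mul_inv, mul_inv, mul_pow, inv_pow, inv_inv]
  have hd0 : deriv u 0 ≠ 0 := by
    intro h
    rw [h] at hd
    norm_num at hd
  obtain ⟨s, hs, hinj⟩ := eventually_injOn_of_deriv_ne_zero han hd0
  obtain ⟨ε, hε, hball⟩ := Metric.mem_nhds_iff.1 hs
  refine ⟨ε⁻¹, fun a b ha hb hab => ?_⟩
  have key : ∀ c : ℂ, ε⁻¹ < ‖c‖ → c⁻¹ ∈ s ∧ c⁻¹ ≠ 0 := by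
    intro c hc
    have hc0 : 0 < ‖c‖ := (inv_pos.2 hε).trans hc
    refine ⟨hball ?_, inv_ne_zero (norm_pos_iff.1 hc0)⟩
    rw [mem_ball_zero_iff, norm_inv]
    exact inv_lt_of_inv_lt₀ hε hc
  have h := hinj (key a ha).1 (key b hb).1 (by
    rw [hus _ (key a ha).2, hus _ (key b hb).2, inv_inv, inv_inv, hab])
  exact inv_injective h

/-! ### Local behaviour of analytic functions -/

theorem exists_norm_lt_of_mem_nhds {w : ℂ} (hw : w ≠ 0) {s : Set ℂ} (hs : s ∈ 𝓝 w) :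
    ∃ z ∈ s, ‖w‖ < ‖z‖ := by
  have h1 : Tendsto (fun t : ℝ => (1 + (t : ℂ)) * w) (𝓝[>] 0) (𝓝 w) := by
    have : Tendsto (fun t : ℝ => (1 + (t : ℂ)) * w) (𝓝 0) (𝓝 ((1 + ((0 : ℝ) : ℂ)) * w)) :=
      Continuous.tendsto (by fun_prop) 0
    simp only [Complex.ofReal_zero, add_zero, one_mul] at this
    exact this.mono_left nhdsWithin_le_nhds
  obtain ⟨t, ht, ht0⟩ := ((h1.eventually hs).and self_mem_nhdsWithin).exists
  have ht0 : 0 < t := ht0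
  refine ⟨_, ht, ?_⟩
  rw [norm_mul, show (1 + (t : ℂ)) = ((1 + t : ℝ) : ℂ) by push_cast; rfl, Complex.norm_real,
    Real.norm_of_nonneg (by linarith)]
  have := norm_pos_iff.2 hw
  nlinarith

/-- At a critical point of order `n ≥ 2`, `g - g z₀` is the `n`-th power of a local coordinate `(z -
z₀) p z`. The coordinate values `t q` and `t ω q`, with `q ^ n = g z₀` and `ω` a primitive `n`-th
root of unity, both give `(1 + t ^ n) g z₀`, which has larger modulus than `g z₀`. -/
theorem exists_ne_eq_of_deriv_eq_zero {g : ℂ → ℂ} {z₀ : ℂ} (hg : AnalyticAt ℂ g z₀)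
    (hnc : ¬∀ᶠ z in 𝓝 z₀, g z = g z₀) (hd : deriv g z₀ = 0) (hw : g z₀ ≠ 0) {U : Set ℂ}
    (hU : U ∈ 𝓝 z₀) : ∃ a ∈ U, ∃ b ∈ U, a ≠ b ∧ g a = g b ∧ ‖g z₀‖ < ‖g a‖ := by
  have hg1 : AnalyticAt ℂ (fun z => g z - g z₀) z₀ := hg.sub analyticAt_const
  obtain ⟨n, k, hk, hk0, hgk⟩ := hg1.exists_eventuallyEq_pow_smul_nonzero_iff.2 (by
    simpa only [sub_eq_zero] using hnc)
  have hn0 : n ≠ 0 := by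
    rintro rfl
    have := hgk.self_of_nhds
    simp only [sub_self, pow_zero, one_smul] at this
    exact hk0 this.symm
  have hn1 : n ≠ 1 := by
    rintro rfl
    have h1 : HasDerivAt (fun z => (z - z₀) ^ 1 • k z) (k z₀) z₀ := by
      simp only [pow_one, smul_eq_mul]
      refine (((hasDerivAt_id z₀).sub_const z₀).mul hk.differentiableAt.hasDerivAt).congr_deriv ?_
      simp
    have h2 : HasDerivAt (fun z => g z - g z₀) (deriv g z₀) z₀ :=
      hg.differentiableAt.hasDerivAt.sub_const _
    exact hk0 ((h1.congr_of_eventuallyEq hgk).unique h2 |>.trans hd)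
  obtain ⟨r, hr⟩ := IsAlgClosed.exists_pow_nat_eq (k z₀) (Nat.pos_of_ne_zero hn0)
  obtain ⟨q, hq⟩ := IsAlgClosed.exists_pow_nat_eq (g z₀) (Nat.pos_of_ne_zero hn0)
  have hr0 : r ≠ 0 := by rintro rfl; rw [zero_pow hn0] at hr; exact hk0 hr.symm
  have hq0 : q ≠ 0 := by rintro rfl; rw [zero_pow hn0] at hq; exact hw hq.symm
  set p : ℂ → ℂ := fun z => r * (k z / k z₀) ^ ((n : ℂ)⁻¹) with hp
  have hpn : ∀ z, p z ^ n = k z := fun z => by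
    simp only [hp]
    rw [mul_pow, Complex.cpow_nat_inv_pow _ hn0, hr]
    field_simp
  have hpd : DifferentiableAt ℂ p z₀ := by
    refine (DifferentiableAt.cpow_const (hk.differentiableAt.div_const _) ?_).const_mul r
    rw [div_self hk0]
    exact Or.inl (by simp)
  have hpan : AnalyticAt ℂ p z₀ := by
    refine analyticAt_const.mul ((hk.div_const).cpow analyticAt_const ?_)
    rw [div_self hk0]
    exact Or.inl (by simp)
  have hp0 : p z₀ = r := by simp [hp, div_self hk0]
  have hhan : AnalyticAt ℂ (fun z => (z - z₀) * p z) z₀ :=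
    (analyticAt_id.sub analyticAt_const).mul hpan
  have hhd : deriv (fun z => (z - z₀) * p z) z₀ = r := by
    refine (((hasDerivAt_id z₀).sub_const z₀).mul hpd.hasDerivAt).deriv.trans ?_
    simp [hp0]
  have hmap := hhan.hasStrictDerivAt.map_nhds_eq (by rw [hhd]; exact hr0)
  simp only [sub_self, zero_mul] at hmap
  have hV : (fun z => (z - z₀) * p z) '' (U ∩ {z | g z - g z₀ = (z - z₀) ^ n • k z}) ∈ 𝓝 (0 : ℂ) := by
    rw [← hmap]
    exact image_mem_map (inter_mem hU hgk)
  have hζ := Complex.isPrimitiveRoot_exp n hn0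
  set ω := Complex.exp (2 * Real.pi * Complex.I / n)
  have hlim : ∀ c : ℂ, Tendsto (fun t : ℝ => (t : ℂ) * c) (𝓝[>] 0) (𝓝 0) := fun c => by
    have : Tendsto (fun t : ℝ => (t : ℂ) * c) (𝓝 0) (𝓝 (((0 : ℝ) : ℂ) * c)) :=
      Continuous.tendsto (by fun_prop) 0
    simp only [Complex.ofReal_zero, zero_mul] at this
    exact this.mono_left nhdsWithin_le_nhds
  obtain ⟨t, ⟨⟨a, ⟨haU, ha⟩, hat⟩, ⟨b, ⟨hbU, hb⟩, hbt⟩⟩, ht0⟩ :=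
    ((((hlim q).eventually hV).and ((hlim (ω * q)).eventually hV)).and self_mem_nhdsWithin).exists
  have ht0 : 0 < t := ht0
  have hval : ∀ z c : ℂ, g z - g z₀ = (z - z₀) ^ n • k z → (z - z₀) * p z = (t : ℂ) * c →
      c ^ n = g z₀ → g z = (1 + (t : ℂ) ^ n) * g z₀ := by
    intro z c h1 h2 h3
    rw [← hpn, smul_eq_mul, ← mul_pow, h2, mul_pow, h3] at h1
    linear_combination h1
  have hga := hval a q ha hat hq
  have hgb := hval b (ω * q) hb hbt (by rw [mul_pow, hζ.pow_eq_one, one_mul, hq])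
  refine ⟨a, haU, b, hbU, ?_, hga.trans hgb.symm, ?_⟩
  · rintro rfl
    have h1 : (t : ℂ) * q = t * (ω * q) := hat.symm.trans hbt
    have h2 := mul_left_cancel₀ (Complex.ofReal_ne_zero.2 ht0.ne') h1
    have h3 : ω = 1 := mul_right_cancel₀ hq0 (by rw [← h2, one_mul])
    rw [h3] at hζ
    exact hn1 (hζ.unique IsPrimitiveRoot.one)
  · rw [hga, norm_mul, show (1 + (t : ℂ) ^ n) = ((1 + t ^ n : ℝ) : ℂ) by push_cast; rfl,
      Complex.norm_real, Real.norm_of_nonneg (by positivity)]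
    have := norm_pos_iff.2 hw
    have : 0 < t ^ n := by positivity
    nlinarith

/-! ### The cube root of the parameter map is a homeomorphism -/

theorem coPhi_ne_zero {a : ℂ} (ha : a ∈ escaping) : coPhi a ≠ 0 := by
  rw [← norm_ne_zero_iff, norm_coPhi ha]
  exact (Real.exp_pos _).ne'

theorem continuousAt_coPhi {a : ℂ} (ha : a ∈ escaping) : ContinuousAt coPhi a :=
  (analyticAt_coPhi ha).continuousAt

theorem one_lt_norm_coPhi {a : ℂ} (ha : a ∈ escaping) : 1 < ‖coPhi a‖ := by
  rw [norm_coPhi ha]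
  exact Real.one_lt_exp_iff.2 ha

theorem critGreen_eq_log {a : ℂ} (ha : a ∈ escaping) : critGreen a = Real.log ‖coPhi a‖ := by
  rw [norm_coPhi ha, Real.log_exp]

theorem isCompact_critGreen_Icc (m M : ℝ) : IsCompact {a | m ≤ critGreen a ∧ critGreen a ≤ M} := by
  refine Metric.isCompact_of_isClosed_isBounded
    ((isClosed_le continuous_const continuous_critGreen).inter
      (isClosed_le continuous_critGreen continuous_const)) ?_
  have h := tendsto_critGreen.eventually (eventually_gt_atTop M)
  rw [← Bornology.isCobounded_compl_iff]
  refine mem_of_superset h fun a ha hmem => ?_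
  exact absurd hmem.2 (not_le.2 ha)

theorem zero_notMem_escaping : (0 : ℂ) ∉ escaping := fun h =>
  (escape_facts h).1 ⟨rfl, by simp⟩

/-- The set where `coPhi` is locally equal to this constant would be clopen in `ℂ`: `critGreen` is
constant on it, so limits stay in the escape locus, and isolated zeros exclude them otherwise. It
would then contain `0`, which does not escape. -/
theorem not_eventually_coPhi_eq {a : ℂ} (ha : a ∈ escaping) : ¬∀ᶠ b in 𝓝 a, coPhi b = coPhi a := by
  intro h
  set S : Set ℂ := {b | b ∈ escaping ∧ ∀ᶠ x in 𝓝 b, coPhi x = coPhi a} with hS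
  have hopen : IsOpen S := by
    rw [isOpen_iff_mem_nhds]
    rintro b ⟨hb, hb2⟩
    filter_upwards [isOpen_escaping.mem_nhds hb, hb2.eventually_nhds] with x hx hx2
    exact ⟨hx, hx2⟩
  have hcl : IsClosed S := by
    refine isClosed_of_closure_subset fun b hb => ?_
    have hG : critGreen b = critGreen a := by
      refine closure_minimal (t := {x | critGreen x = critGreen a}) ?_
        (isClosed_eq continuous_critGreen continuous_const) hb
      rintro x ⟨hx, hx2⟩
      change critGreen x = critGreen a
      rw [critGreen_eq_log hx, critGreen_eq_log ha, hx2.self_of_nhds]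
    have hbe : b ∈ escaping := by
      change 0 < critGreen b
      rw [hG]
      exact ha
    refine ⟨hbe, ?_⟩
    have han : AnalyticAt ℂ (fun x => coPhi x - coPhi a) b :=
      (analyticAt_coPhi hbe).sub analyticAt_const
    rcases han.eventually_eq_zero_or_eventually_ne_zero with h0 | h0
    · exact h0.mono fun x hx => sub_eq_zero.1 hx
    · exfalso
      rw [eventually_nhdsWithin_iff] at h0
      obtain ⟨x, hx, hxS⟩ := mem_closure_iff_nhds.1 hb _ (h0.eventually_nhds)
      obtain ⟨y, ⟨hy1, hy2⟩, hyb⟩ : ∃ y, (coPhi y = coPhi a ∧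
          (y ∈ ({b}ᶜ : Set ℂ) → coPhi y - coPhi a ≠ 0)) ∧ y ≠ b := by
        have h1 : ∀ᶠ y in 𝓝 x, coPhi y = coPhi a ∧
          (y ∈ ({b}ᶜ : Set ℂ) → coPhi y - coPhi a ≠ 0) := hxS.2.and hx
        by_cases hxb : x = b
        · subst hxb
          exact ((h1.filter_mono nhdsWithin_le_nhds).and
            (self_mem_nhdsWithin : {x}ᶜ ∈ 𝓝[≠] x)).exists
        · exact ⟨x, h1.self_of_nhds, hxb⟩
      exact hy2 hyb (sub_eq_zero.2 hy1)
  have huniv : S = Set.univ := IsClopen.eq_univ ⟨hcl, hopen⟩ ⟨a, ha, h⟩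
  exact zero_notMem_escaping (huniv.symm.subset (Set.mem_univ (0 : ℂ))).1

theorem nhds_le_map_coPhi {a : ℂ} (ha : a ∈ escaping) : 𝓝 (coPhi a) ≤ map coPhi (𝓝 a) :=
  (analyticAt_coPhi ha).eventually_constant_or_nhds_le_map_nhds.resolve_left
    (not_eventually_coPhi_eq ha)

theorem isOpen_image_coPhi {s : Set ℂ} (hs : IsOpen s) (hse : s ⊆ escaping) :
    IsOpen (coPhi '' s) := by
  rw [isOpen_iff_mem_nhds]
  rintro _ ⟨a, ha, rfl⟩
  exact nhds_le_map_coPhi (hse ha) (image_mem_map (hs.mem_nhds ha))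

theorem isPreconnected_one_lt_norm : IsPreconnected {w : ℂ | 1 < ‖w‖} := by
  have h : {w : ℂ | 1 < ‖w‖} = Complex.exp '' {ζ | 0 < ζ.re} := by
    ext w
    constructor
    · intro hw
      have hw : 1 < ‖w‖ := hw
      have hw0 : w ≠ 0 := norm_pos_iff.1 (by linarith)
      exact ⟨Complex.log w, show 0 < (Complex.log w).re by
        rw [Complex.log_re]; exact Real.log_pos hw, Complex.exp_log hw0⟩
    · rintro ⟨ζ, hζ, rfl⟩
      change 1 < ‖Complex.exp ζ‖
      rw [Complex.norm_exp]
      exact Real.one_lt_exp_iff.2 hζ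
  rw [h]
  exact (isPreconnected_half 0).image _ Complex.continuous_exp.continuousOn

theorem escaping_nonempty : escaping.Nonempty := eventually_mem_escaping.exists

/-- The image is open. It is relatively closed because points with values in a closed annulus lie in
the compact set where `critGreen` is between two positive levels. The exterior of the disc is
connected. -/
theorem image_coPhi : coPhi '' escaping = {w | 1 < ‖w‖} := by
  refine Set.Subset.antisymm ?_ ?_
  · rintro _ ⟨a, ha, rfl⟩
    exact one_lt_norm_coPhi ha
  refine isPreconnected_one_lt_norm.subset_of_closure_inter_subset
    (isOpen_image_coPhi isOpen_escaping subset_rfl) ?_ ?_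
  · obtain ⟨a, ha⟩ := escaping_nonempty
    exact ⟨coPhi a, one_lt_norm_coPhi ha, a, ha, rfl⟩
  rintro w ⟨hw, hw1⟩
  have hw1 : 1 < ‖w‖ := hw1
  obtain ⟨r, hr1, hrw⟩ := exists_between hw1
  set K := {a | Real.log r ≤ critGreen a ∧ critGreen a ≤ Real.log (‖w‖ + 1)} with hK
  have hKe : K ⊆ escaping := fun a ha => (Real.log_pos hr1).trans_le ha.1
  have hKc : IsCompact (coPhi '' K) := (isCompact_critGreen_Icc _ _).image_of_continuousOn
    fun a ha => (continuousAt_coPhi (hKe ha)).continuousWithinAt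
  have hmem : w ∈ closure (coPhi '' K) := by
    rw [mem_closure_iff_nhds]
    intro t ht
    have hn : {z : ℂ | r < ‖z‖ ∧ ‖z‖ < ‖w‖ + 1} ∈ 𝓝 w :=
      ((isOpen_lt continuous_const continuous_norm).inter
        (isOpen_lt continuous_norm continuous_const)).mem_nhds ⟨hrw, by simp⟩
    obtain ⟨z, ⟨hzt, hz1, hz2⟩, a, ha, rfl⟩ := mem_closure_iff_nhds.1 hw _ (inter_mem ht hn)
    refine ⟨_, hzt, a, ⟨?_, ?_⟩, rfl⟩
    · rw [critGreen_eq_log ha]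
      exact Real.log_le_log (by linarith) hz1.le
    · rw [critGreen_eq_log ha]
      exact Real.log_le_log (by linarith) hz2.le
  rw [hKc.isClosed.closure_eq] at hmem
  exact Set.image_mono hKe hmem

/-- Collisions at or above the level of a given one lie in a compact set, because `coPhi` is
injective near infinity. In the closure of these collisions a pair of largest level exists, and the
local behaviour of `coPhi` there always produces a collision of larger modulus or contradicts being
a limit of collisions. -/
theorem injOn_coPhi : Set.InjOn coPhi escaping := by
  intro a₀ ha₀ b₀ hb₀ hab₀
  by_contra hne₀
  obtain ⟨R, hR⟩ := exists_injOn_coPhi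
  obtain ⟨M, hM⟩ : ∃ M, ∀ a, ‖a‖ ≤ R → critGreen a ≤ M := by
    obtain ⟨M, hM⟩ := ((ProperSpace.isCompact_closedBall (0 : ℂ) R).image
      continuous_critGreen).bddAbove
    exact ⟨M, fun a ha => hM ⟨a, by simpa using ha, rfl⟩⟩
  have hm : 0 < critGreen a₀ := ha₀
  have hcrit : ∀ a ∈ escaping, ∀ b ∈ escaping, coPhi a = coPhi b → critGreen a = critGreen b :=
    fun a ha b hb h => by rw [critGreen_eq_log ha, critGreen_eq_log hb, h]
  set B : Set (ℂ × ℂ) := {p | p.1 ∈ escaping ∧ p.2 ∈ escaping ∧ p.1 ≠ p.2 ∧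
    coPhi p.1 = coPhi p.2 ∧ critGreen a₀ ≤ critGreen p.1} with hB
  set K := {a | critGreen a₀ ≤ critGreen a ∧ critGreen a ≤ M} with hK
  have hKc : IsCompact K := isCompact_critGreen_Icc _ _
  have hKe : K ⊆ escaping := fun a ha => hm.trans_le ha.1
  have hBK : B ⊆ K ×ˢ K := by
    rintro ⟨a, b⟩ ⟨ha, hb, hne, hab, hge⟩
    have hc := hcrit a ha b hb hab
    have hle : critGreen a ≤ M := by
      by_contra hgt
      refine hne (hR a b ?_ ?_ hab)
      · exact not_le.1 fun h => hgt (hM a h)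
      · exact not_le.1 fun h => hgt (hc.trans_le (hM b h))
    exact ⟨⟨hge, hle⟩, ⟨hge.trans_eq hc, hc.symm.trans_le hle⟩⟩
  have hclK : closure B ⊆ K ×ˢ K := closure_minimal hBK (hKc.prod hKc).isClosed
  have hclc : IsCompact (closure B) := (hKc.prod hKc).of_isClosed_subset isClosed_closure hclK
  obtain ⟨⟨a, b⟩, hab, hmax⟩ := hclc.exists_isMaxOn
    ⟨(a₀, b₀), subset_closure ⟨ha₀, hb₀, hne₀, hab₀, le_rfl⟩⟩
    (continuous_critGreen.comp continuous_fst).continuousOn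
  have haK := (hclK hab).1
  have ha : a ∈ escaping := hKe haK
  have hb : b ∈ escaping := hKe (hclK hab).2
  have heq : coPhi a = coPhi b := by
    have h1 : Tendsto (fun p : ℂ × ℂ => coPhi p.1) (𝓝 (a, b)) (𝓝 (coPhi a)) :=
      Tendsto.comp (g := coPhi) (continuousAt_coPhi ha) (continuous_fst.tendsto (a, b))
    have h2 : Tendsto (fun p : ℂ × ℂ => coPhi p.2) (𝓝 (a, b)) (𝓝 (coPhi b)) :=
      Tendsto.comp (g := coPhi) (continuousAt_coPhi hb) (continuous_snd.tendsto (a, b))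
    have : (𝓝[B] (a, b)).NeBot := mem_closure_iff_nhdsWithin_neBot.1 hab
    refine tendsto_nhds_unique (l := 𝓝[B] (a, b)) ((h1.mono_left nhdsWithin_le_nhds).congr' ?_)
      (h2.mono_left nhdsWithin_le_nhds)
    filter_upwards [self_mem_nhdsWithin] with p hp using hp.2.2.2.1
  have hno : ∀ a' ∈ escaping, ∀ b' ∈ escaping, a' ≠ b' → coPhi a' = coPhi b' →
      ¬‖coPhi a‖ < ‖coPhi a'‖ := by
    intro a' ha' b' hb' hne h hlt
    have hlt' : critGreen a < critGreen a' := by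
      rw [critGreen_eq_log ha, critGreen_eq_log ha']
      exact Real.log_lt_log (norm_pos_iff.2 (coPhi_ne_zero ha)) hlt
    have := hmax (subset_closure (show (a', b') ∈ B from
      ⟨ha', hb', hne, h, haK.1.trans hlt'.le⟩))
    exact absurd hlt' (not_lt.2 this)
  -- If the extremal pair lies on the diagonal, either the derivative vanishes and new collisions
  -- appear further out, or `coPhi` is injective nearby and no collisions accumulate. Off the
  -- diagonal, openness at both points gives a common value of larger modulus.
  by_cases hne : a = b
  · subst hne
    by_cases hd : deriv coPhi a = 0
    · obtain ⟨x, hx, y, hy, hxy, h1, h2⟩ := exists_ne_eq_of_deriv_eq_zero (analyticAt_coPhi ha)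
        (not_eventually_coPhi_eq ha) hd (coPhi_ne_zero ha) (isOpen_escaping.mem_nhds ha)
      exact hno x hx y hy hxy h1 h2
    · obtain ⟨s, hs, hinj⟩ := eventually_injOn_of_deriv_ne_zero (analyticAt_coPhi ha) hd
      obtain ⟨⟨x, y⟩, ⟨hx, hy⟩, hxy⟩ := mem_closure_iff_nhds.1 hab _ (prod_mem_nhds hs hs)
      exact hxy.2.2.1 (hinj hx hy hxy.2.2.2.1)
  · obtain ⟨U, V, hU, hV, haU, hbV, hUV⟩ := t2_separation hne
    have h1 := nhds_le_map_coPhi ha (image_mem_map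
      ((hU.inter isOpen_escaping).mem_nhds ⟨haU, ha⟩))
    have h2 := nhds_le_map_coPhi hb (image_mem_map
      ((hV.inter isOpen_escaping).mem_nhds ⟨hbV, hb⟩))
    rw [← heq] at h2
    obtain ⟨w, ⟨⟨x, hx, rfl⟩, ⟨y, hy, hxy⟩⟩, hlt⟩ :=
      exists_norm_lt_of_mem_nhds (coPhi_ne_zero ha) (inter_mem h1 h2)
    refine hno x hx.2 y hy.2 ?_ hxy.symm hlt
    rintro rfl
    exact Set.disjoint_left.1 hUV hx.1 hy.1

/-- The cube root of the parameter map, as a homeomorphism from the escape locus onto the exterior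
of the closed unit disc. -/
def coPhiHomeo : OpenPartialHomeomorph ℂ ℂ :=
  OpenPartialHomeomorph.ofContinuousOpenRestrict injOn_coPhi.toPartialEquiv
    (fun _ ha => (continuousAt_coPhi ha).continuousWithinAt)
    (fun s hs => by
      have : escaping.domRestrict coPhi '' s = coPhi '' (Subtype.val '' s) := by
        rw [Set.image_image]; rfl
      change IsOpen (escaping.domRestrict coPhi '' s)
      rw [this]
      refine isOpen_image_coPhi (isOpen_escaping.isOpenMap_subtype_val s hs) ?_
      rintro _ ⟨x, -, rfl⟩
      exact x.2)
    isOpen_escaping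

theorem coPhiHomeo_source : coPhiHomeo.source = escaping := rfl

theorem coPhiHomeo_target : coPhiHomeo.target = {w | 1 < ‖w‖} := image_coPhi

theorem isConnected_escaping : IsConnected escaping := by
  refine ⟨escaping_nonempty, ?_⟩
  have h := isPreconnected_one_lt_norm
  rw [← coPhiHomeo_target] at h
  have h2 := h.image _ coPhiHomeo.continuousOn_symm
  rwa [coPhiHomeo.symm_image_target_eq_source, coPhiHomeo_source] at h2

theorem tendsto_coPhiHomeo_symm :
    Tendsto coPhiHomeo.symm (Bornology.cobounded ℂ) (Bornology.cobounded ℂ) := by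
  rw [← tendsto_norm_atTop_iff_cobounded, tendsto_atTop]
  intro R
  obtain ⟨M, hM⟩ := ((ProperSpace.isCompact_closedBall (0 : ℂ) R).image
    continuous_critGreen).bddAbove
  filter_upwards [tendsto_norm_cobounded_atTop.eventually (eventually_gt_atTop (max 1 (Real.exp M)))]
    with w hw
  have hwt : w ∈ coPhiHomeo.target := by
    rw [coPhiHomeo_target]
    exact (le_max_left _ _).trans_lt hw
  have hs : coPhiHomeo.symm w ∈ escaping := coPhiHomeo.map_target hwt
  have h1 : coPhi (coPhiHomeo.symm w) = w := coPhiHomeo.right_inv hwt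
  by_contra hlt
  have h2 : critGreen (coPhiHomeo.symm w) ≤ M := hM ⟨_, by simpa using (not_le.1 hlt).le, rfl⟩
  have h3 := norm_coPhi hs
  rw [h1] at h3
  have h4 := (le_max_right _ _).trans_lt hw
  rw [h3] at h4
  exact absurd (Real.exp_lt_exp.1 h4) (not_lt.2 h2)

/-! ### The branched covering -/

/-- Branched coverings are invariant under changes of coordinates. -/
theorem IsBranchedCoveringOn.of_charts {X Y : Type*} [TopologicalSpace X] [TopologicalSpace Y]
    {g : ℂ → ℂ} {D D' : Set ℂ} {d : ℕ} {e : ℂ → ℕ} (hg : IsBranchedCoveringOn g D D' d e)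
    {h : X → Y} (κ : OpenPartialHomeomorph X ℂ) (b : OpenPartialHomeomorph Y ℂ)
    (hκ : κ.target = D) (hb : b.target = D') (hmaps : Set.MapsTo h κ.source b.source)
    (hconj : ∀ x ∈ κ.source, b (h x) = g (κ x)) :
    IsBranchedCoveringOn h κ.source b.source d (e ∘ κ) where
  mapsTo := hmaps
  model y hy := by
    classical
    subst hκ hb
    obtain ⟨F, ψ, χ, hF, hsum, hyψ, hψV, hψy, hψt, hpre, hdisj, hχ⟩ := hg.model (b y) (b.map_source hy)
    have hFt : ∀ u ∈ F, u ∈ κ.target := fun u hu => (hF.subset hu).1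
    have hχt : ∀ u ∈ F, (χ u).source ⊆ κ.target := fun u hu v hv =>
      (hpre.symm.subset (Set.mem_biUnion (Finset.mem_coe.2 hu) hv)).1
    have hFi : ∀ x, x ∈ F.image κ.symm ↔ x ∈ κ.source ∧ κ x ∈ F := by
      intro x
      rw [Finset.mem_image]
      constructor
      · rintro ⟨u, hu, rfl⟩
        exact ⟨κ.map_target (hFt u hu), by rwa [κ.right_inv (hFt u hu)]⟩
      · rintro ⟨hx, hxF⟩
        exact ⟨κ x, hxF, κ.left_inv hx⟩
    have hsrc : ∀ x, ((fun x => κ.trans (χ (κ x))) x).source =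
        κ.source ∩ κ ⁻¹' (χ (κ x)).source := fun x => by
      simp only [OpenPartialHomeomorph.trans_source]
    refine ⟨F.image κ.symm, b.trans ψ, fun x => κ.trans (χ (κ x)), ?_, ?_, ?_, ?_, ?_, ?_, ?_, ?_, ?_⟩
    · ext x
      rw [Finset.mem_coe, hFi]
      constructor
      · rintro ⟨hx, hxF⟩
        have h1 := (hF.subset hxF).2
        have h2 : g (κ x) = b y := h1
        exact ⟨hx, b.injOn (hmaps hx) hy ((hconj x hx).trans h2)⟩
      · rintro ⟨hx, hxy⟩
        have hxy : h x = y := hxy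
        exact ⟨hx, hF.symm.subset ⟨κ.map_source hx, show g (κ x) = b y by rw [← hconj x hx, hxy]⟩⟩
    · rw [Finset.sum_image, ← hsum]
      · refine Finset.sum_congr rfl fun u hu => ?_
        rw [Function.comp, κ.right_inv (hFt u hu)]
      · intro u hu v hv huv
        exact κ.symm.injOn (hFt u hu) (hFt v hv) huv
    · rw [OpenPartialHomeomorph.trans_source]
      exact ⟨hy, hyψ⟩
    · rw [OpenPartialHomeomorph.trans_source]
      exact Set.inter_subset_left
    · exact hψy
    · rw [OpenPartialHomeomorph.trans_target, hψt, Set.inter_eq_left, ← hψt]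
      intro u hu
      exact hψV (ψ.map_target hu)
    · ext x
      simp only [Set.mem_iUnion, hsrc, OpenPartialHomeomorph.trans_source, exists_prop, hFi]
      constructor
      · rintro ⟨hx, -, hx2⟩
        have hx2 : b (h x) ∈ ψ.source := hx2
        rw [hconj x hx] at hx2
        have := hpre.subset (⟨κ.map_source hx, hx2⟩ : κ x ∈ κ.target ∩ g ⁻¹' ψ.source)
        simp only [Set.mem_iUnion, exists_prop] at this
        obtain ⟨u, hu, hxu⟩ := this
        refine ⟨κ.symm u, ⟨κ.map_target (hFt u hu), ?_⟩, hx, ?_⟩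
        · rwa [κ.right_inv (hFt u hu)]
        · rw [κ.right_inv (hFt u hu)]
          exact hxu
      · rintro ⟨x', ⟨hx', hx'F⟩, hx, hxs⟩
        refine ⟨hx, hmaps hx, ?_⟩
        change b (h x) ∈ ψ.source
        rw [hconj x hx]
        exact (hpre.symm.subset (Set.mem_biUnion (Finset.mem_coe.2 hx'F) hxs)).2
    · intro x hx x' hx' hne
      obtain ⟨hx1, hxF⟩ := (hFi x).1 hx
      obtain ⟨hx1', hxF'⟩ := (hFi x').1 hx'
      have := hdisj hxF hxF' fun h => hne (κ.injOn hx1 hx1' h)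
      change Disjoint (κ.trans (χ (κ x))).source (κ.trans (χ (κ x'))).source
      rw [OpenPartialHomeomorph.trans_source, OpenPartialHomeomorph.trans_source]
      exact (Disjoint.preimage κ this).mono Set.inter_subset_right Set.inter_subset_right
    · intro x hx
      obtain ⟨hx1, hxF⟩ := (hFi x).1 hx
      obtain ⟨h1, h2, h3, h4, h5⟩ := hχ _ hxF
      refine ⟨?_, h2, ?_, h4, ?_⟩
      · rw [hsrc]
        exact ⟨hx1, h1⟩
      · simp only [OpenPartialHomeomorph.trans_target]
        rw [h3, Set.inter_eq_left, ← h3]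
        intro u hu
        exact hχt _ hxF ((χ (κ x)).map_target hu)
      · intro u hu
        rw [hsrc] at hu
        have := h5 (κ u) hu.2
        rw [← hconj u hu.1] at this
        exact this

/-! ### Coordinates on the sphere at infinity. -/

theorem coe_tendsto_infty : Tendsto ((↑) : ℂ → OnePoint ℂ) (Bornology.cobounded ℂ) (𝓝 ∞) := by
  rw [Metric.cobounded_eq_cocompact, ← Filter.coclosedCompact_eq_cocompact]
  exact OnePoint.tendsto_coe_infty

theorem isOpen_withInfty {S : Set ℂ} (hS : IsOpen S) (hc : S ∈ Bornology.cobounded ℂ) :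
    IsOpen (withInfty S) := by
  have hpre : ((↑) : ℂ → OnePoint ℂ) ⁻¹' withInfty S = S := by
    ext a
    simp [withInfty]
  rw [OnePoint.isOpen_iff_of_mem (Or.inl rfl), hpre]
  refine ⟨hS.isClosed_compl, Metric.isCompact_of_isClosed_isBounded hS.isClosed_compl ?_⟩
  rw [← Bornology.isCobounded_compl_iff, compl_compl]
  exact hc

/-- A homeomorphism onto the exterior of the closed unit disc which is proper at `∞` gives a
coordinate on the sphere, centred at `∞`, with values in the unit disc. -/
def inftyChart (E : OpenPartialHomeomorph ℂ ℂ) (hE : E.target = {w | 1 < ‖w‖})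
    (hc : E.source ∈ Bornology.cobounded ℂ)
    (h1 : Tendsto E (Bornology.cobounded ℂ) (Bornology.cobounded ℂ))
    (h2 : Tendsto E.symm (Bornology.cobounded ℂ) (Bornology.cobounded ℂ)) :
    OpenPartialHomeomorph (OnePoint ℂ) ℂ where
  toFun x := x.elim 0 fun a => (E a)⁻¹
  invFun u := if u = 0 then ∞ else (E.symm u⁻¹ : ℂ)
  source := withInfty E.source
  target := Metric.ball 0 1
  map_source' := by
    rintro x (rfl | ⟨a, ha, rfl⟩)
    · simp
    · have : E a ∈ E.target := E.map_source ha
      rw [hE] at this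
      have : 1 < ‖E a‖ := this
      rw [mem_ball_zero_iff]
      simpa using inv_lt_one_of_one_lt₀ this
  map_target' := by
    intro u hu
    by_cases h0 : u = 0
    · simp only [h0, if_true]
      exact Or.inl rfl
    · simp only [h0, if_false]
      refine Or.inr ⟨_, E.map_target ?_, rfl⟩
      rw [hE]
      change 1 < ‖u⁻¹‖
      rw [norm_inv]
      exact one_lt_inv₀ (norm_pos_iff.2 h0) |>.2 (mem_ball_zero_iff.1 hu)
  left_inv' := by
    rintro x (rfl | ⟨a, ha, rfl⟩)
    · simp
    · have : E a ∈ E.target := E.map_source ha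
      rw [hE] at this
      have : 1 < ‖E a‖ := this
      have h0 : E a ≠ 0 := norm_pos_iff.1 (by linarith)
      simp [h0, E.left_inv ha]
  right_inv' := by
    intro u hu
    by_cases h0 : u = 0
    · simp [h0]
    · have : u⁻¹ ∈ E.target := by
        rw [hE]
        change 1 < ‖u⁻¹‖
        rw [norm_inv]
        exact one_lt_inv₀ (norm_pos_iff.2 h0) |>.2 (mem_ball_zero_iff.1 hu)
      simp [h0, E.right_inv this]
  continuousOn_toFun := by
    rintro x (rfl | ⟨a, ha, rfl⟩)
    · refine ContinuousAt.continuousWithinAt ?_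
      rw [OnePoint.continuousAt_infty', Filter.coclosedCompact_eq_cocompact,
        ← Metric.cobounded_eq_cocompact]
      exact tendsto_inv₀_cobounded.comp h1
    · refine ContinuousAt.continuousWithinAt ?_
      rw [OnePoint.continuousAt_coe]
      have : E a ∈ E.target := E.map_source ha
      rw [hE] at this
      have : 1 < ‖E a‖ := this
      exact (E.continuousAt ha).inv₀ (norm_pos_iff.1 (by linarith))
  continuousOn_invFun := by
    intro u hu
    refine ContinuousAt.continuousWithinAt ?_
    by_cases h0 : u = 0
    · subst h0
      rw [continuousAt_iff_punctured_nhds]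
      simp only [if_true]
      refine (coe_tendsto_infty.comp (h2.comp tendsto_inv₀_nhdsNE_zero)).congr' ?_
      filter_upwards [self_mem_nhdsWithin] with v hv
      have hv : v ≠ 0 := hv
      simp [hv]
    · have ht : u⁻¹ ∈ E.target := by
        rw [hE]
        change 1 < ‖u⁻¹‖
        rw [norm_inv]
        exact one_lt_inv₀ (norm_pos_iff.2 h0) |>.2 (mem_ball_zero_iff.1 hu)
      have h3 : ContinuousAt (fun v : ℂ => ((E.symm v⁻¹ : ℂ) : OnePoint ℂ)) u :=
        OnePoint.continuous_coe.continuousAt.comp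
          (ContinuousAt.comp (g := E.symm) (f := fun v : ℂ => v⁻¹) (E.symm.continuousAt ht)
            (continuousAt_inv₀ h0))
      refine h3.congr ?_
      filter_upwards [isOpen_ne.mem_nhds h0] with v hv
      have hv : v ≠ 0 := hv
      simp [hv]
  open_source := isOpen_withInfty E.open_source hc
  open_target := Metric.isOpen_ball

/-- The affine coordinate on the disc of centre `y` and radius `r`, with values in the unit disc. -/
def discChart (y : ℂ) {r : ℝ} (hr : 0 < r) : OpenPartialHomeomorph ℂ ℂ where
  toFun w := (w - y) / r
  invFun v := y + r * v
  source := Metric.ball y r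
  target := Metric.ball 0 1
  map_source' := by
    intro w hw
    rw [mem_ball_zero_iff, norm_div, Complex.norm_real, Real.norm_of_nonneg hr.le, div_lt_one hr]
    exact mem_ball_iff_norm.1 hw
  map_target' := by
    intro v hv
    rw [mem_ball_iff_norm, add_sub_cancel_left, norm_mul, Complex.norm_real,
      Real.norm_of_nonneg hr.le]
    have := mem_ball_zero_iff.1 hv
    nlinarith
  left_inv' := by
    intro w _
    have : (r : ℂ) ≠ 0 := Complex.ofReal_ne_zero.2 hr.ne'
    field_simp
    ring
  right_inv' := by
    intro w _
    have : (r : ℂ) ≠ 0 := Complex.ofReal_ne_zero.2 hr.ne'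
    field_simp
    ring
  continuousOn_toFun := by fun_prop
  continuousOn_invFun := by fun_prop
  open_source := Metric.isOpen_ball
  open_target := Metric.isOpen_ball

/-! ### The cube map on the unit disc. -/

theorem three_mul_im_sq_lt {t : ℂ} (h : 0 < t.re) (h3 : 0 < (t ^ 3).re) :
    3 * t.im ^ 2 < t.re ^ 2 := by
  have e : (t ^ 3).re = t.re * (t.re ^ 2 - 3 * t.im ^ 2) := by
    simp [pow_succ]; ring
  rw [e] at h3
  have := pos_of_mul_pos_right h3 h.le
  linarith

/-- Both arguments are less than `π/6` in absolute value by `three_mul_im_sq_lt`, so the arguments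
cannot differ by a third of a turn. This separates the sheets of the cube map using only the sign of
a real part. -/
theorem eq_of_cube_eq {s t : ℂ} (hs : 0 < s.re) (ht : 0 < t.re) (hs3 : 0 < (s ^ 3).re)
    (h : s ^ 3 = t ^ 3) : s = t := by
  have h1 := three_mul_im_sq_lt hs hs3
  have h2 := three_mul_im_sq_lt ht (h ▸ hs3)
  have e : (s - t) * (s ^ 2 + s * t + t ^ 2) = 0 := by linear_combination h
  rcases mul_eq_zero.1 e with h0 | h0
  · exact sub_eq_zero.1 h0
  · exfalso
    have h3 := congrArg Complex.re h0
    simp [pow_two] at h3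
    nlinarith [mul_pos hs ht, sq_nonneg (s.im - t.im), sq_nonneg (s.im + t.im)]

theorem cbrt_re_pos {w : ℂ} (hw : w ≠ 0) : 0 < (w ^ (((3 : ℕ) : ℂ)⁻¹)).re := by
  have h2 : (Complex.log w * (((3 : ℕ) : ℂ)⁻¹)).im = w.arg / 3 := by
    rw [show Complex.log w * (((3 : ℕ) : ℂ)⁻¹) = Complex.log w / (3 : ℝ) by
      push_cast; ring, Complex.div_ofReal_im, Complex.log_im]
  rw [Complex.cpow_def_of_ne_zero hw, Complex.exp_re, h2]
  refine mul_pos (Real.exp_pos _) (Real.cos_pos_of_mem_Ioo ?_)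
  have := Real.pi_pos
  constructor <;> linarith [Complex.neg_pi_lt_arg w, Complex.arg_le_pi w]

theorem re_div_pos_of_mem_ball {y w : ℂ} {r : ℝ} (hr : r ≤ ‖y‖) (hw : w ∈ Metric.ball y r) :
    0 < (w / y).re := by
  have hy : 0 < ‖y‖ := (Metric.pos_of_mem_ball hw).trans_le hr
  have hy0 : y ≠ 0 := norm_pos_iff.1 hy
  have h1 : ‖1 - w / y‖ < 1 := by
    rw [show 1 - w / y = (y - w) / y by field_simp, norm_div, div_lt_one hy, norm_sub_rev]
    exact (mem_ball_iff_norm.1 hw).trans_le hr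
  have h2 := (Complex.re_le_norm _).trans_lt h1
  simp only [Complex.sub_re, Complex.one_re] at h2
  linarith

/-- The coordinate `u ↦ (u ^ 3 - y) / r` around a cube root `x` of `y ≠ 0`. -/
def cbrtChart (y x : ℂ) {r : ℝ} (hr : 0 < r) (hry : r ≤ ‖y‖) (hx : x ^ 3 = y) :
    OpenPartialHomeomorph ℂ ℂ where
  toFun u := discChart y hr (u ^ 3)
  invFun v := x * ((discChart y hr).symm v / y) ^ (((3 : ℕ) : ℂ)⁻¹)
  source := {u | u ^ 3 ∈ Metric.ball y r ∧ 0 < (u / x).re}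
  target := Metric.ball 0 1
  map_source' _ hu := (discChart y hr).map_source hu.1
  map_target' v hv := by
    have hy0 : y ≠ 0 := norm_pos_iff.1 (hr.trans_le hry)
    have hx0 : x ≠ 0 := by rintro rfl; simp at hx; exact hy0 hx.symm
    have hm := (discChart y hr).map_target hv
    have hre := re_div_pos_of_mem_ball hry hm
    refine ⟨?_, ?_⟩
    · rw [mul_pow, Complex.cpow_nat_inv_pow _ three_ne_zero, hx, mul_div_cancel₀ _ hy0]
      exact hm
    · rw [mul_div_cancel_left₀ _ hx0]
      exact cbrt_re_pos fun h => by rw [h] at hre; simp at hre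
  left_inv' u hu := by
    have hy0 : y ≠ 0 := norm_pos_iff.1 (hr.trans_le hry)
    have hx0 : x ≠ 0 := by rintro rfl; simp at hx; exact hy0 hx.symm
    have hre := re_div_pos_of_mem_ball hry hu.1
    have e : (u / x) ^ 3 = u ^ 3 / y := by rw [div_pow, hx]
    rw [(discChart y hr).left_inv hu.1, mul_comm, ← eq_div_iff hx0]
    refine eq_of_cube_eq (cbrt_re_pos fun h => ?_) hu.2 ?_ ?_
    · rw [h] at hre; simp at hre
    · rwa [Complex.cpow_nat_inv_pow _ three_ne_zero]
    · rw [Complex.cpow_nat_inv_pow _ three_ne_zero, e]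
  right_inv' v hv := by
    have hy0 : y ≠ 0 := norm_pos_iff.1 (hr.trans_le hry)
    rw [mul_pow, Complex.cpow_nat_inv_pow _ three_ne_zero, hx, mul_div_cancel₀ _ hy0]
    exact (discChart y hr).right_inv hv
  continuousOn_toFun := by
    refine (discChart y hr).continuousOn.comp (by fun_prop) fun u hu => hu.1
  continuousOn_invFun := by
    refine continuousOn_const.mul (ContinuousOn.cpow_const
      ((discChart y hr).continuousOn_symm.div_const y) fun v hv => Or.inl ?_)
    exact re_div_pos_of_mem_ball hry ((discChart y hr).map_target hv)
  open_source := (Metric.isOpen_ball.preimage (by fun_prop)).inter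
    (isOpen_lt continuous_const (Complex.continuous_re.comp (continuous_id.div_const x)))
  open_target := Metric.isOpen_ball

/-- The quotients of `u` by the three cube roots sum to `0`. If no real part were positive, all
would vanish, forcing a primitive cube root of unity to be real. -/
theorem exists_cube_root_re_pos {u x : ℂ} (hu : u ≠ 0) (hx : x ≠ 0) :
    ∃ x' : ℂ, x' ^ 3 = x ^ 3 ∧ 0 < (u / x').re := by
  by_contra! hno
  have hω := Complex.isPrimitiveRoot_exp 3 three_ne_zero
  set ω := Complex.exp (2 * Real.pi * Complex.I / (3 : ℕ))
  have hω3 : ω ^ 3 = 1 := hω.pow_eq_one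
  have hω1 : ω ≠ 1 := hω.ne_one (by norm_num)
  have hω0 : ω ≠ 0 := Complex.exp_ne_zero _
  have hsum : 1 + ω + ω ^ 2 = 0 := by
    have : (ω - 1) * (1 + ω + ω ^ 2) = 0 := by linear_combination hω3
    exact (mul_eq_zero.1 this).resolve_left (sub_ne_zero.2 hω1)
  set t := u / x with ht
  have ht0 : t ≠ 0 := div_ne_zero hu hx
  have h0 := hno x rfl
  have h1 : (t * ω).re ≤ 0 := by
    have := hno (x * ω ^ 2) (by linear_combination x ^ 3 * (ω ^ 3 + 1) * hω3)
    rwa [show u / (x * ω ^ 2) = t * ω by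
      rw [ht]; field_simp; linear_combination -hω3] at this
  have h2 : (t * ω ^ 2).re ≤ 0 := by
    have := hno (x * ω) (by linear_combination x ^ 3 * hω3)
    rwa [show u / (x * ω) = t * ω ^ 2 by
      rw [ht]; field_simp; linear_combination -hω3] at this
  have hs : t.re + (t * ω).re + (t * ω ^ 2).re = 0 := by
    rw [← Complex.add_re, ← Complex.add_re, show t + t * ω + t * ω ^ 2 = t * (1 + ω + ω ^ 2) by ring,
      hsum, mul_zero, Complex.zero_re]
  have h0 : t.re ≤ 0 := h0
  have e0 : t.re = 0 := by linarith
  have e1 : (t * ω).re = 0 := by linarith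
  have him : t.im ≠ 0 := fun h => ht0 (Complex.ext e0 h)
  rw [Complex.mul_re, e0, zero_mul, zero_sub, neg_eq_zero] at e1
  have hωi : ω.im = 0 := (mul_eq_zero.1 e1).resolve_left him
  have h3 := congrArg Complex.re hsum
  simp [pow_two, hωi] at h3
  nlinarith [sq_nonneg (ω.re + 1 / 2)]

theorem isBranchedCoveringOn_cube :
    IsBranchedCoveringOn (fun u : ℂ => u ^ 3) (Metric.ball 0 1) (Metric.ball 0 1) 3
      (fun u => if u = 0 then 3 else 1) where
  mapsTo u hu := by
    rw [mem_ball_zero_iff] at hu ⊢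
    rw [norm_pow]
    exact pow_lt_one₀ (norm_nonneg u) hu three_ne_zero
  model y hy := by
    have hball : ∀ u : ℂ, u ^ 3 ∈ Metric.ball (0 : ℂ) 1 ↔ u ∈ Metric.ball (0 : ℂ) 1 := fun u => by
      rw [mem_ball_zero_iff, mem_ball_zero_iff, norm_pow,
        pow_lt_one_iff_of_nonneg (norm_nonneg u) three_ne_zero]
    by_cases hy0 : y = 0
    · subst hy0
      have hs : (OpenPartialHomeomorph.ofSet (Metric.ball (0 : ℂ) 1) Metric.isOpen_ball).source =
        Metric.ball (0 : ℂ) 1 := rfl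
      refine ⟨{0}, OpenPartialHomeomorph.ofSet _ Metric.isOpen_ball,
        fun _ => OpenPartialHomeomorph.ofSet (Metric.ball 0 1) Metric.isOpen_ball, ?_, ?_, hy, subset_rfl, rfl, rfl,
        ?_, ?_, ?_⟩
      · ext u
        simp only [Finset.coe_singleton, Set.mem_singleton_iff, Set.mem_inter_iff,
          Set.mem_preimage, pow_eq_zero_iff three_ne_zero]
        exact ⟨fun h => ⟨h ▸ hy, h⟩, fun h => h.2⟩
      · simp
      · ext u
        simp only [hs, Finset.mem_singleton, Set.iUnion_iUnion_eq_left, Set.mem_inter_iff,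
          Set.mem_preimage, hball, and_self]
      · simp
      · intro x hx
        rw [Finset.mem_singleton] at hx
        subst hx
        exact ⟨hy, rfl, rfl, by simp, fun u _ => by simp⟩
    · have hypos := norm_pos_iff.2 hy0
      have hy1 : ‖y‖ < 1 := mem_ball_zero_iff.1 hy
      -- The disc of this radius about `y` stays in the unit disc and in the half plane `Re (w / y)
      -- > 0`, so it avoids `0` and its preimage splits into three sheets, one around each cube
      -- root.
      set r := min ‖y‖ (1 - ‖y‖) with hrdef
      have hr : 0 < r := lt_min hypos (by linarith)
      have hry : r ≤ ‖y‖ := min_le_left _ _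
      have hsub : Metric.ball y r ⊆ Metric.ball 0 1 := by
        refine Metric.ball_subset_ball' ?_
        rw [dist_zero_right]
        linarith [min_le_right ‖y‖ (1 - ‖y‖)]
      obtain ⟨x₀, hx₀⟩ := IsAlgClosed.exists_pow_nat_eq y three_pos
      have hroot : ∀ x : ℂ, x ∈ (Polynomial.nthRoots 3 y).toFinset ↔ x ^ 3 = y := fun x => by
        rw [Multiset.mem_toFinset, Polynomial.mem_nthRoots three_pos]
      have hne : ∀ x : ℂ, x ^ 3 = y → x ≠ 0 := by
        rintro x hx rfl
        simp at hx
        exact hy0 hx.symm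
      have hcard : (Polynomial.nthRoots 3 y).toFinset.card = 3 := by
        have hω := Complex.isPrimitiveRoot_exp 3 three_ne_zero
        rw [Multiset.toFinset_card_of_nodup (hω.nthRoots_nodup hy0),
          hω.card_nthRoots, if_pos ⟨x₀, hx₀⟩]
      classical
      set χ : ℂ → OpenPartialHomeomorph ℂ ℂ := fun x =>
        if hx : x ^ 3 = y then cbrtChart y x hr hry hx else discChart y hr with hχ
      have hχs : ∀ x, x ^ 3 = y → (χ x).source =
          {u | u ^ 3 ∈ Metric.ball y r ∧ 0 < (u / x).re} := fun x hx => by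
        rw [hχ]; simp only [hx, dite_true]; rfl
      refine ⟨(Polynomial.nthRoots 3 y).toFinset, discChart y hr, χ, ?_, ?_,
        Metric.mem_ball_self hr, hsub, ?_, rfl, ?_, ?_, ?_⟩
      · ext x
        rw [Finset.mem_coe, hroot]
        refine ⟨fun h => ⟨(hball x).1 (h ▸ hy), h⟩, fun h => h.2⟩
      · rw [Finset.sum_congr rfl fun x hx => if_neg (hne x ((hroot x).1 hx))]
        simp [hcard]
      · simp [discChart]
      · ext u
        simp only [Set.mem_iUnion, exists_prop, hroot]
        constructor
        · rintro ⟨-, hu⟩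
          have hu : u ^ 3 ∈ Metric.ball y r := hu
          have hu0 : u ≠ 0 := by
            rintro rfl
            have := re_div_pos_of_mem_ball hry hu
            simp at this
          obtain ⟨x, hx, hre⟩ := exists_cube_root_re_pos hu0 (hne x₀ hx₀)
          rw [hx₀] at hx
          refine ⟨x, hx, ?_⟩
          rw [hχs x hx]
          exact ⟨hu, hre⟩
        · rintro ⟨x, hx, hu⟩
          rw [hχs x hx] at hu
          exact ⟨(hball u).1 (hsub hu.1), hu.1⟩
      · intro x hx x' hx' hxx
        rw [Finset.mem_coe, hroot] at hx hx'
        change Disjoint (χ x).source (χ x').source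
        rw [hχs x hx, hχs x' hx', Set.disjoint_left]
        rintro u ⟨hu, hux⟩ ⟨-, hux'⟩
        refine hxx ?_
        have hre := re_div_pos_of_mem_ball hry hu
        have h1 : u / x = u / x' := by
          refine eq_of_cube_eq hux hux' ?_ ?_
          · rwa [div_pow, hx]
          · rw [div_pow, div_pow, hx, hx']
        have hu0 : u ≠ 0 := by
          rintro rfl
          simp at hux
        have := hne x hx
        have := hne x' hx'
        field_simp at h1
        exact h1.symm
      · intro x hx
        rw [hroot] at hx
        have hx0 := hne x hx
        have hχx : χ x = cbrtChart y x hr hry hx := by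
          rw [hχ]; simp only [hx, dite_true]
        refine ⟨?_, ?_, ?_, ?_, ?_⟩
        · rw [hχs x hx]
          exact ⟨hx ▸ Metric.mem_ball_self hr, by rw [div_self hx0]; simp⟩
        · rw [hχx]
          change discChart y hr (x ^ 3) = 0
          rw [hx]
          simp [discChart]
        · rw [hχx]; rfl
        · simp [hx0]
        · intro u _
          simp only [if_neg hx0, pow_one]
          rw [hχx]; rfl

/-- The coordinate `1 / coPhi` on the source and `1 / w` on the target conjugate the extended `Phi`
to cubing on the unit disc; `∞` is the only point with coordinate `0`. -/
theorem isBranchedCoveringOn_Phi : ∃ e : OnePoint ℂ → ℕ,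
    IsBranchedCoveringOn (OnePoint.map Phi) (withInfty escaping) (withInfty {w : ℂ | 1 < ‖w‖}) 3 e ∧
    ∀ x ∈ withInfty escaping, e x ≠ 1 ↔ x = ∞ := by
  have hopen : IsOpen {w : ℂ | 1 < ‖w‖} := isOpen_lt continuous_const continuous_norm
  set κ := inftyChart coPhiHomeo coPhiHomeo_target eventually_mem_escaping tendsto_coPhi
    tendsto_coPhiHomeo_symm with hκ
  set b := inftyChart (OpenPartialHomeomorph.ofSet _ hopen) rfl
    (tendsto_norm_cobounded_atTop.eventually (eventually_gt_atTop 1)) tendsto_id tendsto_id with hb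
  have hκs : κ.source = withInfty escaping := rfl
  have hbs : b.source = withInfty {w : ℂ | 1 < ‖w‖} := rfl
  have hmaps : Set.MapsTo (OnePoint.map Phi) κ.source b.source := by
    rintro x (rfl | ⟨a, ha, rfl⟩)
    · exact Or.inl rfl
    · refine Or.inr ⟨Phi a, ?_, rfl⟩
      change 1 < ‖Phi a‖
      rw [← coPhi_pow_three ha, norm_pow]
      exact one_lt_pow₀ (one_lt_norm_coPhi ha) three_ne_zero
  have hconj : ∀ x ∈ κ.source, b (OnePoint.map Phi x) = κ x ^ 3 := by
    rintro x (rfl | ⟨a, ha, rfl⟩)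
    · exact (zero_pow three_ne_zero).symm
    · change (Phi a)⁻¹ = (coPhi a)⁻¹ ^ 3
      rw [← coPhi_pow_three ha, inv_pow]
  refine ⟨(fun u => if u = 0 then 3 else 1) ∘ κ,
    isBranchedCoveringOn_cube.of_charts κ b rfl rfl hmaps hconj, ?_⟩
  rintro x (rfl | ⟨a, ha, rfl⟩)
  · have : κ ∞ = 0 := rfl
    simp [this]
  · have : κ a = (coPhi a)⁻¹ := rfl
    simp [this, coPhi_ne_zero ha]

end PerOne

end

theorem mainTheorem10 :
    IsConnected PerOne.escapeLocus ∧
    -- the parameter map is well defined on the escape locus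
    (∀ a ∈ PerOne.escapeLocus, a ∉ PerOne.slit ∧ PerOne.IsBottcher a (PerOne.bottcher a) ∧
      PerOne.vMinus a ∈ PerOne.bottcherDomain a) ∧
    DifferentiableOn ℂ PerOne.Phi PerOne.escapeLocus ∧
    -- extended by `∞ ↦ ∞`, it is a branched covering of degree 3, ramified exactly at `∞`
    ∃ e : OnePoint ℂ → ℕ,
      PerOne.IsBranchedCoveringOn (OnePoint.map PerOne.Phi) (PerOne.withInfty PerOne.escapeLocus)
        (PerOne.withInfty {w : ℂ | 1 < ‖w‖}) 3 e ∧
      ∀ x ∈ PerOne.withInfty PerOne.escapeLocus, e x ≠ 1 ↔ x = OnePoint.infty := by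
  rw [PerOne.escapeLocus_eq]
  refine ⟨PerOne.isConnected_escaping, fun a ha => ⟨(PerOne.escape_facts ha).1,
    PerOne.isBottcher_bottcher a,
    PerOne.mem_bottcherDomain_iff.2 (PerOne.critGreen_lt_green_vMinus ha)⟩, ?_,
    PerOne.isBranchedCoveringOn_Phi⟩
  have h : DifferentiableOn ℂ (fun a => PerOne.coPhi a ^ 3) PerOne.escaping := fun a ha =>
    ((PerOne.analyticAt_coPhi ha).differentiableAt.pow 3).differentiableWithinAt
  exact h.congr fun a ha => (PerOne.coPhi_pow_three ha).symm
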